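/- Let $\Bbbk$ be an algebraically closed field of characteristic $0$, let $n\ge 3$, let $r_1,\dots,r_n$ be positive integers, and put $d=\sum_{k=1}^n r_k$. Let $Q_0=\{d+1,\dots,2d\}$ and, for $i\in[n]=\{1,\dots,n\}$, let $$Q_i^+=\Big\{\sum_{k<i}r_k+1,\dots,\sum_{k\le i}r_k\Big\},\qquad Q_i^-=\Big\{d+\sum_{k<i}r_k+1,\dots,d+\sum_{k\le i}r_k\Big\},\qquad Q_i=Q_i^+\cup(Q_0\setminus Q_i^-).$$ Let $G=G_{r_1,\dots,r_n}$ be the graph on the vertex set $\{1,\dots,2d\}$ in which two distinct vertices are adjacent if and only if some $Q_i$ ($0\le i\le n$) contains both. Then: (i) The sets $Q_0,Q_1,\dots,Q_n$ are pairwise distinct and are precisely the maximal cliques of $G$. (ii) A set $S$ of vertices is a maximal stable set of $G$ if and only if either $S=\{v,v'\}$ for some $i\in[n]$, $v\in Q_i^+$, $v'\in Q_i^-$, or $S=\{v_1,\dots,v_n\}$ with $v_i\in Q_i^+$ for every $i\in[n]$. (iii) $G$ is chordal (every cycle of length at least $4$ has a chord), hence perfect (every induced subgraph has chromatic number equal to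 its clique number), but $G$ is not a comparability graph: there is no partial order on the vertex set for which the edges of $G$ are exactly the pairs of distinct comparable elements. Consequently the stable set polytope of $G$ (the convex hull in $\mathbb R^{2d}$ of the indicator vectors of the stable sets) is not the chain polytope $\{x\in\mathbb R^{2d}_{\ge 0} : \sum_{v\in C}x_v\le 1 \text{ for every chain } C\}$ of any partial order on $\{1,\dots,2d\}$. (iv) The stable set ring $\Bbbk[\mathrm{Stab}_G]=\Bbbk\big[\,t_0\prod_{v\in S}t_v : S \text{ a stable set of } G\,\big]\subset \Bbbk[t_0,t_1,\dots,t_{2d}]$ is Gorenstein, and its divisor class group (Weil divisors modulo principal divisors) is isomorphic to $\mathbb Z^n$. (v) For multisets $I,J$ of elements of $\{0,1,\dots,n\}$ and a vertex $v$ let $m_{IJ}(v)=|\{i\in I: v\in Q_i\}|-|\{j\in J: v\in Q_j\}|$ (counted with multiplicity), and let $\mathcal C(G)$ be the set of all $(z_1,\dots,z_n)\in\mathbb R^n$ such that, with $z_0=0$, $$-|J|+\sum_{v:\,m_{IJ}(v)<0}m_{IJ}(v)+1\ \le\ \sum_{i\in I}z_i-\sum_{j\in J}z_j\ \le\ |I|+\sum_{v:\,m_{IJ}(v)>0}m_{IJ}(v)-1$$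 for all nonempty multisets $I,J$ with $|I|=|J|$ and $I\cap J=\emptyset$. Then $$\mathcal C(G)=\{(z_1,\dots,z_n)\in\mathbb R^n : -r_i\le z_i\le r_i \text{ for all } i\in[n]\}.$$ -/

import Mathlib

namespace StabFamily

/-! ### Graph-theoretic notions -/

section Graphs

variable {V : Type*}

/-- A graph is chordal if each of its cycles of length at least `4` has a chord, that is, an edge
joining two vertices of the cycle which is not an edge of the cycle. -/
def IsChordal (G : SimpleGraph V) : Prop :=
  ∀ (u : V) (c : G.Walk u u), c.IsCycle → 4 ≤ c.length →
    ∃ x ∈ c.support, ∃ y ∈ c.support, G.Adj x y ∧ s(x, y) ∉ c.edges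

/-- A (finite) graph is perfect if the chromatic number of each induced subgraph equals
its clique number. -/
def IsPerfect (G : SimpleGraph V) : Prop :=
  ∀ s : Set V, (G.induce s).chromaticNumber = ((G.induce s).cliqueNum : ℕ∞)

/-- `G` is a comparability graph if its edges are the pairs of distinct comparable elements
for some partial order on the vertex set. -/
def IsComparabilityGraph (G : SimpleGraph V) : Prop :=
  ∃ P : PartialOrder V, ∀ u v : V, G.Adj u v ↔ u ≠ v ∧ (P.le u v ∨ P.le v u)

/-- The stable set polytope: the convex hull of the indicator vectors of the stable sets. -/
def stabPolytope (G : SimpleGraph V) : Set (V → ℝ) :=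
  convexHull ℝ {x | ∃ S : Set V, G.IsIndepSet S ∧ x = S.indicator 1}

/-- The chain polytope of a partial order on a finite set `V`: nonnegative vectors whose
coordinates sum to at most `1` along every chain. -/
def chainPolytope (P : PartialOrder V) : Set (V → ℝ) :=
  {x | (∀ v, 0 ≤ x v) ∧ ∀ C : Finset V, IsChain P.le (C : Set V) → ∑ v ∈ C, x v ≤ 1}

/-- The stable set ring: the `k`-subalgebra of the polynomial ring in variables `t_0`
(the variable `none`) and `t_v`, `v ∈ V` (the variable `some v`), generated by the monomials
`t_0 * ∏_{v ∈ S} t_v`, for `S` a stable set. -/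
noncomputable def stableSetRing (k : Type*) [Field k] (G : SimpleGraph V) :
    Subalgebra k (MvPolynomial (Option V) k) :=
  Algebra.adjoin k
    {f | ∃ S : Finset V, G.IsIndepSet (S : Set V) ∧
      f = MvPolynomial.X none * ∏ v ∈ S, MvPolynomial.X (some v)}

instance stableSetRing_isNoetherianRing [Finite V] (k : Type*) [Field k] (G : SimpleGraph V) :
    IsNoetherianRing (stableSetRing k G) := by
  have hfin : {f : MvPolynomial (Option V) k | ∃ S : Finset V, G.IsIndepSet (S : Set V) ∧
      f = MvPolynomial.X none * ∏ v ∈ S, MvPolynomial.X (some v)}.Finite := by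
    refine (Set.finite_range (fun S : Finset V =>
      (MvPolynomial.X none * ∏ v ∈ S, MvPolynomial.X (some v) :
        MvPolynomial (Option V) k))).subset ?_
    rintro f ⟨S, -, rfl⟩
    exact ⟨S, rfl⟩
  have hfg : (stableSetRing k G).FG := Subalgebra.fg_def.2 ⟨_, hfin, rfl⟩
  have : Algebra.FiniteType k (stableSetRing k G) :=
    (Subalgebra.fg_iff_finiteType _).1 hfg
  exact Algebra.FiniteType.isNoetherianRing k _

end Graphs

/-! ### The polytope attached to an enumerated family of maximal cliques -/

section ConicPolytope

variable {V : Type*} [DecidableEq V] {n : ℕ}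

/-- `m_{IJ}(v) = m_I(v) - m_J(v)`, where `m_L(v)` is the number of members `l` of the multiset
`L`, counted with multiplicity, such that `v ∈ Q_l`. -/
def mIJ (Q : Fin (n + 1) → Finset V) (I J : Multiset (Fin (n + 1))) (v : V) : ℤ :=
  (I.countP (fun l => v ∈ Q l) : ℤ) - (J.countP (fun l => v ∈ Q l) : ℤ)

/-- `∑_{i ∈ L} z_i` for a multiset `L` of indices `0, 1, …, n`, where `z_0 = 0` and
`z = (z_1, …, z_n)`. -/
def sumOver (z : Fin n → ℝ) (L : Multiset (Fin (n + 1))) : ℝ :=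
  (L.map (Fin.cons 0 z : Fin (n + 1) → ℝ)).sum

/-- The polytope `C(G)` of a finite graph with maximal cliques `Q_0, …, Q_n`.
The multisets `I`, `J` are nonempty: for `I = J = ∅` the inequality would read `1 ≤ 0 ≤ -1`. -/
def conicPolytope [Fintype V] (Q : Fin (n + 1) → Finset V) : Set (Fin n → ℝ) :=
  {z | ∀ I J : Multiset (Fin (n + 1)), I.card = J.card → Disjoint I J → I ≠ 0 →
    (-(J.card : ℝ) + (∑ v with mIJ Q I J v < 0, (mIJ Q I J v : ℝ)) + 1
        ≤ sumOver z I - sumOver z J) ∧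
    (sumOver z I - sumOver z J
        ≤ (I.card : ℝ) + (∑ v with 0 < mIJ Q I J v, (mIJ Q I J v : ℝ)) - 1)}

end ConicPolytope

/-! ### Gorenstein rings -/

/-- A commutative ring is Gorenstein if it is Noetherian and its localization at every maximal
ideal has finite injective dimension as a module over itself. -/
def IsGorenstein (R : Type*) [CommRing R] : Prop :=
  IsNoetherianRing R ∧ ∀ (m : Ideal R) [m.IsMaximal],
    ∃ i : ℕ, CategoryTheory.HasInjectiveDimensionLE
      (ModuleCat.of (Localization.AtPrime m) (Localization.AtPrime m)) i

/-! ### The divisor class group of a Noetherian domain -/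

section ClassGroup

variable (R : Type*) [CommRing R]

/-- Prime ideals of height one. -/
def HeightOnePrime : Type _ := {p : Ideal R // p.IsPrime ∧ p.height = 1}

variable {R}

instance (p : HeightOnePrime R) : p.1.IsPrime := p.2.1

instance (p : HeightOnePrime R) : Ring.KrullDimLE 1 (Localization.AtPrime p.1) := by
  have h := IsLocalization.AtPrime.ringKrullDim_eq_height p.1 (Localization.AtPrime p.1)
  rw [p.2.2] at h
  exact (Order.krullDimLE_iff _ _).2 (le_of_eq h)

variable [IsDomain R] [IsNoetherianRing R]

/-- The order along a height one prime `p` of a nonzero element of the fraction field: for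
`f = a / b` it is the length of `R_p / (a)` minus that of `R_p / (b)`. If `R` is normal, then `R_p`
is a discrete valuation ring and this is its valuation. -/
noncomputable def ordAt (p : HeightOnePrime R) : (FractionRing R)ˣ →* Multiplicative ℤ :=
  (WithZero.unitsWithZeroEquiv (α := Multiplicative ℤ)).toMonoidHom.comp
    (Units.map (Ring.ordFrac (K := FractionRing R) (Localization.AtPrime p.1)).toMonoidHom)

variable (R)

/-- The principal divisors, as a subgroup of the group of Weil divisors: those `D` for which
there is a nonzero element of the fraction field whose order along each height one prime `p`
is the coefficient of `D` at `p`. -/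
def principalDivisors : AddSubgroup (HeightOnePrime R →₀ ℤ) where
  carrier := {D | ∃ f : (FractionRing R)ˣ, ∀ p, D p = (ordAt p f).toAdd}
  zero_mem' := ⟨1, fun p => by simp⟩
  add_mem' := by
    rintro D E ⟨f, hf⟩ ⟨g, hg⟩
    exact ⟨f * g, fun p => by simp [hf, hg]⟩
  neg_mem' := by
    rintro D ⟨f, hf⟩
    exact ⟨f⁻¹, fun p => by simp [hf]⟩

/-- The divisor class group: Weil divisors modulo principal divisors. -/
abbrev DivisorClassGroup : Type _ := (HeightOnePrime R →₀ ℤ) ⧸ principalDivisors R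

end ClassGroup

/-! ### The graph `G_{r_1,…,r_n}`

The vertices `1, …, 2d` are numbered `0, …, 2d - 1`, and the indices `1, …, n` of the numbers `r_i`
are the elements of `Fin n`; the clique with index `0` is `Q_0`, and the clique with index
`i.succ` is the one attached to `r i`. -/

section Family

variable {n : ℕ} (r : Fin n → ℕ)

/-- `d = r_1 + ⋯ + r_n`. -/
def dim : ℕ := ∑ k, r k

/-- `Q_i^+`. -/
def Qplus (i : Fin n) : Finset (Fin (2 * dim r)) :=
  {v | ∑ k ∈ Finset.Iio i, r k ≤ v.val ∧ v.val < ∑ k ∈ Finset.Iic i, r k}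

/-- `Q_i^-`. -/
def Qminus (i : Fin n) : Finset (Fin (2 * dim r)) :=
  {v | dim r + ∑ k ∈ Finset.Iio i, r k ≤ v.val ∧ v.val < dim r + ∑ k ∈ Finset.Iic i, r k}

/-- `Q_0`. -/
def Qzero : Finset (Fin (2 * dim r)) := {v | dim r ≤ v.val}

/-- The sets `Q_0, Q_1, …, Q_n`. -/
def Q : Fin (n + 1) → Finset (Fin (2 * dim r)) :=
  Fin.cons (Qzero r) fun i => Qplus r i ∪ (Qzero r \ Qminus r i)

/-- The graph `G_{r_1,…,r_n}`: two distinct vertices are adjacent if some `Q_i` contains both. -/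
def graph : SimpleGraph (Fin (2 * dim r)) where
  Adj u v := u ≠ v ∧ ∃ i, u ∈ Q r i ∧ v ∈ Q r i
  symm := ⟨fun _ _ h => ⟨h.1.symm, h.2.imp fun _ hi => hi.symm⟩⟩
  loopless := ⟨fun _ h => h.1 rfl⟩

end Family

end StabFamily

/-! Index the vertices as `(i, a)^+` and `(i, a)^-` with `a < r i` (the bijection `vtx`). The minus
vertices form the clique `Q_0`; the closed neighbourhood of `(i, a)^+` is the clique `Q_i`, so every
plus vertex is simplicial. The maximal cliques and maximal stable sets can be read off. A cycle of
length at least 4 either meets a simplicial vertex or lies in `Q_0`, so it has a chord; perfection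
is an explicit colouring. Three minus vertices from different blocks and the three plus vertices of
the same blocks induce a 3-sun, whose edges have no transitive orientation. A stable set polytope
equal to a chain polytope would make the graph a comparability graph.

For the ring, the exponents of products of stable sets are exactly the lattice points satisfying the
clique inequalities (`closure_range_genExp`), so the ring is the monomial ring of a saturated
monoid. The Gorenstein property is proved from a homogeneous basis over a polynomial subring. (a)
The stable sets are distributed over `2d + 1` slots; the product of two different stable sets in one
slot can be rewritten with a factor in a lower slot (`exists_lower_slot`). Hence the slot sums are a
linear system of parameters. (b) Over `ZMod 2` these parameters form a regular sequence, by a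
Frobenius argument: raise a relation to a large power, use that powers of the variables are regular
in the parameter ring, and take a root (`monomialRing_regular`). This gives monomials which are a
basis modulo the parameters, with the expected Hilbert numerator. Spanning is the surjectivity of an
integer matrix, so the same monomials work in characteristic zero, and counting gives freeness over
the parameter ring (`exists_paramBasis`). (c) With the slack of the `Q_0` inequality fixed, the
blocks separate in the Hilbert function. The numerator of each block is reversed by `w ↦ -1 - w`,
and this reciprocity makes the h-vector symmetric with top degree `d` (`hVector_symm`). (d) For a
free graded domain with symmetric h-vector, the Gram matrix of the coordinate form of a top basis
element has nonzero determinant of degree zero, hence a unit. So the ring is isomorphic to its dual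
`Hom_P(R, P)`, which has finite injective dimension because the polynomial ring `P` does
(`isGorenstein_of_homogeneous_basis`).

For the class group, a height one prime containing a monomial is the prime of a facet, and any other
is the contraction of a principal prime of the polynomial ring. The latter are equivalent to
combinations of facet primes, so the group is the cokernel of the facet functionals
(`nonempty_divisorClassGroup_equiv`). There are `2d + n + 1` facets in rank `2d + 1`, and `classMap`
identifies the cokernel with `ℤ^n`.

For the polytope, `m_{IJ}` takes opposite values on `(i, a)^+` and `(i, a)^-`, namely the difference
of the multiplicities of `i` in `I` and `J`, up to sign. The pairs `I = {i}`, `J = {0}` give the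
box, and the triangle inequality gives all other pairs. -/

namespace StabFamily

open CategoryTheory

/-! ### Injective dimension over polynomial rings, and a Gorenstein criterion by self-duality. -/

section InjDim

universe u

variable {A B : Type u} [CommRing A] [CommRing B] (f : A →+* B)

/-- Coextension is right adjoint to restriction of scalars, which preserves monomorphisms. -/
instance coextendScalars_preservesInjectiveObjects :
    (ModuleCat.coextendScalars.{u, u, u} f).PreservesInjectiveObjects :=
  Functor.preservesInjectiveObjects_of_adjunction_of_preservesMonomorphisms
    (ModuleCat.restrictCoextendScalarsAdj.{u, u, u} f)

/-- `Hom_A(B, -)` is always left exact; projectivity of `B` over `A` is needed only to lift along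
`S.g` at the end. -/
theorem coextendScalars_shortExact
    [hproj : Module.Projective A ((ModuleCat.restrictScalars f).obj (ModuleCat.of B B))]
    {S : ShortComplex (ModuleCat.{u} A)} (hS : S.ShortExact)
    (T : ShortComplex (ModuleCat.{u} B)) (hT : T = ShortComplex.mk
      ((ModuleCat.coextendScalars.{u, u, u} f).map S.f)
      ((ModuleCat.coextendScalars.{u, u, u} f).map S.g) (by
        ext x s
        have h : ∀ y, S.g (S.f y) = 0 := fun y => by
          rw [← ModuleCat.comp_apply, S.zero]; rfl
        exact h _)) : T.ShortExact := by
  subst hT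
  have hinj : Function.Injective S.f := (ModuleCat.mono_iff_injective _).1 hS.mono_f
  have hsurj : Function.Surjective S.g := (ModuleCat.epi_iff_surjective _).1 hS.epi_g
  have hex := (ShortComplex.ShortExact.moduleCat_exact_iff_function_exact S).1 hS.exact
  refine { exact := ?_, mono_f := ?_, epi_g := ?_ }
  · rw [ShortComplex.ShortExact.moduleCat_exact_iff_function_exact]
    intro x
    constructor
    · intro hx
      have h1 : ∀ s, S.g (ModuleCat.CoextendScalars.equiv f _ x s) = 0 := fun s =>
        congrArg (fun y => ModuleCat.CoextendScalars.equiv f _ y s) hx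
      have h2 : ∀ s, ∃ y, S.f y = ModuleCat.CoextendScalars.equiv f _ x s := fun s =>
        (hex _).1 (h1 s)
      choose y hy using h2
      refine ⟨(ModuleCat.CoextendScalars.equiv f _).symm
        { toFun := y, map_add' := ?_, map_smul' := ?_ }, ?_⟩
      · intro a b; apply hinj; rw [map_add, hy, hy, hy, map_add]
      · intro a b; apply hinj
        rw [RingHom.id_apply, map_smul, hy, hy, map_smul]
      · apply ModuleCat.CoextendScalars.ext
        ext s
        exact hy s
    · rintro ⟨y, rfl⟩
      apply ModuleCat.CoextendScalars.ext
      ext s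
      exact (hex _).2 ⟨_, rfl⟩
  · rw [ModuleCat.mono_iff_injective]
    intro x y hxy
    apply ModuleCat.CoextendScalars.ext
    ext s
    apply hinj
    exact congrArg (fun y => ModuleCat.CoextendScalars.equiv f _ y s) hxy
  · rw [ModuleCat.epi_iff_surjective]
    intro x
    obtain ⟨g, hg⟩ := Module.projective_lifting_property S.g.hom
      (ModuleCat.CoextendScalars.equiv f _ x) hsurj
    refine ⟨(ModuleCat.CoextendScalars.equiv f _).symm g, ?_⟩
    apply ModuleCat.CoextendScalars.ext
    ext s
    exact LinearMap.congr_fun hg s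

/-- Dimension shifting: embed `N` in an injective module and apply coextension, which keeps both the
injective and the exact sequence. -/
theorem coextendScalars_hasInjectiveDimensionLE
    [hproj : Module.Projective A ((ModuleCat.restrictScalars f).obj (ModuleCat.of B B))] (n : ℕ)
    (N : ModuleCat.{u} A) [HasInjectiveDimensionLE N n] :
    HasInjectiveDimensionLE ((ModuleCat.coextendScalars.{u, u, u} f).obj N) n := by
  induction n generalizing N with
  | zero =>
    have injle : HasInjectiveDimensionLE N 0 := ‹_›
    simp only [HasInjectiveDimensionLE, zero_add, ← injective_iff_hasInjectiveDimensionLT_one]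
      at injle ⊢
    infer_instance
  | succ n ih =>
    rcases (inferInstance : EnoughInjectives (ModuleCat.{u} A)).1 N with ⟨I, inj, g, monog⟩
    let T := ShortComplex.mk g (Limits.cokernel.π g) (Limits.cokernel.condition g)
    have T_exact : T.ShortExact := { exact := ShortComplex.exact_cokernel g }
    have TS_exact := coextendScalars_shortExact f T_exact _ rfl
    let _ := (T_exact.hasInjectiveDimensionLT_X₃_iff n ‹_›).mpr ‹_›
    have : Injective ((ModuleCat.coextendScalars.{u, u, u} f).obj T.X₂) :=
      (ModuleCat.coextendScalars.{u, u, u} f).injective_obj _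
    exact (TS_exact.hasInjectiveDimensionLT_X₃_iff n this).mp (ih T.X₃)

section Coext

variable (A B : Type u) [CommRing A] [CommRing B] [Algebra A B] (N : Type u) [AddCommGroup N]
  [Module A N]

/-- The coextension `Hom_A(B, N)` of an `A`-module `N`, as a `B`-module. -/
def Coext : Type u := B →ₗ[A] N

instance : AddCommGroup (Coext A B N) := inferInstanceAs (AddCommGroup (B →ₗ[A] N))

variable {A B N}

/-- A linear map, viewed as an element of the coextension. -/
def Coext.of : (B →ₗ[A] N) ≃+ Coext A B N := AddEquiv.refl _

instance : FunLike (Coext A B N) B N := inferInstanceAs (FunLike (B →ₗ[A] N) B N)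

instance : LinearMapClass (Coext A B N) A B N :=
  inferInstanceAs (LinearMapClass (B →ₗ[A] N) A B N)

theorem Coext.ext {g h : Coext A B N} (H : ∀ b, g b = h b) : g = h := DFunLike.ext _ _ H

instance : Module B (Coext A B N) where
  smul b g := Coext.of ((Coext.of.symm g).comp (LinearMap.mulRight A b))
  one_smul g := Coext.ext fun c => congrArg g (mul_one c)
  mul_smul a b g := Coext.ext fun c => congrArg g (by
    simp only [LinearMap.mulRight_apply]; ring)
  smul_zero a := Coext.ext fun c => rfl
  smul_add a g h := Coext.ext fun c => rfl
  add_smul a b g := Coext.ext fun c => (congrArg g (mul_add c a b)).trans (map_add g _ _)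
  zero_smul g := Coext.ext fun c => (congrArg g (mul_zero c)).trans (map_zero g)

@[simp] theorem Coext.smul_apply (b : B) (g : Coext A B N) (c : B) : (b • g) c = g (c * b) := rfl

@[simp] theorem Coext.of_apply (g : B →ₗ[A] N) (c : B) : Coext.of g c = g c := rfl

@[simp] theorem Coext.add_apply (g h : Coext A B N) (c : B) : (g + h) c = g c + h c := rfl

@[simp] theorem Coext.zero_apply (c : B) : (0 : Coext A B N) c = 0 := rfl

/-- Transports the categorical statement to the concrete module `Coext`, where elements are linear
maps and `b • g` is `c ↦ g (c * b)`. -/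
theorem Coext.hasInjectiveDimensionLE [Module.Projective A B] (n : ℕ)
    [HasInjectiveDimensionLE (ModuleCat.of A N) n] :
    HasInjectiveDimensionLE (ModuleCat.of B (Coext A B N)) n := by
  have hsmul : ∀ (a : A) (b : (ModuleCat.restrictScalars (algebraMap A B)).obj
      (ModuleCat.of B B)), a • b = (a • (show B from b) : B) := fun a b =>
    (Algebra.smul_def a (show B from b)).symm
  let e : B ≃ₗ[A] (ModuleCat.restrictScalars (algebraMap A B)).obj (ModuleCat.of B B) :=
    { AddEquiv.refl B with map_smul' := fun a b => (hsmul a b).symm }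
  have : Module.Projective A ((ModuleCat.restrictScalars (algebraMap A B)).obj
      (ModuleCat.of B B)) := Module.Projective.of_equiv e
  have h := coextendScalars_hasInjectiveDimensionLE (algebraMap A B) n (ModuleCat.of A N)
  refine (ModuleCat.hasInjectiveDimensionLE_iff_of_linearEquiv (R := B) ?_ n).1 h
  refine (ModuleCat.CoextendScalars.equiv (algebraMap A B) (ModuleCat.of A N)).trans
    { toFun := fun g => Coext.of (g.comp e.toLinearMap)
      invFun := fun g => (Coext.of.symm g).comp e.symm.toLinearMap
      map_add' := fun _ _ => rfl
      map_smul' := fun _ _ => rfl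
      left_inv := fun _ => rfl
      right_inv := fun _ => rfl }

end Coext

open Polynomial in
/-- Injective dimensions over a polynomial ring exceed those over the base ring by at most one. -/
theorem polynomial_hasInjectiveDimensionLE_succ {A : Type u} [CommRing A] (n : ℕ)
    (N : Type u) [AddCommGroup N] [Module A N] [Module A[X] N] [IsScalarTower A A[X] N]
    [HasInjectiveDimensionLE (ModuleCat.of A N) n] :
    HasInjectiveDimensionLE (ModuleCat.of A[X] N) (n + 1) := by
  have hE : HasInjectiveDimensionLE (ModuleCat.of A[X] (Coext A A[X] N)) n :=
    Coext.hasInjectiveDimensionLE n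
  -- The sequence `0 → N → Hom_A(A[X], N) → Hom_A(A[X], N) → 0` with `ι x = (p ↦ p • x)` and `π g =
  -- (p ↦ g (X p) - X g p)` is exact: the kernel of `π` consists of the `A[X]`-linear maps, which
  -- are determined by their value at `1`.
  let ι : N →ₗ[A[X]] Coext A A[X] N :=
    { toFun := fun x => Coext.of ((LinearMap.toSpanSingleton A[X] N x).restrictScalars A)
      map_add' := fun x y => Coext.ext fun p => smul_add _ _ _
      map_smul' := fun a x => Coext.ext fun p => (mul_smul p a x).symm }
  have hιa : ∀ x p, ι x p = p • x := fun _ _ => rfl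
  let shift : Coext A A[X] N → Coext A A[X] N := fun g => Coext.of
    { toFun := fun p => g (X * p) - (X : A[X]) • g p
      map_add' := fun p q => by rw [mul_add, map_add, map_add, smul_add, add_sub_add_comm]
      map_smul' := fun a p => by
        rw [mul_smul_comm, map_smul, map_smul, RingHom.id_apply, smul_sub, smul_comm] }
  have hshift : ∀ g p, shift g p = g (X * p) - (X : A[X]) • g p := fun _ _ => rfl
  let π : Coext A A[X] N →ₗ[A[X]] Coext A A[X] N :=
    { toFun := shift
      map_add' := fun x y => Coext.ext fun p => by
        rw [Coext.add_apply, hshift, hshift, hshift, Coext.add_apply, Coext.add_apply, smul_add,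
          add_sub_add_comm]
      map_smul' := fun a x => Coext.ext fun p => by
        rw [RingHom.id_apply, Coext.smul_apply, hshift, hshift, Coext.smul_apply,
          Coext.smul_apply, mul_assoc] }
  have hπa : ∀ g p, π g p = g (X * p) - (X : A[X]) • g p := hshift
  have hι : Function.Injective ι := fun x y hxy => by
    have := congrArg (fun g : Coext A A[X] N => g 1) hxy
    simpa only [hιa, one_smul] using this
  have hext : ∀ g g' : Coext A A[X] N, (∀ i : ℕ, g (X ^ i) = g' (X ^ i)) → g = g' := by
    intro g g' h
    refine Coext.ext fun p => ?_
    induction p using Polynomial.induction_on' with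
    | add p q hp hq => rw [map_add, map_add, hp, hq]
    | monomial i a =>
      rw [← mul_one a, ← smul_eq_mul, ← smul_monomial, map_smul, map_smul,
        monomial_one_right_eq_X_pow, h]
  have hex : Function.Exact ι π := by
    intro g
    constructor
    · intro hg
      refine ⟨g 1, (hext _ _ fun i => ?_).symm⟩
      rw [hιa]
      induction i with
      | zero => rw [pow_zero, one_smul]
      | succ i ih =>
        have h1 := hπa g (X ^ i)
        rw [hg, Coext.zero_apply] at h1
        rw [pow_succ', sub_eq_zero.1 h1.symm, ih, mul_smul]
    · rintro ⟨x, rfl⟩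
      refine hext _ _ fun i => ?_
      rw [hπa, hιa, hιa, mul_smul, sub_self, Coext.zero_apply]
  have hsurj : Function.Surjective π := by
    intro g
    -- A preimage `l` of `g` must satisfy `l (X^(i+1)) = g (X^i) + X • l (X^i)`; this recursion can
    -- be solved starting from `l 1 = 0`.
    let y : ℕ → N := fun i => Nat.rec 0 (fun i z => g (X ^ i) + (X : A[X]) • z) i
    let l : A[X] →ₗ[A] N := Polynomial.lsum fun i => LinearMap.toSpanSingleton A N (y i)
    have hl : ∀ i, l (X ^ i) = y i := fun i => by
      rw [← monomial_one_right_eq_X_pow]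
      change (monomial i 1).sum _ = _
      rw [Polynomial.sum_monomial_index]
      · exact one_smul A _
      · simp
    refine ⟨Coext.of l, hext _ _ fun i => ?_⟩
    rw [hπa, Coext.of_apply, Coext.of_apply, ← pow_succ', hl, hl]
    exact add_sub_cancel_right _ _
  let S : ShortComplex (ModuleCat.{u} A[X]) :=
    ModuleCat.shortComplexOfCompEqZero ι π hex.linearMap_comp_eq_zero
  have hS : S.ShortExact := ModuleCat.shortComplex_shortExact S hex hι hsurj
  exact hS.hasInjectiveDimensionLT_X₁ (n + 1) hE
    (hasInjectiveDimensionLT_of_ge _ (n + 1) (n + 1 + 1) (Nat.le_succ _))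

theorem hasInjectiveDimensionLE_of_ringEquiv {A B : Type u} [CommRing A] [CommRing B]
    (e : A ≃+* B) {n : ℕ} (h : ∀ N : ModuleCat.{u} A, HasInjectiveDimensionLE N n)
    (N : ModuleCat.{u} B) : HasInjectiveDimensionLE N n := by
  let := RingHomInvPair.of_ringEquiv e
  let := RingHomInvPair.symm (RingHomClass.toRingHom e) (RingHomClass.toRingHom e.symm)
  let : Module A N := Module.compHom N e.toRingHom
  refine (ModuleCat.hasInjectiveDimensionLE_iff_of_semiLinearEquiv e (M := ModuleCat.of A N)
    (N := N) { AddEquiv.refl N with map_smul' := fun _ _ => rfl } n).1 (h _)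

/-- Injective dimensions over a polynomial ring in `m` variables over a field are at most `m`. -/
theorem mvPolynomial_hasInjectiveDimensionLE (k : Type u) [Field k] (m : ℕ)
    (N : ModuleCat.{u} (MvPolynomial (Fin m) k)) : HasInjectiveDimensionLE N m := by
  induction m with
  | zero =>
    -- Without variables the ring is the field `k`, over which all modules are injective.
    refine hasInjectiveDimensionLE_of_ringEquiv (MvPolynomial.isEmptyRingEquiv k (Fin 0)).symm
      (fun N => ?_) N
    have : Module.Injective k N := Module.injective_of_isSemisimpleRing k N
    have : Injective N := Module.injective_object_of_injective_module k N
    infer_instance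
  | succ m ih =>
    refine hasInjectiveDimensionLE_of_ringEquiv
      (MvPolynomial.finSuccEquiv k m).symm.toRingEquiv (fun N => ?_) N
    let : Module (MvPolynomial (Fin m) k) N := Module.compHom N Polynomial.C
    have : IsScalarTower (MvPolynomial (Fin m) k) (Polynomial (MvPolynomial (Fin m) k)) N :=
      ⟨fun a b x => by
        rw [Polynomial.smul_eq_C_mul, mul_smul]; rfl⟩
    have := ih (ModuleCat.of (MvPolynomial (Fin m) k) N)
    exact polynomial_hasInjectiveDimensionLE_succ m N

/-- The localization of a module, computed by any localized module. -/
noncomputable def localizedModuleEquiv {R : Type u} [CommRing R] (S : Submonoid R)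
    (M : ModuleCat.{u} R) {N : Type u} [AddCommGroup N] [Module R N] [Module (Localization S) N]
    [IsScalarTower R (Localization S) N] (g : M →ₗ[R] N) [IsLocalizedModule S g] :
    M.localizedModule S ≃ₗ[Localization S] N :=
  LinearEquiv.extendScalarsOfIsLocalization S (Localization S)
    (IsLocalizedModule.linearEquiv S (M.localizedModuleMkLinearMap S) g)

/-- A Noetherian ring which has finite injective dimension over itself is Gorenstein. -/
theorem isGorenstein_of_hasInjectiveDimensionLE (R : Type u) [CommRing R] [IsNoetherianRing R]
    (n : ℕ) [HasInjectiveDimensionLE (ModuleCat.of R R) n] : IsGorenstein R := by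
  refine ⟨inferInstance, fun m _ => ⟨n, ?_⟩⟩
  have h := ModuleCat.localizedModule_hasInjectiveDimensionLE n m.primeCompl (ModuleCat.of R R)
  refine (ModuleCat.hasInjectiveDimensionLE_iff_of_linearEquiv
    (R := Localization.AtPrime m) ?_ n).1 h
  have hloc : IsLocalizedModule m.primeCompl (Algebra.linearMap R (Localization.AtPrime m)) :=
    inferInstance
  exact localizedModuleEquiv m.primeCompl (ModuleCat.of R R)
    (Algebra.linearMap R (Localization.AtPrime m))

/-- A Noetherian ring `R` which is projective over a polynomial ring `P`, and which admits a
`P`-linear form `φ : R → P` such that all linear forms are `b ↦ φ (b * a)` for a unique `a`,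
is Gorenstein. -/
theorem isGorenstein_of_frobenius_form (k : Type u) [Field k] (m : ℕ) (R : Type u) [CommRing R]
    [IsNoetherianRing R] [Algebra (MvPolynomial (Fin m) k) R]
    [Module.Projective (MvPolynomial (Fin m) k) R]
    (φ : R →ₗ[MvPolynomial (Fin m) k] MvPolynomial (Fin m) k)
    (hinj : ∀ a, (∀ b, φ (b * a) = 0) → a = 0)
    (hsurj : ∀ ψ : R →ₗ[MvPolynomial (Fin m) k] MvPolynomial (Fin m) k,
      ∃ a, ∀ b, ψ b = φ (b * a)) : IsGorenstein R := by
  have := mvPolynomial_hasInjectiveDimensionLE k m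
    (ModuleCat.of _ (MvPolynomial (Fin m) k))
  have h : HasInjectiveDimensionLE (ModuleCat.of R
      (Coext (MvPolynomial (Fin m) k) R (MvPolynomial (Fin m) k))) m :=
    Coext.hasInjectiveDimensionLE m
  -- The hypotheses on `φ` say that `a ↦ φ (· * a)` is an isomorphism from `R` onto `Hom_P(R, P)`,
  -- whose injective dimension is at most that of `P`.
  let ι : R →ₗ[R] Coext (MvPolynomial (Fin m) k) R (MvPolynomial (Fin m) k) :=
    LinearMap.toSpanSingleton R _ (Coext.of φ)
  have hι : ∀ a b, ι a b = φ (b * a) := fun _ _ => rfl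
  have hbij : Function.Bijective ι := by
    refine ⟨(injective_iff_map_eq_zero ι).2 fun a ha => hinj a fun b => ?_, fun ψ => ?_⟩
    · rw [← hι, ha, Coext.zero_apply]
    · obtain ⟨a, ha⟩ := hsurj (Coext.of.symm ψ)
      exact ⟨a, Coext.ext fun b => (ha b).symm⟩
  have : HasInjectiveDimensionLE (ModuleCat.of R R) m :=
    (ModuleCat.hasInjectiveDimensionLE_iff_of_linearEquiv (R := R)
      (LinearEquiv.ofBijective ι hbij).symm m).1 h
  exact isGorenstein_of_hasInjectiveDimensionLE R m

end InjDim

end StabFamily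

namespace StabFamily

open MvPolynomial

/-! ### Monomial rings, and regularity of parameters in characteristic `p` by Frobenius roots. -/

section MonomialRing

variable {σ : Type*} (K : Type*) [CommRing K] (M : AddSubmonoid (σ →₀ ℕ))

/-- The subalgebra of the polynomials all of whose monomials have exponents in `M`. -/
def monomialRing : Subalgebra K (MvPolynomial σ K) where
  carrier := {f | ∀ m, coeff m f ≠ 0 → m ∈ M}
  mul_mem' := by
    classical
    intro f g hf hg m hm
    rw [coeff_mul] at hm
    obtain ⟨⟨a, b⟩, hab, h⟩ := Finset.exists_ne_zero_of_sum_ne_zero hm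
    rw [Finset.HasAntidiagonal.mem_antidiagonal] at hab
    rw [← hab]
    exact M.add_mem (hf a (left_ne_zero_of_mul h)) (hg b (right_ne_zero_of_mul h))
  add_mem' := by
    intro f g hf hg m hm
    by_contra h
    exact hm (by rw [coeff_add, not_not.1 (mt (hf m) h), not_not.1 (mt (hg m) h), add_zero])
  algebraMap_mem' := by
    classical
    intro r m hm
    rw [algebraMap_eq, coeff_C] at hm
    obtain rfl : 0 = m := by by_contra h; exact hm (if_neg h)
    exact M.zero_mem

variable {K M}

theorem monomial_mem_monomialRing {m : σ →₀ ℕ} (hm : m ∈ M) (c : K) :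
    monomial m c ∈ monomialRing K M := by
  classical
  intro m' h
  rw [coeff_monomial] at h
  by_cases h' : m = m'
  · exact h' ▸ hm
  · exact absurd (if_neg h') h

end MonomialRing

section Cartier

variable {σ : Type*} {K : Type*} [CommRing K]

/-- The additive map which sends `x ^ (q m + e)` to `x ^ m`, and kills the other monomials. -/
noncomputable def rootMap (q : ℕ) (hq : q ≠ 0) (e : σ →₀ ℕ) :
    MvPolynomial σ K → MvPolynomial σ K := fun f =>
  AddMonoidAlgebra.ofCoeff (Finsupp.comapDomain (fun m => q • m + e) (AddMonoidAlgebra.coeff f)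
    (fun a _ b _ h => by
      ext s
      have := DFunLike.congr_fun (add_right_cancel h) s
      simpa [hq] using this))

variable {q : ℕ} (hq : q ≠ 0) (e : σ →₀ ℕ)

theorem coeff_rootMap (f : MvPolynomial σ K) (m : σ →₀ ℕ) :
    coeff m (rootMap q hq e f) = coeff (q • m + e) f := rfl

theorem rootMap_add (f g : MvPolynomial σ K) :
    rootMap q hq e (f + g) = rootMap q hq e f + rootMap q hq e g := by
  ext m; simp only [coeff_rootMap, coeff_add]

theorem rootMap_sum {ι : Type*} (s : Finset ι) (f : ι → MvPolynomial σ K) :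
    rootMap q hq e (∑ i ∈ s, f i) = ∑ i ∈ s, rootMap q hq e (f i) := by
  ext m; simp only [coeff_rootMap, coeff_sum]

/-- Linearity over `q`-th powers: coefficients in `ZMod p` are fixed by Frobenius, and since the
entries of `e` are below `q = p ^ j`, divisibility of `q m + e` by `q a` is divisibility of `m` by
`a`. -/
theorem rootMap_pow_mul {p : ℕ} [Fact p.Prime] (j : ℕ) (hq : p ^ j ≠ 0)
    (he : ∀ s, e s < p ^ j) (g f : MvPolynomial σ (ZMod p)) :
    rootMap (p ^ j) hq e (g ^ p ^ j * f) = g * rootMap (p ^ j) hq e f := by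
  induction g using MvPolynomial.induction_on' with
  | add g h hg hh =>
    rw [add_pow_char_pow, add_mul, rootMap_add, hg, hh, add_mul]
  | monomial a c =>
    ext m
    rw [coeff_rootMap, monomial_pow, ZMod.pow_card_pow, coeff_monomial_mul', coeff_monomial_mul',
      coeff_rootMap]
    have h : p ^ j • a ≤ p ^ j • m + e ↔ a ≤ m := by
      constructor
      · intro h s
        have h1 := h s
        simp only [Finsupp.smul_apply, Finsupp.add_apply, smul_eq_mul] at h1
        have h2 := he s
        by_contra h3
        have h4 : m s + 1 ≤ a s := by omega
        have h5 : p ^ j * (m s + 1) ≤ p ^ j * a s := Nat.mul_le_mul_left _ h4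
        rw [mul_add] at h5
        omega
      · intro h
        exact (nsmul_le_nsmul_right h _).trans le_self_add
    by_cases h' : a ≤ m
    · rw [if_pos h', if_pos (h.2 h')]
      congr 2
      obtain ⟨b, rfl⟩ := exists_add_of_le h'
      rw [smul_add, add_tsub_cancel_left, add_assoc, add_tsub_cancel_left]
    · rw [if_neg h', if_neg (mt h.1 h')]

/-- When all exponents are below `q`, the index `q m + e` can occur only for `m = 0`. -/
theorem rootMap_eq_C (f : MvPolynomial σ K) (hf : ∀ m, coeff m f ≠ 0 → ∀ s, m s < q) :
    rootMap q hq e f = C (coeff e f) := by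
  classical
  ext m
  rw [coeff_rootMap, coeff_C]
  split_ifs with h
  · subst h; simp
  · by_contra h1
    obtain ⟨s, hs⟩ : ∃ s, m s ≠ 0 := by
      by_contra h2; push Not at h2
      exact h (Finsupp.ext h2).symm
    have := hf _ h1 s
    simp only [Finsupp.smul_apply, Finsupp.add_apply, smul_eq_mul] at this
    have : q * 1 ≤ q * m s := Nat.mul_le_mul_left _ (Nat.one_le_iff_ne_zero.2 hs)
    omega

end Cartier

section Generic

theorem exists_sum_smul_of_mem_span_image {A R ι : Type*} [Semiring A] [AddCommMonoid R]
    [Module A R] {s : Finset ι} {v : ι → R} {x : R}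
    (hx : x ∈ Submodule.span A (v '' (s : Set ι))) : ∃ c : ι → A, ∑ i ∈ s, c i • v i = x := by
  classical
  obtain ⟨c, hc⟩ := (Submodule.mem_span_image_finset_iff_exists_fun _).1 hx
  refine ⟨fun i => if h : i ∈ s then c ⟨i, h⟩ else 0, ?_⟩
  rw [← hc, ← Finset.sum_coe_sort]
  exact Finset.sum_congr rfl fun i _ => by simp only [dif_pos i.2]

/-- A finitely generated module over a domain is, up to multiplication by a nonzero scalar,
contained in a free submodule. -/
theorem exists_smul_mem_span_linearIndepOn {A R : Type*} [CommRing A] [IsDomain A]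
    [AddCommGroup R] [Module A R] {ι : Type*} [Finite ι] (v : ι → R)
    (hv : Submodule.span A (Set.range v) = ⊤) :
    ∃ s : Set ι, LinearIndepOn A v s ∧ ∃ c : A, c ≠ 0 ∧
      ∀ x : R, c • x ∈ Submodule.span A (v '' s) := by
  classical
  have := Fintype.ofFinite ι
  obtain ⟨s, hs, hmax⟩ := exists_maximal_linearIndepOn A v
  have : ∀ i, ∃ a : A, a ≠ 0 ∧ a • v i ∈ Submodule.span A (v '' s) := fun i => by
    by_cases hi : i ∈ s
    · exact ⟨1, one_ne_zero, by rw [one_smul]; exact Submodule.subset_span ⟨i, hi, rfl⟩⟩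
    · exact hmax i hi
  choose a ha hav using this
  refine ⟨s, hs, ∏ i, a i, Finset.prod_ne_zero_iff.2 fun i _ => ha i, fun x => ?_⟩
  have hx : x ∈ Submodule.span A (Set.range v) := hv ▸ Submodule.mem_top
  induction hx using Submodule.span_induction with
  | mem x hx =>
    obtain ⟨i, rfl⟩ := hx
    rw [← Finset.prod_erase_mul _ _ (Finset.mem_univ i), mul_smul]
    exact Submodule.smul_mem _ _ (hav i)
  | zero => rw [smul_zero]; exact Submodule.zero_mem _
  | add x y _ _ hx hy => rw [smul_add]; exact Submodule.add_mem _ hx hy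
  | smul b x _ hx => rw [smul_comm]; exact Submodule.smul_mem _ _ hx

/-- Powers of distinct variables form a regular sequence in any order. -/
theorem exists_eq_sum_X_pow_mul {ι K : Type*} [Field K] {J : Finset ι} {j : ι} (hj : j ∉ J)
    (q : ℕ) (a : MvPolynomial ι K) (b : ι → MvPolynomial ι K)
    (h : a * X j ^ q = ∑ i ∈ J, b i * X i ^ q) :
    ∃ b' : ι → MvPolynomial ι K, a = ∑ i ∈ J, b' i * X i ^ q := by
  classical
  -- The ideal is monomial, so membership is tested on each monomial; multiplying by a power of
  -- another variable does not affect divisibility by `X i ^ q`.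
  have key : ∀ f : MvPolynomial ι K, f ∈ Ideal.span ((fun m => monomial m (1 : K)) ''
      ((fun i => Finsupp.single i q) '' (J : Set ι))) ↔ ∃ b' : ι → MvPolynomial ι K,
      f = ∑ i ∈ J, b' i * X i ^ q := by
    intro f
    have : (fun m => monomial m (1 : K)) '' ((fun i => Finsupp.single i q) '' (J : Set ι))
        = (fun i => X i ^ q) '' (J : Set ι) := by
      rw [Set.image_image]
      simp only [X_pow_eq_monomial]
    rw [this]
    constructor
    · intro hf
      obtain ⟨c, hc⟩ := exists_sum_smul_of_mem_span_image hf
      exact ⟨c, by rw [← hc]; rfl⟩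
    · rintro ⟨b', rfl⟩
      exact Ideal.sum_mem _ fun i hi => Ideal.mul_mem_left _ _
        (Ideal.subset_span ⟨i, hi, rfl⟩)
  rw [← key, mem_ideal_span_monomial_image]
  intro m hm
  have h1 : a * X j ^ q ∈ Ideal.span ((fun m => monomial m (1 : K)) ''
      ((fun i => Finsupp.single i q) '' (J : Set ι))) := (key _).2 ⟨b, h⟩
  rw [mem_ideal_span_monomial_image] at h1
  have h2 : m + Finsupp.single j q ∈ (a * X j ^ q).support := by
    rw [mem_support_iff, X_pow_eq_monomial, coeff_mul_monomial, mul_one]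
    exact mem_support_iff.1 hm
  obtain ⟨_, ⟨i, hi, rfl⟩, hle⟩ := h1 _ h2
  refine ⟨_, ⟨i, hi, rfl⟩, ?_⟩
  have hij : i ≠ j := fun h => hj (h ▸ hi)
  rw [Finsupp.single_le_iff] at hle ⊢
  rwa [Finsupp.add_apply, Finsupp.single_eq_of_ne hij, add_zero] at hle

end Generic

section Regular

variable {σ : Type*} {p : ℕ} [Fact p.Prime] {M : AddSubmonoid (σ →₀ ℕ)}

/-- Parameters of a saturated monomial ring in characteristic `p` form a regular sequence, in
any order. -/
theorem monomialRing_regular (hM : ∀ e ∈ M, ∃ N : ℕ, ∀ q ≥ N, ∀ m : σ →₀ ℕ, q • m + e ∈ M → m ∈ M)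
    {ι : Type*} (θ : ι → monomialRing (ZMod p) M)
    (hθ : Function.Injective (aeval (R := ZMod p) θ))
    (hfin : (aeval (R := ZMod p) θ).toRingHom.Finite)
    {J : Finset ι} {j : ι} (hj : j ∉ J) (r : monomialRing (ZMod p) M)
    (s : ι → monomialRing (ZMod p) M) (h : r * θ j = ∑ i ∈ J, s i * θ i) :
    ∃ s' : ι → monomialRing (ZMod p) M, r = ∑ i ∈ J, s' i * θ i := by
  classical
  let := (aeval (R := ZMod p) θ).toRingHom.toAlgebra
  have halg : ∀ (a : MvPolynomial ι (ZMod p)) (x : monomialRing (ZMod p) M),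
      a • x = aeval θ a * x := fun a x => rfl
  have hfin : Module.Finite (MvPolynomial ι (ZMod p)) (monomialRing (ZMod p) M) := hfin
  obtain ⟨n, v, hv⟩ := Module.Finite.exists_fin (R := MvPolynomial ι (ZMod p))
    (M := monomialRing (ZMod p) M)
  -- Multiplication by `D`, the image of `c`, carries the ring into a free module over the parameter
  -- ring, where relations can be compared coefficientwise. `D` does not depend on the power `q`
  -- chosen below.
  obtain ⟨S, hS, c, hc0, hc⟩ := exists_smul_mem_span_linearIndepOn v hv
  set D : monomialRing (ZMod p) M := aeval θ c with hD
  have hD0 : (D : MvPolynomial σ (ZMod p)) ≠ 0 := by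
    rw [Ne, ZeroMemClass.coe_eq_zero, hD, map_eq_zero_iff _ hθ]; exact hc0
  obtain ⟨e, he⟩ := MvPolynomial.ne_zero_iff.1 hD0
  have heM : e ∈ M := D.2 e he
  obtain ⟨N, hN⟩ := hM e heM
  obtain ⟨N', hN'⟩ : ∃ N', ∀ m, coeff m (D : MvPolynomial σ (ZMod p)) ≠ 0 → ∀ s, m s < N' := by
    refine ⟨(D : MvPolynomial σ (ZMod p)).totalDegree + 1, fun m hm s => Nat.lt_succ_of_le ?_⟩
    have h1 := le_totalDegree (mem_support_iff.2 hm)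
    refine le_trans ?_ h1
    by_cases hs : s ∈ m.support
    · exact Finset.single_le_sum (f := fun i => m i) (fun _ _ => Nat.zero_le _) hs
    · rw [Finsupp.notMem_support_iff.1 hs]; exact Nat.zero_le _
  -- Two demands on `q`: at least `N`, so that the root map at `e` stays in the monomial ring, and
  -- larger than every exponent in `D`, so that the root of `D` is a constant.
  obtain ⟨k, hk⟩ : ∃ k, max N N' ≤ p ^ k :=
    ⟨max N N', (Nat.lt_pow_self (Fact.out : p.Prime).one_lt).le⟩
  set q := p ^ k with hq
  have hq0 : q ≠ 0 := pow_ne_zero _ (Fact.out : p.Prime).ne_zero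
  have hcoef : ∀ x : monomialRing (ZMod p) M, ∃ a : Fin n → MvPolynomial ι (ZMod p),
      D * x = ∑ l with l ∈ S, a l • v l := by
    intro x
    have h1 := hc x
    have : v '' S = v '' ((Finset.univ.filter (· ∈ S) : Finset (Fin n)) : Set (Fin n)) := by simp
    rw [this] at h1
    obtain ⟨a, ha⟩ := exists_sum_smul_of_mem_span_image h1
    exact ⟨a, by rw [ha, halg]⟩
  obtain ⟨a, ha⟩ := hcoef (r ^ q)
  choose b hb using fun i => hcoef (s i ^ q)
  -- The given relation raised to the power `q`, which is additive in characteristic `p`.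
  have hpow : r ^ q * θ j ^ q = ∑ i ∈ J, s i ^ q * θ i ^ q := by
    have : CharP (monomialRing (ZMod p) M) p :=
      charP_of_injective_algebraMap (algebraMap (ZMod p) _).injective p
    rw [← mul_pow, h, hq, sum_pow_char_pow]
    exact Finset.sum_congr rfl fun i _ => mul_pow _ _ _
  have hlin : ∀ l ∈ S, a l * X j ^ q = ∑ i ∈ J, b i l * X i ^ q := by
    have h1 : ∑ l with l ∈ S, (a l * X j ^ q - ∑ i ∈ J, b i l * X i ^ q) • v l = 0 := by
      simp only [halg, map_sub, map_sum, map_mul, map_pow, aeval_X, sub_mul,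
        Finset.sum_sub_distrib, Finset.sum_mul]
      rw [Finset.sum_comm, sub_eq_zero]
      have h2 : ∀ (i : ι) (f : MvPolynomial ι (ZMod p)) l,
          aeval θ f * θ i ^ q * v l = θ i ^ q * (f • v l) := by
        intro i f l
        rw [halg]; ring
      simp only [h2, ← Finset.mul_sum, ← ha, ← hb]
      rw [mul_left_comm, mul_comm (θ j ^ q), hpow, Finset.mul_sum]
      exact Finset.sum_congr rfl fun i _ => by ring
    intro l hl
    have h2 := linearIndepOn_iff'.1 hS (Finset.univ.filter (· ∈ S)) _ (by simp) h1 l (by simpa)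
    exact sub_eq_zero.1 h2
  choose! a' ha' using fun l (hl : l ∈ S) => exists_eq_sum_X_pow_mul hj q _ _ (hlin l hl)
  let t : ι → monomialRing (ZMod p) M := fun i => ∑ l with l ∈ S, a' l i • v l
  -- Powers of the variables are regular in the parameter ring, so each coefficient of `D * r ^ q`
  -- lies in the ideal of the `X i ^ q`.
  have ht : D * r ^ q = ∑ i ∈ J, θ i ^ q * t i := by
    rw [ha]
    simp only [t, Finset.mul_sum]
    rw [Finset.sum_comm]
    refine Finset.sum_congr rfl fun l hl => ?_
    rw [ha' l (by simpa using hl), halg, map_sum, Finset.sum_mul]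
    refine Finset.sum_congr rfl fun i _ => ?_
    rw [halg, map_mul, map_pow, aeval_X]; ring
  have hroot : ∀ x : monomialRing (ZMod p) M,
      rootMap q hq0 e (x : MvPolynomial σ (ZMod p)) ∈ monomialRing (ZMod p) M := by
    intro x m hm
    rw [coeff_rootMap] at hm
    exact hN q ((le_max_left _ _).trans hk) m (x.2 _ hm)
  have hlt : ∀ m, coeff m (D : MvPolynomial σ (ZMod p)) ≠ 0 → ∀ s, m s < q :=
    fun m hm s => (hN' m hm s).trans_le ((le_max_right _ _).trans hk)
  -- Taking roots turns `D * r ^ q` into a nonzero constant times `r`, and each `θ i ^ q` into `θ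
  -- i`.
  have hfinal : C (coeff e (D : MvPolynomial σ (ZMod p))) * (r : MvPolynomial σ (ZMod p))
      = ∑ i ∈ J, (θ i : MvPolynomial σ (ZMod p)) * rootMap q hq0 e (t i) := by
    have h1 := congrArg (fun x : monomialRing (ZMod p) M =>
      rootMap q hq0 e (x : MvPolynomial σ (ZMod p))) ht
    simp only [MulMemClass.coe_mul, SubmonoidClass.coe_pow, AddSubmonoidClass.coe_finsetSum]
      at h1
    rw [rootMap_sum, mul_comm, rootMap_pow_mul e k hq0 (hlt e he),
      rootMap_eq_C hq0 e _ hlt] at h1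
    rw [mul_comm, h1]
    exact Finset.sum_congr rfl fun i _ => rootMap_pow_mul e k hq0 (hlt e he) _ _
  refine ⟨fun i => (coeff e (D : MvPolynomial σ (ZMod p)))⁻¹ • ⟨_, hroot (t i)⟩, ?_⟩
  apply Subtype.ext
  simp only [AddSubmonoidClass.coe_finsetSum, MulMemClass.coe_mul, SetLike.val_smul]
  have h2 := congrArg ((coeff e (D : MvPolynomial σ (ZMod p)))⁻¹ • ·) hfinal
  simp only [← smul_eq_C_mul, smul_smul, inv_mul_cancel₀ he, one_smul, Finset.smul_sum] at h2
  rw [h2]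
  exact Finset.sum_congr rfl fun i _ => by rw [smul_mul_assoc, mul_comm]

end Regular

end StabFamily

namespace StabFamily

open MvPolynomial

/-! ### The monoid of the clique inequalities, and its decomposition into stable sets. -/

section Coordinates

variable {n : ℕ} (r : Fin n → ℕ)

/-- Positions `(i, a)` with `a < r i`. -/
abbrev Cell : Type := Σ i, Fin (r i)

/-- The variables: the degree variable, and one variable for each vertex `(i, a)^+`, `(i, a)^-`. -/
abbrev Var : Type := Option (Cell r ⊕ Cell r)

variable {r}

/-- The sum of the exponents of the vertices `(i, a)^+`. -/
def plusSum (i : Fin n) : (Var r →₀ ℕ) →+ ℕ where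
  toFun m := ∑ a, m (some (Sum.inl ⟨i, a⟩))
  map_zero' := by simp
  map_add' := by simp [Finset.sum_add_distrib]

/-- The sum of the exponents of the vertices `(i, a)^-`. -/
def minusSum (i : Fin n) : (Var r →₀ ℕ) →+ ℕ where
  toFun m := ∑ a, m (some (Sum.inr ⟨i, a⟩))
  map_zero' := by simp
  map_add' := by simp [Finset.sum_add_distrib]

theorem plusSum_apply (i : Fin n) (m : Var r →₀ ℕ) :
    plusSum i m = ∑ a, m (some (Sum.inl ⟨i, a⟩)) := rfl

theorem minusSum_apply (i : Fin n) (m : Var r →₀ ℕ) :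
    minusSum i m = ∑ a, m (some (Sum.inr ⟨i, a⟩)) := rfl

variable (r)

/-- The degree of an exponent. -/
def deg : (Var r →₀ ℕ) →+ ℕ := Finsupp.applyAddHom none

/-- The monoid of the exponents which satisfy the clique inequalities. -/
def cliqueMonoid : AddSubmonoid (Var r →₀ ℕ) where
  -- The inequalities of `Q_0` and of the `Q_i`; the latter has `minusSum i` moved to the right to
  -- avoid truncated subtraction.
  carrier := {m | ∑ i, minusSum i m ≤ deg r m ∧
    ∀ i, plusSum i m + ∑ j, minusSum j m ≤ deg r m + minusSum i m}
  zero_mem' := by simp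
  add_mem' := by
    rintro a b ⟨h1, h2⟩ ⟨h3, h4⟩
    refine ⟨?_, fun i => ?_⟩
    · simp only [map_add, Finset.sum_add_distrib]; omega
    · have := h2 i; have := h4 i
      simp only [map_add, Finset.sum_add_distrib]; omega

variable {r}

theorem deg_apply (m : Var r →₀ ℕ) : deg r m = m none := rfl

theorem mem_cliqueMonoid {m : Var r →₀ ℕ} : m ∈ cliqueMonoid r ↔
    ∑ i, minusSum i m ≤ deg r m ∧
      ∀ i, plusSum i m + ∑ j, minusSum j m ≤ deg r m + minusSum i m := Iff.rfl

/-- A violated inequality is violated by at least one, hence by at least `q` after scaling, and `e`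
cannot compensate once `q` exceeds the bound. This form of normality is what the root map needs. -/
theorem cliqueMonoid_saturated (e : Var r →₀ ℕ) : ∃ N : ℕ, ∀ q ≥ N,
    ∀ m : Var r →₀ ℕ, q • m + e ∈ cliqueMonoid r → m ∈ cliqueMonoid r := by
  refine ⟨deg r e + ∑ j, minusSum j e + 1, fun q hq m hm => ?_⟩
  rw [mem_cliqueMonoid] at hm ⊢
  simp only [map_add, map_nsmul, Finset.sum_add_distrib, smul_eq_mul, ← Finset.mul_sum] at hm
  refine ⟨?_, fun i => ?_⟩
  · by_contra h
    have : q * (deg r m + 1) ≤ q * ∑ i, minusSum i m := Nat.mul_le_mul_left _ (by omega)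
    rw [mul_add] at this
    omega
  · by_contra h
    have h1 := hm.2 i
    have h2 : minusSum i e ≤ ∑ j, minusSum j e :=
      Finset.single_le_sum (f := fun j => minusSum j e) (fun _ _ => Nat.zero_le _)
        (Finset.mem_univ i)
    have : q * (deg r m + minusSum i m + 1) ≤ q * (plusSum i m + ∑ j, minusSum j m) :=
      Nat.mul_le_mul_left _ (by omega)
    simp only [mul_add] at this
    omega

/-- The exponent of the `b`-th vertex `(i, b - 1)^+`, which is absent for `b = 0`. -/
noncomputable def plusExp (i : Fin n) (b : Fin (r i + 1)) : Var r →₀ ℕ :=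
  Fin.cases 0 (fun a => Finsupp.single (some (Sum.inl ⟨i, a⟩)) 1) b

theorem plusExp_zero (i : Fin n) : plusExp (r := r) i 0 = 0 := rfl

theorem plusExp_succ (i : Fin n) (a : Fin (r i)) :
    plusExp i a.succ = Finsupp.single (some (Sum.inl ⟨i, a⟩)) 1 := rfl

@[simp] theorem deg_plusExp (i : Fin n) (b : Fin (r i + 1)) : deg r (plusExp i b) = 0 := by
  induction b using Fin.cases with
  | zero => rfl
  | succ a => simp [plusExp_succ, deg_apply]

@[simp] theorem minusSum_plusExp (j i : Fin n) (b : Fin (r i + 1)) :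
    minusSum j (plusExp i b) = 0 := by
  induction b using Fin.cases with
  | zero => exact map_zero _
  | succ a => simp [plusExp_succ, minusSum_apply]

theorem plusSum_single_inl (j i : Fin n) (a : Fin (r i)) (c : ℕ) :
    plusSum j (Finsupp.single (some (Sum.inl ⟨i, a⟩)) c) = if j = i then c else 0 := by
  classical
  rw [plusSum_apply]
  split_ifs with h
  · subst h
    rw [Finset.sum_eq_single a]
    · simp
    · intro b _ hb
      rw [Finsupp.single_eq_of_ne]
      simpa using hb
    · simp
  · refine Finset.sum_eq_zero fun b _ => Finsupp.single_eq_of_ne ?_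
    simp [h]

theorem minusSum_single_inr (j i : Fin n) (a : Fin (r i)) (c : ℕ) :
    minusSum j (Finsupp.single (some (Sum.inr ⟨i, a⟩)) c) = if j = i then c else 0 := by
  classical
  rw [minusSum_apply]
  split_ifs with h
  · subst h
    rw [Finset.sum_eq_single a]
    · simp
    · intro b _ hb
      rw [Finsupp.single_eq_of_ne]
      simpa using hb
    · simp
  · refine Finset.sum_eq_zero fun b _ => Finsupp.single_eq_of_ne ?_
    simp [h]

@[simp] theorem minusSum_single_inl (j : Fin n) (c : Cell r) (k : ℕ) :
    minusSum j (Finsupp.single (some (Sum.inl c)) k) = 0 := by simp [minusSum_apply]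

@[simp] theorem plusSum_single_inr (j : Fin n) (c : Cell r) (k : ℕ) :
    plusSum j (Finsupp.single (some (Sum.inr c)) k) = 0 := by simp [plusSum_apply]

@[simp] theorem plusSum_single_none (j : Fin n) (k : ℕ) :
    plusSum (r := r) j (Finsupp.single none k) = 0 := by simp [plusSum_apply]

@[simp] theorem minusSum_single_none (j : Fin n) (k : ℕ) :
    minusSum (r := r) j (Finsupp.single none k) = 0 := by simp [minusSum_apply]

@[simp] theorem deg_single_none (k : ℕ) : deg r (Finsupp.single none k) = k := by
  simp [deg_apply]

@[simp] theorem deg_single_some (c : Cell r ⊕ Cell r) (k : ℕ) :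
    deg r (Finsupp.single (some c) k) = 0 := by simp [deg_apply]

theorem plusSum_plusExp (j i : Fin n) (b : Fin (r i + 1)) :
    plusSum j (plusExp i b) = if j = i ∧ b ≠ 0 then 1 else 0 := by
  induction b using Fin.cases with
  | zero => simp [plusExp_zero]
  | succ a => simp [plusExp_succ, plusSum_single_inl]

theorem plusSum_plusExp_le (j i : Fin n) (b : Fin (r i + 1)) :
    plusSum j (plusExp i b) ≤ if j = i then 1 else 0 := by
  rw [plusSum_plusExp]; split_ifs <;> simp_all

theorem plusExp_inf_add_sup (i : Fin n) (b b' : Fin (r i + 1)) :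
    plusExp i (b ⊓ b') + plusExp i (b ⊔ b') = plusExp i b + plusExp i b' := by
  rcases le_total b b' with h | h
  · rw [inf_eq_left.2 h, sup_eq_right.2 h]
  · rw [inf_eq_right.2 h, sup_eq_left.2 h, add_comm]

variable (r) in
/-- The stable sets `{v_1, …, v_n}` with `v_i ∈ Q_i^+` or `v_i` missing, and the stable sets
`{v}`, `{v, v'}` with `v ∈ Q_i^-` and `v' ∈ Q_i^+`. -/
abbrev Gen : Type := (∀ i, Fin (r i + 1)) ⊕ (Σ i, Fin (r i) × Fin (r i + 1))

/-- The exponent of a stable set. -/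
noncomputable def genExp : Gen r → (Var r →₀ ℕ)
  | Sum.inl b => Finsupp.single none 1 + ∑ i, plusExp i (b i)
  | Sum.inr ⟨i, a, b⟩ => Finsupp.single none 1 + Finsupp.single (some (Sum.inr ⟨i, a⟩)) 1 +
      plusExp i b

theorem deg_genExp (g : Gen r) : deg r (genExp g) = 1 := by
  rcases g with b | ⟨i, a, b⟩
  · simp [genExp]
  · simp [genExp]

theorem plusSum_sum_plusExp (j : Fin n) (b : ∀ i, Fin (r i + 1)) :
    plusSum j (∑ i, plusExp i (b i)) = if b j ≠ 0 then 1 else 0 := by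
  rw [map_sum]
  simp only [plusSum_plusExp]
  rw [Finset.sum_eq_single j]
  · simp
  · intro i _ hi
    rw [if_neg]; tauto
  · simp

theorem genExp_mem (g : Gen r) : genExp g ∈ cliqueMonoid r := by
  rcases g with b | ⟨i, a, b⟩
  · refine mem_cliqueMonoid.2 ⟨by simp [genExp], fun j => ?_⟩
    rw [genExp, map_add, plusSum_sum_plusExp]
    simp only [map_add, map_sum, minusSum_plusExp]
    simp
    split_ifs <;> simp
  · refine mem_cliqueMonoid.2 ⟨by simp [genExp, minusSum_single_inr], fun j => ?_⟩
    have := plusSum_plusExp_le j i b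
    simp only [genExp, map_add, minusSum_single_inr, minusSum_plusExp]
    simp
    split_ifs at this ⊢ <;> omega

theorem exists_pos_of_plusSum {i : Fin n} {m : Var r →₀ ℕ} (h : 0 < plusSum i m) :
    ∃ a, 0 < m (some (Sum.inl ⟨i, a⟩)) := by
  rw [plusSum_apply] at h
  obtain ⟨a, -, ha⟩ := Finset.exists_ne_zero_of_sum_ne_zero h.ne'
  exact ⟨a, Nat.pos_of_ne_zero ha⟩

/-- One can choose a vertex `(i, a)^+` in the support of `m`, if there is one. -/
theorem exists_plusExp (i : Fin n) (m : Var r →₀ ℕ) : ∃ b : Fin (r i + 1),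
    (plusSum i (plusExp i b) = min 1 (plusSum i m)) ∧
    (∀ v, plusExp i b v ≤ m v) ∧ (∀ v, plusExp i b v ≠ 0 → ∃ a, v = some (Sum.inl ⟨i, a⟩)) := by
  rcases Nat.eq_zero_or_pos (plusSum i m) with h | h
  · exact ⟨0, by simp [plusExp_zero, h], by simp [plusExp_zero], by simp [plusExp_zero]⟩
  · obtain ⟨a, ha⟩ := exists_pos_of_plusSum h
    refine ⟨a.succ, ?_, fun v => ?_, fun v hv => ⟨a, ?_⟩⟩
    · rw [plusExp_succ, plusSum_single_inl, if_pos rfl]; omega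
    · classical
      rw [plusExp_succ, Finsupp.single_apply]
      split_ifs with hv
      · rw [← hv]; exact ha
      · exact Nat.zero_le _
    · by_contra h'
      rw [plusExp_succ, Finsupp.single_eq_of_ne h'] at hv
      exact hv rfl

/-- An exponent of positive degree which satisfies the clique inequalities is the sum of the
exponent of a stable set and of another such exponent. -/
theorem exists_genExp_add {m : Var r →₀ ℕ} (hm : m ∈ cliqueMonoid r) (h : 0 < deg r m) :
    ∃ g : Gen r, ∃ m' ∈ cliqueMonoid r, m = genExp g + m' := by
  rw [mem_cliqueMonoid] at hm
  choose b hb1 hb2 hb3 using fun i => exists_plusExp i m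
  -- Without minus vertices in the support, remove one plus vertex from every block that has one.
  -- Otherwise remove a minus vertex of some block `i` together with a plus vertex of the same
  -- block, if there is one; if there is none, the inequality of `Q_i` for the remainder follows
  -- from that of `Q_0`.
  rcases Nat.eq_zero_or_pos (∑ i, minusSum i m) with h0 | h0
  · have hle : genExp (Sum.inl b) ≤ m := by
      intro v
      simp only [genExp, Finsupp.add_apply, Finsupp.finsetSum_apply]
      rcases v with _ | c | c
      · have : ∀ i, plusExp i (b i) none = 0 := fun i => deg_plusExp i (b i)
        simp only [this]
        simpa [Nat.one_le_iff_ne_zero, deg_apply] using h.ne'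
      · rw [Finset.sum_eq_single c.1]
        · simpa using hb2 c.1 _
        · intro i _ hi
          by_contra h'
          obtain ⟨a, ha⟩ := hb3 i _ h'
          simp only [Option.some.injEq, Sum.inl.injEq] at ha
          exact hi (by rw [ha])
        · simp
      · rw [Finset.sum_eq_zero]
        · simp
        · intro i _
          by_contra h'
          obtain ⟨a, ha⟩ := hb3 i _ h'
          simp at ha
    obtain ⟨m', rfl⟩ := exists_add_of_le hle
    refine ⟨Sum.inl b, m', mem_cliqueMonoid.2 ⟨?_, fun i => ?_⟩, rfl⟩
    · simp only [map_add, Finset.sum_add_distrib] at h0; omega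
    · have h2 := hm.2 i
      have hbi := hb1 i
      have h3 : plusSum i (genExp (Sum.inl b)) = plusSum i (plusExp i (b i)) := by
        rw [genExp, map_add, plusSum_sum_plusExp, plusSum_plusExp]; simp
      simp only [map_add, Finset.sum_add_distrib, deg_genExp, h3] at h2 h0 hbi ⊢
      have h4 : minusSum i (genExp (Sum.inl b)) = 0 := by simp [genExp]
      omega
  · obtain ⟨i, -, hi⟩ := Finset.exists_ne_zero_of_sum_ne_zero h0.ne'
    rw [minusSum_apply] at hi
    obtain ⟨a, -, ha⟩ := Finset.exists_ne_zero_of_sum_ne_zero hi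
    have hle : genExp (Sum.inr ⟨i, a, b i⟩) ≤ m := by
      intro v
      simp only [genExp, Finsupp.add_apply]
      rcases v with _ | c | c
      · have : plusExp i (b i) none = 0 := deg_plusExp i (b i)
        rw [this]
        simpa [Nat.one_le_iff_ne_zero, deg_apply] using h.ne'
      · simpa using hb2 i _
      · have : plusExp i (b i) (some (Sum.inr c)) = 0 := by
          by_contra h'
          obtain ⟨a, ha⟩ := hb3 i _ h'
          simp at ha
        rw [this]
        by_cases hc : c = ⟨i, a⟩
        · subst hc; simp; omega
        · rw [Finsupp.single_eq_of_ne (by simp), Finsupp.single_eq_of_ne (by simpa using hc)]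
          exact Nat.zero_le _
    obtain ⟨m', rfl⟩ := exists_add_of_le hle
    have h5 : ∀ j, minusSum j (genExp (Sum.inr ⟨i, a, b i⟩)) = if j = i then 1 else 0 := by
      intro j; simp [genExp, minusSum_single_inr]
    have h6 : ∀ j, plusSum j (genExp (Sum.inr ⟨i, a, b i⟩))
        = if j = i then plusSum i (plusExp i (b i)) else 0 := by
      intro j
      simp only [genExp, map_add, plusSum_single_none, plusSum_single_inr, plusSum_plusExp]
      by_cases hj : j = i <;> simp [hj]
    refine ⟨Sum.inr ⟨i, a, b i⟩, m', mem_cliqueMonoid.2 ⟨?_, fun j => ?_⟩, rfl⟩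
    · have := hm.1
      simp only [map_add, Finset.sum_add_distrib, h5, deg_genExp, Finset.sum_ite_eq',
        Finset.mem_univ, if_true] at this
      omega
    · have h1 := hm.1
      have h2 := hm.2 j
      have hbi := hb1 i
      simp only [map_add, Finset.sum_add_distrib, h5, h6, deg_genExp, Finset.sum_ite_eq',
        Finset.mem_univ, if_true] at h1 h2 hbi ⊢
      by_cases hj : j = i
      · subst hj
        simp only [if_true] at h2 hbi
        have h7 : minusSum j m' ≤ ∑ k, minusSum k m' :=
          Finset.single_le_sum (f := fun j => minusSum j m') (fun _ _ => Nat.zero_le _)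
            (Finset.mem_univ j)
        omega
      · simp only [if_neg hj] at h2
        omega

/-- The exponents are the sums of exponents of stable sets. -/
theorem closure_range_genExp : AddSubmonoid.closure (Set.range (genExp (r := r)))
    = cliqueMonoid r := by
  apply le_antisymm
  · rw [AddSubmonoid.closure_le]
    rintro _ ⟨g, rfl⟩
    exact genExp_mem g
  · intro m hm
    induction hd : deg r m generalizing m with
    | zero =>
      have : m = 0 := by
        have h := mem_cliqueMonoid.1 hm
        rw [hd] at h
        have h1 : ∀ i, minusSum i m = 0 := fun i =>
          Finset.sum_eq_zero_iff.1 (Nat.le_zero.1 h.1) i (Finset.mem_univ i)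
        have h2 : ∀ i, plusSum i m = 0 := fun i => by have := h.2 i; rw [h1] at this; omega
        ext v
        rcases v with _ | ⟨i, a⟩ | ⟨i, a⟩
        · exact hd
        · exact Finset.sum_eq_zero_iff.1 ((plusSum_apply i m).symm.trans (h2 i)) a (Finset.mem_univ a)
        · exact Finset.sum_eq_zero_iff.1 ((minusSum_apply i m).symm.trans (h1 i)) a (Finset.mem_univ a)
      rw [this]; exact AddSubmonoid.zero_mem _
    | succ d ih =>
      obtain ⟨g, m', hm', rfl⟩ := exists_genExp_add hm (by omega)
      rw [map_add, deg_genExp] at hd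
      exact AddSubmonoid.add_mem _ (AddSubmonoid.subset_closure ⟨g, rfl⟩) (ih hm' (by omega))

end Coordinates

end StabFamily

namespace StabFamily

open MvPolynomial

/-! ### Distribution of the stable sets over `2d + 1` slots, and the straightening law. -/

section Slots

variable {n : ℕ} {r : Fin n → ℕ}

variable (r) in
/-- The sum of the numbers `r k` with `k < i`. -/
def offset (i : Fin n) : ℕ := ∑ k ∈ Finset.Iio i, r k

theorem offset_add_le {i j : Fin n} (h : i < j) : offset r i + r i ≤ offset r j := by
  unfold offset
  rw [add_comm, ← Finset.sum_insert (by simp : i ∉ Finset.Iio i)]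
  refine Finset.sum_le_sum_of_subset fun k hk => ?_
  simp only [Finset.mem_insert, Finset.mem_Iio] at hk ⊢
  rcases hk with rfl | hk
  · exact h
  · exact hk.trans h

theorem offset_add_le_dim (i : Fin n) : offset r i + r i ≤ dim r := by
  unfold offset dim
  rw [add_comm, ← Finset.sum_insert (by simp : i ∉ Finset.Iio i)]
  exact Finset.sum_le_sum_of_subset (Finset.subset_univ _)

theorem exists_offset {c : ℕ} (h : c < dim r) : ∃ (i : Fin n) (e : ℕ), e < r i ∧
    c = offset r i + e := by
  classical
  by_contra hcon
  push Not at hcon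
  have key : ∀ (m : ℕ) (hm : m ≤ n), ∑ k : Fin m, r (Fin.castLE hm k) ≤ c := by
    intro m
    induction m with
    | zero => intro _; simp
    | succ m ih =>
      intro hm
      have h1 := ih (by omega)
      rw [Fin.sum_univ_castSucc]
      set i : Fin n := Fin.castLE hm (Fin.last m) with hi
      have h2 : offset r i = ∑ k : Fin m, r (Fin.castLE (by omega : m ≤ n) k) := by
        unfold offset
        symm
        refine Finset.sum_bij (fun k _ => Fin.castLE (by omega : m ≤ n) k) ?_ ?_ ?_ ?_
        · intro k _; simp [hi, Fin.lt_def]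
        · intro a _ b _ h; simpa using h
        · intro b hb
          simp only [hi, Finset.mem_Iio, Fin.lt_def, Fin.val_castLE, Fin.val_last] at hb
          exact ⟨⟨b, hb⟩, Finset.mem_univ _, rfl⟩
        · intro _ _; rfl
      have h3 := hcon i (c - offset r i)
      have h4 : ∀ k : Fin m, Fin.castLE hm k.castSucc = Fin.castLE (by omega : m ≤ n) k :=
        fun _ => rfl
      simp only [h4]
      rw [← h2] at h1 ⊢
      by_contra h5
      exact h3 (by omega) (by omega)
  have := key n le_rfl
  unfold dim at h
  simp at this
  omega

/-- The rank of a choice function. -/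
def rankSum (b : ∀ i, Fin (r i + 1)) : ℕ := ∑ i, (b i : ℕ)

theorem rankSum_le (b : ∀ i, Fin (r i + 1)) : rankSum b ≤ dim r :=
  Finset.sum_le_sum fun i _ => Nat.lt_succ_iff.1 (b i).2

open Classical in
/-- The slot of a choice function. -/
noncomputable def slotPlus (b : ∀ i, Fin (r i + 1)) : ℕ :=
  -- Slot `0` is reserved for the empty set, and block `i` owns the `2 * r i` slots from `1 + 2 *
  -- offset r i` on. A choice function of rank `offset r i + e + 1` goes to the first or the second
  -- half of block `i`, according to whether `e < b i`; this is what makes collisions with minus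
  -- vertices straighten downwards.
  if h : rankSum b = 0 then 0 else
    let i := (exists_offset (r := r) (c := rankSum b - 1) (by have := rankSum_le b; omega)).choose
    let e := rankSum b - 1 - offset r i
    if e < (b i : ℕ) then 1 + 2 * offset r i + e else 1 + 2 * offset r i + e + r i

theorem offset_unique {i j : Fin n} {e f : ℕ} (he : e < r i) (hf : f < r j)
    (h : offset r i + e = offset r j + f) : i = j ∧ e = f := by
  rcases lt_trichotomy i j with hij | rfl | hij
  · have := offset_add_le (r := r) hij; omega
  · exact ⟨rfl, by omega⟩
  · have := offset_add_le (r := r) hij; omega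

theorem two_offset_unique {i j : Fin n} {e f : ℕ} (he : e < 2 * r i) (hf : f < 2 * r j)
    (h : 2 * offset r i + e = 2 * offset r j + f) : i = j ∧ e = f := by
  rcases lt_trichotomy i j with hij | rfl | hij
  · have := offset_add_le (r := r) hij; omega
  · exact ⟨rfl, by omega⟩
  · have := offset_add_le (r := r) hij; omega

theorem slotPlus_of_rankSum_eq_zero {b : ∀ i, Fin (r i + 1)} (h : rankSum b = 0) :
    slotPlus b = 0 := dif_pos h

theorem slotPlus_eq {b : ∀ i, Fin (r i + 1)} {i : Fin n} {e : ℕ} (he : e < r i)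
    (h : rankSum b = offset r i + e + 1) :
    slotPlus b = if e < (b i : ℕ) then 1 + 2 * offset r i + e else 1 + 2 * offset r i + e + r i := by
  have h0 : rankSum b ≠ 0 := by omega
  have hex := exists_offset (r := r) (c := rankSum b - 1) (by have := rankSum_le b; omega)
  obtain ⟨f, hf, hc⟩ := hex.choose_spec
  obtain ⟨h1, h2⟩ := offset_unique he hf (by omega)
  unfold slotPlus
  rw [dif_neg h0]
  dsimp only
  rw [← h1]
  have : rankSum b - 1 - offset r i = e := by omega
  rw [this]

theorem slotPlus_cases (b : ∀ i, Fin (r i + 1)) : (rankSum b = 0 ∧ slotPlus b = 0) ∨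
    ∃ i e, e < r i ∧ rankSum b = offset r i + e + 1 ∧
      ((e < (b i : ℕ) ∧ slotPlus b = 1 + 2 * offset r i + e) ∨
      ((b i : ℕ) ≤ e ∧ slotPlus b = 1 + 2 * offset r i + e + r i)) := by
  by_cases h : rankSum b = 0
  · exact Or.inl ⟨h, slotPlus_of_rankSum_eq_zero h⟩
  · right
    obtain ⟨i, e, he, hc⟩ := exists_offset (r := r) (c := rankSum b - 1)
      (by have := rankSum_le b; omega)
    refine ⟨i, e, he, by omega, ?_⟩
    have := slotPlus_eq (b := b) he (by omega)
    split_ifs at this with h1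
    · exact Or.inl ⟨h1, this⟩
    · exact Or.inr ⟨by omega, this⟩

/-- The slot of a stable set: the stable sets in a given slot are summed up to a parameter. -/
noncomputable def slot : Gen r → ℕ
  | Sum.inl b => slotPlus b
  -- The sum `a + b` runs from `0` to `2 * r i - 1`, so it fills exactly the slots of block `i`.
  | Sum.inr ⟨i, a, b⟩ => 1 + 2 * offset r i + a + b

theorem slot_lt (g : Gen r) : slot g < 2 * dim r + 1 := by
  rcases g with b | ⟨i, a, b⟩
  · rcases slotPlus_cases b with ⟨-, h⟩ | ⟨i, e, he, -, ⟨-, h⟩ | ⟨-, h⟩⟩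
    · simp [slot, h]
    all_goals
      have := offset_add_le_dim (r := r) i
      simp only [slot, h]; omega
  · have := offset_add_le_dim (r := r) i
    have := a.2; have := b.2
    simp only [slot]; omega

theorem slotPlus_lt_of_rankSum_le {b : ∀ i, Fin (r i + 1)} {i : Fin n}
    (h : rankSum b ≤ offset r i) : slotPlus b < 1 + 2 * offset r i := by
  rcases slotPlus_cases b with ⟨-, h'⟩ | ⟨j, e, he, hc, hs⟩
  · omega
  · have : j < i := by
      by_contra hij
      rcases eq_or_lt_of_le (not_lt.1 hij) with rfl | hij
      · omega
      · have := offset_add_le (r := r) hij; omega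
    have := offset_add_le (r := r) this
    omega

/-- Straightening: the product of two distinct stable sets in the same slot is the product of two
stable sets, one of which is in a lower slot. -/
theorem exists_lower_slot {g g' : Gen r} (hne : g ≠ g') (hs : slot g = slot g') :
    ∃ h h' : Gen r, slot h < slot g ∧ genExp g + genExp g' = genExp h + genExp h' := by
  have mixed : ∀ (b : ∀ i, Fin (r i + 1)) (i : Fin n) (a : Fin (r i)) (c : Fin (r i + 1)),
      slot (Sum.inl b) = slot (Sum.inr ⟨i, a, c⟩ : Gen r) →
      ∃ h h' : Gen r, slot h < slot (Sum.inl b) ∧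
        genExp (Sum.inl b) + genExp (Sum.inr ⟨i, a, c⟩) = genExp h + genExp h' := by
    intro b i a c hs
    classical
    -- The two stable sets exchange their plus vertices in block `i`.
    have hexp : genExp (Sum.inl b) + genExp (Sum.inr ⟨i, a, c⟩ : Gen r)
        = genExp (Sum.inl (Function.update b i c)) + genExp (Sum.inr ⟨i, a, b i⟩) := by
      have h1 : ∑ j, plusExp j (b j) = plusExp i (b i) +
          ∑ j ∈ Finset.univ.erase i, plusExp j (b j) :=
        (Finset.add_sum_erase _ _ (Finset.mem_univ i)).symm
      have h2 : ∑ j, plusExp j (Function.update b i c j) = plusExp i c +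
          ∑ j ∈ Finset.univ.erase i, plusExp j (b j) := by
        rw [← Finset.add_sum_erase _ _ (Finset.mem_univ i), Function.update_self]
        congr 1
        refine Finset.sum_congr rfl fun j hj => ?_
        rw [Function.update_of_ne (Finset.ne_of_mem_erase hj)]
      simp only [genExp, h1, h2]
      abel
    have hrank : rankSum (Function.update b i c) + b i = rankSum b + c := by
      unfold rankSum
      rw [← Finset.add_sum_erase _ _ (Finset.mem_univ i), Function.update_self,
        ← Finset.add_sum_erase _ (fun j => (b j : ℕ)) (Finset.mem_univ i)]
      have : ∑ j ∈ Finset.univ.erase i, ((Function.update b i c j : Fin (r j + 1)) : ℕ)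
          = ∑ j ∈ Finset.univ.erase i, (b j : ℕ) :=
        Finset.sum_congr rfl fun j hj => by
          rw [Function.update_of_ne (Finset.ne_of_mem_erase hj)]
      omega
    have ha := a.2; have hc := c.2; have hb := (b i).2
    simp only [slot] at hs ⊢
    rcases slotPlus_cases b with ⟨-, h⟩ | ⟨j, e, he, hr, ⟨hbe, h⟩ | ⟨hbe, h⟩⟩
    · omega
    -- First half: `c ≤ a + c = e < b j`, so replacing `b j` by `c` lowers the rank, and the new
    -- choice function stays in the first half or leaves the block downwards.
    · obtain ⟨rfl, hea⟩ := two_offset_unique (r := r) (i := j) (j := i) (e := e)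
        (f := a + c) (by omega) (by omega) (by omega)
      refine ⟨Sum.inl (Function.update b j c), _, ?_, hexp⟩
      simp only
      by_cases hle : rankSum (Function.update b j c) ≤ offset r j
      · have := slotPlus_lt_of_rankSum_le hle; omega
      · have h3 := slotPlus_eq (b := Function.update b j c) (i := j)
          (e := rankSum (Function.update b j c) - offset r j - 1) (by omega) (by omega)
        rw [Function.update_self, if_pos (by omega)] at h3
        omega
    -- Second half: here `b j ≤ e` and `a < r j`, so the lower slot is that of the minus vertex with
    -- its new partner, since `a + b j < e + r j`.
    · obtain ⟨rfl, hea⟩ := two_offset_unique (r := r) (i := j) (j := i) (e := e + r j)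
        (f := a + c) (by omega) (by omega) (by omega)
      refine ⟨Sum.inr ⟨j, a, b j⟩, Sum.inl (Function.update b j c), ?_, by rw [hexp, add_comm]⟩
      simp only
      omega
  rcases g with b | ⟨i, a, c⟩ <;> rcases g' with b' | ⟨i', a', c'⟩
  · have hbb : b ≠ b' := fun h => hne (by rw [h])
    -- A slot determines the rank, and rank zero is attained only once.
    have hranks : rankSum b = rankSum b' ∧ rankSum b ≠ 0 := by
      simp only [slot] at hs
      have hz : ∀ b : ∀ i, Fin (r i + 1), rankSum b = 0 → b = fun _ => 0 := fun b hb =>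
        funext fun i => Fin.ext (Finset.sum_eq_zero_iff.1 hb i (Finset.mem_univ i))
      rcases slotPlus_cases b with ⟨h0, h⟩ | ⟨i, e, he, hr, h⟩ <;>
      rcases slotPlus_cases b' with ⟨h0', h'⟩ | ⟨i', e', he', hr', h'⟩
      · exact absurd ((hz b h0).trans (hz b' h0').symm) hbb
      · omega
      · omega
      · rcases h with ⟨h1, h⟩ | ⟨h1, h⟩ <;> rcases h' with ⟨h1', h'⟩ | ⟨h1', h'⟩
        · obtain ⟨rfl, h2⟩ := two_offset_unique (r := r) (i := i) (j := i') (e := e) (f := e')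
            (by omega) (by omega) (by omega)
          omega
        · obtain ⟨rfl, h2⟩ := two_offset_unique (r := r) (i := i) (j := i') (e := e)
            (f := e' + r i') (by omega) (by omega) (by omega)
          omega
        · obtain ⟨rfl, h2⟩ := two_offset_unique (r := r) (i := i) (j := i') (e := e + r i)
            (f := e') (by omega) (by omega) (by omega)
          omega
        · obtain ⟨rfl, h2⟩ := two_offset_unique (r := r) (i := i) (j := i') (e := e + r i)
            (f := e' + r i') (by omega) (by omega) (by omega)
          omega
    have hlt : rankSum (b ⊓ b') < rankSum b := by
      refine lt_of_le_of_ne (Finset.sum_le_sum fun i _ => ?_) fun heq => ?_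
      · exact_mod_cast (inf_le_left : b ⊓ b' ≤ b) i
      · have h1 : ∀ i ∈ Finset.univ, ((b ⊓ b') i : ℕ) = b i :=
          (Finset.sum_eq_sum_iff_of_le fun i _ => by
            exact_mod_cast (inf_le_left : b ⊓ b' ≤ b) i).1 heq
        have h2 : ∀ i ∈ Finset.univ, ((b ⊓ b') i : ℕ) = b' i :=
          (Finset.sum_eq_sum_iff_of_le fun i _ => by
            exact_mod_cast (inf_le_right : b ⊓ b' ≤ b') i).1 (heq.trans hranks.1)
        exact hbb (funext fun i => Fin.ext
          ((h1 i (Finset.mem_univ i)).symm.trans (h2 i (Finset.mem_univ i))))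
    -- Both functions lie in the same half of the same block. Their meet has smaller rank, and if
    -- `e` is below both values at `i` then the smaller `e` of the meet is below their minimum, so
    -- it does not jump to the second half.
    refine ⟨Sum.inl (b ⊓ b'), Sum.inl (b ⊔ b'), ?_, ?_⟩
    · simp only [slot] at hs ⊢
      rcases slotPlus_cases b with ⟨h0, h⟩ | ⟨i, e, he, hr, h⟩
      · omega
      · by_cases hle : rankSum (b ⊓ b') ≤ offset r i
        · have := slotPlus_lt_of_rankSum_le hle; omega
        · have h3 := slotPlus_eq (b := b ⊓ b') (i := i)
            (e := rankSum (b ⊓ b') - offset r i - 1) (by omega) (by omega)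
          have h4 := slotPlus_eq (b := b') (i := i) (e := e) (by omega) (by omega)
          have h5 : ((b ⊓ b') i : ℕ) = min (b i : ℕ) (b' i : ℕ) :=
            (Fin.val_strictMono.monotone.map_min)
          split_ifs at h3 h4 <;> omega
    · have h1 : ∑ i, plusExp i ((b ⊓ b') i) + ∑ i, plusExp i ((b ⊔ b') i)
          = ∑ i, plusExp i (b i) + ∑ i, plusExp i (b' i) := by
        rw [← Finset.sum_add_distrib, ← Finset.sum_add_distrib]
        exact Finset.sum_congr rfl fun i _ => plusExp_inf_add_sup i (b i) (b' i)
      simp only [genExp]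
      rw [add_add_add_comm, ← h1, add_add_add_comm]
  · exact mixed b i' a' c' hs
  · obtain ⟨h, h', h1, h2⟩ := mixed b' i a c hs.symm
    exact ⟨h, h', hs ▸ h1, by rw [add_comm, h2]⟩
  · have ha := a.2; have hc := c.2; have ha' := a'.2; have hc' := c'.2
    simp only [slot] at hs
    obtain ⟨rfl, h⟩ := two_offset_unique (r := r) (i := i) (j := i') (e := a + c)
      (f := a' + c') (by omega) (by omega) (by omega)
    have hne' : (a : ℕ) ≠ a' := fun haa => hne (by
      rw [Fin.ext haa, Fin.ext (by omega : (c : ℕ) = c')])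
    -- Two minus vertices of one block exchange partners; as `a + c` is constant, the smaller minus
    -- vertex gets the smaller partner.
    have key : ∀ (a a' : Fin (r i)) (c c' : Fin (r i + 1)), (a : ℕ) < a' →
        (a : ℕ) + c = a' + c' →
        (a : ℕ) + c' < a + c ∧ genExp (Sum.inr ⟨i, a, c⟩ : Gen r) + genExp (Sum.inr ⟨i, a', c'⟩)
          = genExp (Sum.inr ⟨i, a, c'⟩) + genExp (Sum.inr ⟨i, a', c⟩) := by
      intro a a' c c' h1 h2
      refine ⟨by omega, ?_⟩
      simp only [genExp]
      abel
    rcases lt_or_gt_of_ne hne' with hlt | hlt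
    · obtain ⟨h1, h2⟩ := key a a' c c' hlt h
      exact ⟨_, _, by simp only [slot]; omega, h2⟩
    · obtain ⟨h1, h2⟩ := key a' a c' c hlt h.symm
      exact ⟨Sum.inr ⟨i, a', c⟩, Sum.inr ⟨i, a, c'⟩, by simp only [slot]; omega,
        by rw [add_comm, h2]⟩

end Slots

end StabFamily

namespace StabFamily

open MvPolynomial

/-! ### Graded pieces of monomial rings, and the ideals generated by linear parameters. -/

section Graded

variable {σ : Type*} (K : Type*) [CommRing K] (M : AddSubmonoid (σ →₀ ℕ)) (δ : (σ →₀ ℕ) →+ ℕ)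

/-- The homogeneous elements of degree `j` of a monomial ring. -/
def grade (j : ℕ) : Submodule K (MvPolynomial σ K) where
  carrier := {f | ∀ m, coeff m f ≠ 0 → m ∈ M ∧ δ m = j}
  zero_mem' := fun m hm => absurd (coeff_zero m) hm
  add_mem' := by
    intro f g hf hg m hm
    by_contra h
    exact hm (by rw [coeff_add, not_not.1 (mt (hf m) h), not_not.1 (mt (hg m) h), add_zero])
  smul_mem' := by
    intro c f hf m hm
    rw [coeff_smul, smul_eq_mul] at hm
    exact hf m (right_ne_zero_of_mul hm)

variable {K M δ}

theorem grade_le (j : ℕ) {f : MvPolynomial σ K} (hf : f ∈ grade K M δ j) :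
    f ∈ monomialRing K M := fun m hm => (hf m hm).1

theorem monomial_mem_grade {m : σ →₀ ℕ} (hm : m ∈ M) {j : ℕ} (hj : δ m = j) (c : K) :
    monomial m c ∈ grade K M δ j := by
  classical
  intro m' h
  rw [coeff_monomial] at h
  by_cases h' : m = m'
  · exact h' ▸ ⟨hm, hj⟩
  · exact absurd (if_neg h') h

theorem mul_mem_grade {i j : ℕ} {f g : MvPolynomial σ K} (hf : f ∈ grade K M δ i)
    (hg : g ∈ grade K M δ j) : f * g ∈ grade K M δ (i + j) := by
  classical
  intro m hm
  rw [coeff_mul] at hm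
  obtain ⟨⟨a, b⟩, hab, h⟩ := Finset.exists_ne_zero_of_sum_ne_zero hm
  rw [Finset.HasAntidiagonal.mem_antidiagonal] at hab
  have h1 := hf a (left_ne_zero_of_mul h)
  have h2 := hg b (right_ne_zero_of_mul h)
  rw [← hab]
  exact ⟨M.add_mem h1.1 h2.1, by simp only [map_add, h1.2, h2.2]⟩

theorem grade_eq_span (j : ℕ) : grade K M δ j =
    Submodule.span K ((fun m => monomial m (1 : K)) '' {m | m ∈ M ∧ δ m = j}) := by
  apply le_antisymm
  · intro f hf
    rw [as_sum f]
    refine Submodule.sum_mem _ fun m hm => ?_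
    rw [← mul_one (coeff m f), ← smul_eq_mul, ← smul_monomial]
    exact Submodule.smul_mem _ _ (Submodule.subset_span ⟨m, hf m (mem_support_iff.1 hm), rfl⟩)
  · rw [Submodule.span_le]
    rintro _ ⟨m, hm, rfl⟩
    exact monomial_mem_grade hm.1 hm.2 _

variable (δ) in
/-- The homogeneous component of degree `j`. -/
noncomputable def component (j : ℕ) (f : MvPolynomial σ K) : MvPolynomial σ K :=
  AddMonoidAlgebra.ofCoeff (Finsupp.filter (fun m => δ m = j) (AddMonoidAlgebra.coeff f))

theorem coeff_component (j : ℕ) (f : MvPolynomial σ K) (m : σ →₀ ℕ) :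
    coeff m (component δ j f) = if δ m = j then coeff m f else 0 := by
  classical
  exact Finsupp.filter_apply _ _ _

theorem component_sum {ι : Type*} (j : ℕ) (s : Finset ι) (f : ι → MvPolynomial σ K) :
    component δ j (∑ i ∈ s, f i) = ∑ i ∈ s, component δ j (f i) := by
  ext m
  simp only [coeff_component, coeff_sum]
  split_ifs <;> simp

theorem component_mem {f : MvPolynomial σ K} (hf : f ∈ monomialRing K M) (j : ℕ) :
    component δ j f ∈ grade K M δ j := by
  intro m hm
  rw [coeff_component] at hm
  split_ifs at hm with h
  · exact ⟨hf m hm, h⟩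
  · exact absurd rfl hm

theorem component_of_mem {f : MvPolynomial σ K} {j : ℕ} (hf : f ∈ grade K M δ j) :
    component δ j f = f := by
  ext m
  rw [coeff_component]
  split_ifs with h
  · rfl
  · by_contra h'
    exact h (hf m (Ne.symm h')).2

theorem sum_component (f : MvPolynomial σ K) :
    ∑ j ∈ f.support.image δ, component δ j f = f := by
  classical
  ext m
  simp only [coeff_sum, coeff_component, Finset.sum_ite_eq]
  split_ifs with h
  · rfl
  · by_contra h'
    exact h (Finset.mem_image_of_mem _ (mem_support_iff.2 (Ne.symm h')))

theorem component_monomial_mul {g : σ →₀ ℕ} (hg : δ g = 1) (j : ℕ) (f : MvPolynomial σ K) :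
    component δ (j + 1) (monomial g 1 * f) = monomial g 1 * component δ j f := by
  ext m
  rw [coeff_component, coeff_monomial_mul', coeff_monomial_mul', coeff_component]
  by_cases h : g ≤ m
  · obtain ⟨m', rfl⟩ := exists_add_of_le h
    rw [if_pos h, if_pos h, add_tsub_cancel_left, map_add, hg, add_comm]
    by_cases h' : δ m' = j
    · rw [if_pos (by omega), if_pos h']
    · rw [if_neg (by omega), if_neg h', mul_zero]
  · rw [if_neg h, if_neg h, ite_self]

theorem component_zero_monomial_mul {g : σ →₀ ℕ} (hg : δ g = 1) (f : MvPolynomial σ K) :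
    component δ 0 (monomial g 1 * f) = 0 := by
  ext m
  rw [coeff_component, coeff_monomial_mul', coeff_zero]
  by_cases h : g ≤ m
  · obtain ⟨m', rfl⟩ := exists_add_of_le h
    rw [map_add, hg, if_neg (by omega)]
  · rw [if_neg h, ite_self]

end Graded

section Params

variable {σ : Type*} (K : Type*) [CommRing K] (M : AddSubmonoid (σ →₀ ℕ)) (δ : (σ →₀ ℕ) →+ ℕ)
variable {ι : Type*} (G : ι → Finset (σ →₀ ℕ))

/-- The sum of the monomials with exponents in `G i`. -/
noncomputable def param (i : ι) : MvPolynomial σ K := ∑ g ∈ G i, monomial g 1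

/-- The homogeneous elements of degree `j` of the ideal generated by the parameters with index
in `J`. -/
noncomputable def paramIdeal (J : Finset ι) : ℕ → Submodule K (MvPolynomial σ K)
  | 0 => ⊥
  | j + 1 => ⨆ i ∈ J, (grade K M δ j).map (LinearMap.mulLeft K (param K G i))

variable {K M δ G}

theorem component_param_mul (hδ : ∀ i, ∀ g ∈ G i, δ g = 1) (i : ι) (j : ℕ)
    (f : MvPolynomial σ K) :
    component δ (j + 1) (param K G i * f) = param K G i * component δ j f := by
  simp only [param, Finset.sum_mul, component_sum]
  exact Finset.sum_congr rfl fun g hg => component_monomial_mul (hδ i g hg) j f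

theorem component_zero_param_mul (hδ : ∀ i, ∀ g ∈ G i, δ g = 1) (i : ι)
    (f : MvPolynomial σ K) : component δ 0 (param K G i * f) = 0 := by
  simp only [param, Finset.sum_mul, component_sum]
  exact Finset.sum_eq_zero fun g hg => component_zero_monomial_mul (hδ i g hg) f

theorem param_mem_grade (hM : ∀ i, ∀ g ∈ G i, g ∈ M) (hδ : ∀ i, ∀ g ∈ G i, δ g = 1) (i : ι) :
    param K G i ∈ grade K M δ 1 :=
  Submodule.sum_mem _ fun g hg => monomial_mem_grade (hM i g hg) (hδ i g hg) _

theorem mem_paramIdeal_succ {J : Finset ι} {j : ℕ} {f : MvPolynomial σ K} :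
    f ∈ paramIdeal K M δ G J (j + 1) ↔
      ∃ s : ι → MvPolynomial σ K, (∀ i ∈ J, s i ∈ grade K M δ j) ∧
        f = ∑ i ∈ J, param K G i * s i := by
  classical
  constructor
  · intro hf
    rw [paramIdeal, Submodule.mem_iSup_finset_iff_exists_sum] at hf
    obtain ⟨μ, hμ⟩ := hf
    have : ∀ i, ∃ s ∈ grade K M δ j, param K G i * s = μ i := fun i => (μ i).2
    choose s hs1 hs2 using this
    exact ⟨s, fun i _ => hs1 i, by rw [← hμ]; exact Finset.sum_congr rfl fun i _ => (hs2 i).symm⟩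
  · rintro ⟨s, hs, rfl⟩
    refine Submodule.sum_mem _ fun i hi => ?_
    exact Submodule.mem_iSup_of_mem i (Submodule.mem_iSup_of_mem hi ⟨s i, hs i hi, rfl⟩)

theorem component_mem_paramIdeal (hδ : ∀ i, ∀ g ∈ G i, δ g = 1) {J : Finset ι}
    {s : ι → MvPolynomial σ K} (hs : ∀ i ∈ J, s i ∈ monomialRing K M) (j : ℕ) :
    component δ j (∑ i ∈ J, param K G i * s i) ∈ paramIdeal K M δ G J j := by
  rw [component_sum]
  rcases j with _ | j
  · rw [Finset.sum_eq_zero fun i _ => component_zero_param_mul hδ i _]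
    exact Submodule.zero_mem _
  · exact mem_paramIdeal_succ.2 ⟨fun i => component δ j (s i),
      fun i hi => component_mem (hs i hi) j,
      Finset.sum_congr rfl fun i _ => component_param_mul hδ i j _⟩

theorem paramIdeal_le_grade (hM : ∀ i, ∀ g ∈ G i, g ∈ M) (hδ : ∀ i, ∀ g ∈ G i, δ g = 1)
    (J : Finset ι) (j : ℕ) : paramIdeal K M δ G J j ≤ grade K M δ j := by
  rcases j with _ | j
  · exact bot_le
  · intro f hf
    obtain ⟨s, hs, rfl⟩ := mem_paramIdeal_succ.1 hf
    refine Submodule.sum_mem _ fun i hi => ?_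
    rw [add_comm j 1]
    exact mul_mem_grade (param_mem_grade hM hδ i) (hs i hi)

/-- If `W` spans modulo the parameters, then the products of elements of `W` and of monomials in
the parameters span. -/
theorem grade_le_span [Fintype ι] {W : Set (σ →₀ ℕ)}
    (hW : ∀ j, grade K M δ j ≤ Submodule.span K
      ((fun m => monomial m (1 : K)) '' {m | m ∈ W ∧ δ m = j}) ⊔
        paramIdeal K M δ G Finset.univ j) (j : ℕ) :
    grade K M δ j ≤ Submodule.span K {f | ∃ w ∈ W, ∃ ν : ι →₀ ℕ, δ w + ν.degree = j ∧
      f = (aeval (param K G) (monomial ν (1 : K))) * monomial w 1} := by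
  -- Graded Nakayama: the part in the ideal of the parameters has cofactors of smaller degree, to
  -- which the induction applies.
  induction j with
  | zero =>
    refine (hW 0).trans (sup_le ?_ bot_le)
    rw [Submodule.span_le]
    rintro _ ⟨w, ⟨hw, hw0⟩, rfl⟩
    refine Submodule.subset_span ⟨w, hw, 0, by simp [hw0], by simp⟩
  | succ j ih =>
    refine (hW (j + 1)).trans (sup_le ?_ ?_)
    · rw [Submodule.span_le]
      rintro _ ⟨w, ⟨hw, hw0⟩, rfl⟩
      refine Submodule.subset_span ⟨w, hw, 0, by simp [hw0], by simp⟩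
    · rw [paramIdeal]
      refine iSup₂_le fun i _ => ?_
      rw [Submodule.map_le_iff_le_comap]
      refine ih.trans ?_
      rw [Submodule.span_le]
      rintro _ ⟨w, hw, ν, hν, rfl⟩
      refine Submodule.subset_span ⟨w, hw, ν + Finsupp.single i 1, ?_, ?_⟩
      · rw [map_add, Finsupp.degree_single]; omega
      · have hm : monomial (ν + Finsupp.single i 1) (1 : K) = X i * monomial ν 1 := by
          rw [X, monomial_mul, mul_one, add_comm]
        rw [LinearMap.mulLeft_apply, ← mul_assoc, hm, map_mul, aeval_X]

end Params

end StabFamily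

namespace StabFamily

open MvPolynomial

/-! ### Hilbert series modulo a regular sequence. -/

section Hilbert

variable {σ : Type*} {K : Type*} [Field K] {M : AddSubmonoid (σ →₀ ℕ)} {δ : (σ →₀ ℕ) →+ ℕ}
variable {ι : Type*} {G : ι → Finset (σ →₀ ℕ)}

variable (M δ) in
/-- The Hilbert function of a graded monoid. -/
noncomputable def hilb (j : ℕ) : ℕ := Nat.card {m // m ∈ M ∧ δ m = j}

theorem linearIndependent_monomial (s : Set (σ →₀ ℕ)) :
    LinearIndependent K (fun m : s => monomial (m : σ →₀ ℕ) (1 : K)) := by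
  have h := (basisMonomials σ K).linearIndependent.comp (fun m : s => (m : σ →₀ ℕ))
    Subtype.val_injective
  have h2 : (basisMonomials σ K) ∘ (fun m : s => (m : σ →₀ ℕ)) = fun m : s =>
      monomial (m : σ →₀ ℕ) (1 : K) := by
    ext1 m; simp
  rwa [h2] at h

theorem finite_grade (hfin : ∀ j, {m | m ∈ M ∧ δ m = j}.Finite) (j : ℕ) : FiniteDimensional K (grade K M δ j) := by
  rw [grade_eq_span]
  exact FiniteDimensional.span_of_finite K ((hfin j).image _)

theorem finrank_grade (hfin : ∀ j, {m | m ∈ M ∧ δ m = j}.Finite) (j : ℕ) :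
    Module.finrank K (grade K M δ j) = hilb M δ j := by
  have : Fintype ↑{m | m ∈ M ∧ δ m = j} := (hfin j).fintype
  rw [grade_eq_span, Set.image_eq_range, hilb]
  rw [finrank_span_eq_card (linearIndependent_monomial _)]
  exact (Nat.card_eq_fintype_card (α := ↑{m | m ∈ M ∧ δ m = j})).symm

theorem finite_paramIdeal (hfin : ∀ j, {m | m ∈ M ∧ δ m = j}.Finite)
    (hM : ∀ i, ∀ g ∈ G i, g ∈ M) (hδ : ∀ i, ∀ g ∈ G i, δ g = 1)
    (J : Finset ι) (j : ℕ) : FiniteDimensional K (paramIdeal K M δ G J j) := by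
  have := finite_grade (K := K) hfin j
  exact Submodule.finiteDimensional_of_le (paramIdeal_le_grade hM hδ J j)

theorem param_ne_zero {i : ι} (h : (G i).Nonempty) : param K G i ≠ 0 := by
  classical
  obtain ⟨g, hg⟩ := h
  intro h0
  have := congrArg (coeff g) h0
  simp only [param, coeff_sum, coeff_monomial, Finset.sum_ite_eq', if_pos hg, coeff_zero] at this
  exact one_ne_zero this

theorem paramIdeal_insert [DecidableEq ι] (i : ι) (J : Finset ι) (j : ℕ) :
    paramIdeal K M δ G (insert i J) (j + 1) =
      (grade K M δ j).map (LinearMap.mulLeft K (param K G i)) ⊔ paramIdeal K M δ G J (j + 1) := by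
  simp only [paramIdeal]
  rw [Finset.iSup_insert]

theorem param_mul_mem_paramIdeal (hM : ∀ i, ∀ g ∈ G i, g ∈ M) (hδ : ∀ i, ∀ g ∈ G i, δ g = 1)
    (i : ι) {J : Finset ι} {j : ℕ} {f : MvPolynomial σ K} (hf : f ∈ paramIdeal K M δ G J j) :
    param K G i * f ∈ paramIdeal K M δ G J (j + 1) := by
  rcases j with _ | j
  · obtain rfl : f = 0 := hf
    rw [mul_zero]; exact Submodule.zero_mem _
  · obtain ⟨s, hs, rfl⟩ := mem_paramIdeal_succ.1 hf
    refine mem_paramIdeal_succ.2 ⟨fun l => param K G i * s l, fun l hl => ?_, ?_⟩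
    · rw [add_comm j 1]
      exact mul_mem_grade (param_mem_grade hM hδ i) (hs l hl)
    · rw [Finset.mul_sum]
      exact Finset.sum_congr rfl fun l _ => mul_left_comm _ _ _

/-- Inclusion–exclusion for the sum of the multiples of the new parameter and the old ideal. By
regularity their intersection is the new parameter times the old ideal, one degree lower. -/
theorem finrank_paramIdeal_insert [DecidableEq ι] (hfin : ∀ j, {m | m ∈ M ∧ δ m = j}.Finite)
    (hM : ∀ i, ∀ g ∈ G i, g ∈ M)
    (hδ : ∀ i, ∀ g ∈ G i, δ g = 1) (hG : ∀ i, (G i).Nonempty) {J : Finset ι} {i : ι}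
    (hreg : ∀ j, ∀ f ∈ grade K M δ j, param K G i * f ∈ paramIdeal K M δ G J (j + 1) →
      f ∈ paramIdeal K M δ G J j) (j : ℕ) :
    Module.finrank K (paramIdeal K M δ G (insert i J) (j + 1)) +
      Module.finrank K (paramIdeal K M δ G J j) =
    hilb M δ j + Module.finrank K (paramIdeal K M δ G J (j + 1)) := by
  have h1 := finite_grade (K := K) hfin j
  have h2 := finite_paramIdeal (K := K) hfin hM hδ J (j + 1)
  have hinj : Function.Injective (LinearMap.mulLeft K (param K G i)) := fun a b hab =>
    mul_left_cancel₀ (param_ne_zero (hG i)) hab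
  have h3 := Submodule.finrank_sup_add_finrank_inf_eq
    ((grade K M δ j).map (LinearMap.mulLeft K (param K G i))) (paramIdeal K M δ G J (j + 1))
  have h4 : (grade K M δ j).map (LinearMap.mulLeft K (param K G i)) ⊓
      paramIdeal K M δ G J (j + 1) =
      (paramIdeal K M δ G J j).map (LinearMap.mulLeft K (param K G i)) := by
    apply le_antisymm
    · rintro _ ⟨⟨f, hf, rfl⟩, hf2⟩
      exact ⟨f, hreg j f hf hf2, rfl⟩
    · rintro _ ⟨f, hf, rfl⟩
      exact ⟨⟨f, paramIdeal_le_grade hM hδ J j hf, rfl⟩, param_mul_mem_paramIdeal hM hδ i hf⟩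
  have h5 : ∀ S : Submodule K (MvPolynomial σ K), Module.finrank K
      (S.map (LinearMap.mulLeft K (param K G i))) = Module.finrank K S := fun S =>
    (Submodule.equivMapOfInjective _ hinj S).finrank_eq.symm
  rw [paramIdeal_insert, ← finrank_grade (K := K) hfin, ← h5 (grade K M δ j), ← h3, h4, h5]

/-- The Hilbert series modulo a regular sequence of parameters. -/
theorem mk_hilb_sub_finrank (hfin : ∀ j, {m | m ∈ M ∧ δ m = j}.Finite)
    (hM : ∀ i, ∀ g ∈ G i, g ∈ M)
    (hδ : ∀ i, ∀ g ∈ G i, δ g = 1) (hG : ∀ i, (G i).Nonempty)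
    (hreg : ∀ (J : Finset ι) (i : ι), i ∉ J → ∀ j, ∀ f ∈ grade K M δ j,
      param K G i * f ∈ paramIdeal K M δ G J (j + 1) → f ∈ paramIdeal K M δ G J j)
    (J : Finset ι) :
    PowerSeries.mk (fun j => (hilb M δ j : ℤ) - Module.finrank K (paramIdeal K M δ G J j)) =
      (1 - PowerSeries.X) ^ J.card * PowerSeries.mk (fun j => (hilb M δ j : ℤ)) := by
  classical
  induction J using Finset.induction_on with
  | empty =>
    rw [Finset.card_empty, pow_zero, one_mul]
    congr 1
    ext j
    have : paramIdeal K M δ G ∅ j = ⊥ := by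
      rcases j with _ | j
      · rfl
      · simp [paramIdeal]
    rw [this]; simp
  | insert i J hi ih =>
    rw [Finset.card_insert_of_notMem hi, pow_succ', mul_assoc, ← ih]
    ext j
    rcases j with _ | j
    · have : ∀ J, paramIdeal K M δ G J 0 = ⊥ := fun _ => rfl
      rw [sub_mul, one_mul, map_sub, PowerSeries.coeff_zero_X_mul, PowerSeries.coeff_mk,
        PowerSeries.coeff_mk, this, this, sub_zero]
    · rw [sub_mul, one_mul, map_sub, PowerSeries.coeff_succ_X_mul]
      simp only [PowerSeries.coeff_mk]
      have := finrank_paramIdeal_insert hfin hM hδ hG (hreg J i hi) j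
      push_cast [← @Nat.cast_inj ℤ] at this
      linarith

/-- A set of monomials which is a basis of the homogeneous elements of degree `j` modulo the
parameters. -/
theorem exists_monomial_basis (hfin : ∀ j, {m | m ∈ M ∧ δ m = j}.Finite)
    (hM : ∀ i, ∀ g ∈ G i, g ∈ M) (hδ : ∀ i, ∀ g ∈ G i, δ g = 1)
    (J : Finset ι) (j : ℕ) :
    ∃ W : Finset (σ →₀ ℕ), (∀ w ∈ W, w ∈ M ∧ δ w = j) ∧
      grade K M δ j ≤ Submodule.span K ((fun m => monomial m (1 : K)) '' (W : Set (σ →₀ ℕ))) ⊔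
        paramIdeal K M δ G J j ∧
      W.card + Module.finrank K (paramIdeal K M δ G J j) = hilb M δ j := by
  classical
  set U := paramIdeal K M δ G J j with hU
  set S : Set (σ →₀ ℕ) := {m | m ∈ M ∧ δ m = j} with hS
  -- The monomials span the graded piece, so a maximal independent set of their classes in the
  -- quotient is a basis.
  obtain ⟨s, hs, hmax⟩ := exists_maximal_linearIndepOn K
    (fun m : S => U.mkQ (monomial (m : σ →₀ ℕ) (1 : K)))
  have hsfin : (Subtype.val '' s).Finite := (hfin j).subset (by rintro _ ⟨m, -, rfl⟩; exact m.2)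
  have hmem : ∀ m : S, (monomial (m : σ →₀ ℕ) (1 : K)) ∈
      Submodule.span K ((fun m => monomial m (1 : K)) '' (Subtype.val '' s)) ⊔ U := by
    have hmem' : ∀ f, U.mkQ f ∈ Submodule.span K
        ((fun m : S => U.mkQ (monomial (m : σ →₀ ℕ) (1 : K))) '' s) →
        f ∈ Submodule.span K ((fun m => monomial m (1 : K)) '' (Subtype.val '' s)) ⊔ U := by
      intro f hf
      have h1 : (fun m : S => U.mkQ (monomial (m : σ →₀ ℕ) (1 : K))) '' s
          = U.mkQ '' ((fun m => monomial m (1 : K)) '' (Subtype.val '' s)) := by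
        simp only [Set.image_image]
      rw [h1, ← Submodule.map_span, ← Submodule.mem_comap, Submodule.comap_map_mkQ, sup_comm] at hf
      exact hf
    intro m
    apply hmem'
    by_cases hm : m ∈ s
    · exact Submodule.subset_span ⟨m, hm, rfl⟩
    · obtain ⟨a, ha, h⟩ := hmax m hm
      have := Submodule.smul_mem _ a⁻¹ h
      rwa [smul_smul, inv_mul_cancel₀ ha, one_smul] at this
  refine ⟨hsfin.toFinset, fun w hw => ?_, ?_, ?_⟩
  · obtain ⟨m, -, rfl⟩ := hsfin.mem_toFinset.1 hw
    exact m.2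
  · rw [grade_eq_span, Submodule.span_le, Set.Finite.coe_toFinset]
    rintro _ ⟨m, hm, rfl⟩
    exact hmem ⟨m, hm⟩
  · have hsup : Submodule.span K ((fun m => monomial m (1 : K)) '' (Subtype.val '' s)) ⊔ U
        = grade K M δ j := by
      apply le_antisymm
      · refine sup_le ?_ (paramIdeal_le_grade hM hδ J j)
        rw [Submodule.span_le]
        rintro _ ⟨_, ⟨m, -, rfl⟩, rfl⟩
        exact monomial_mem_grade m.2.1 m.2.2 _
      · rw [grade_eq_span, Submodule.span_le]
        rintro _ ⟨m, hm, rfl⟩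
        exact hmem ⟨m, hm⟩
    have hinf : Submodule.span K ((fun m => monomial m (1 : K)) '' (Subtype.val '' s)) ⊓ U = ⊥ := by
      rw [← disjoint_iff]
      have h1 : LinearIndependent K (U.mkQ ∘ fun m : s =>
        (monomial ((m : S) : σ →₀ ℕ) (1 : K))) := hs
      have h2 := (Submodule.range_ker_disjoint h1)
      rw [Submodule.ker_mkQ] at h2
      have heq : (fun m => monomial m (1 : K)) '' (Subtype.val '' s) =
          Set.range (fun m : s => monomial ((m : S) : σ →₀ ℕ) (1 : K)) := by
        rw [Set.image_image, Set.image_eq_range]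
      rw [heq]
      exact h2
    have hf1 := finite_paramIdeal (K := K) hfin hM hδ J j
    have hf2 : FiniteDimensional K (Submodule.span K
      ((fun m => monomial m (1 : K)) '' (Subtype.val '' s))) :=
      FiniteDimensional.span_of_finite K (hsfin.image _)
    have h3 := Submodule.finrank_sup_add_finrank_inf_eq
      (Submodule.span K ((fun m => monomial m (1 : K)) '' (Subtype.val '' s))) U
    have := hsfin.fintype
    have h4 : Module.finrank K (Submodule.span K
        ((fun m => monomial m (1 : K)) '' (Subtype.val '' s))) = hsfin.toFinset.card := by
      rw [Set.image_eq_range (fun m => monomial m (1 : K)) (Subtype.val '' s),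
        finrank_span_eq_card (linearIndependent_monomial _), Set.Finite.card_toFinset]
    rw [hsup, hinf, finrank_bot, finrank_grade hfin, h4] at h3
    omega

end Hilbert

end StabFamily

namespace StabFamily

open MvPolynomial

/-! ### Slot sums are a system of parameters. -/

section Parameters

variable {σ : Type*} {K : Type*} [Field K] {M : AddSubmonoid (σ →₀ ℕ)} {δ : (σ →₀ ℕ) →+ ℕ}
variable {ι : Type*} {G : ι → Finset (σ →₀ ℕ)}

variable (K) in
/-- A monomial as an element of the monomial ring. -/
noncomputable def ringMonomial (m : M) : monomialRing K M :=
  ⟨monomial (m : σ →₀ ℕ) 1, monomial_mem_monomialRing m.2 1⟩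

theorem ringMonomial_add (a b : M) :
    ringMonomial K (a + b) = ringMonomial K a * ringMonomial K b :=
  Subtype.ext (by simp [ringMonomial, monomial_mul])

variable (K) in
/-- A parameter as an element of the monomial ring. -/
noncomputable def ringParam (hM : ∀ i, ∀ g ∈ G i, g ∈ M) (i : ι) : monomialRing K M :=
  ⟨param K G i, Subalgebra.sum_mem _ fun g hg => monomial_mem_monomialRing (hM i g hg) 1⟩

theorem ringParam_eq (hM : ∀ i, ∀ g ∈ G i, g ∈ M) (i : ι) :
    ringParam K hM i = ∑ g ∈ (G i).attach, ringMonomial K (⟨g, hM i g g.2⟩ : M) := by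
  apply Subtype.ext
  simp only [ringParam, param, ringMonomial, AddSubmonoidClass.coe_finsetSum]
  rw [← Finset.sum_attach]

theorem coe_aeval_ringParam (hM : ∀ i, ∀ g ∈ G i, g ∈ M) (P : MvPolynomial ι K) :
    (aeval (ringParam K hM) P : MvPolynomial σ K) = aeval (param K G) P := by
  rw [← Subalgebra.coe_val, ← AlgHom.comp_apply, comp_aeval]
  rfl

/-- Multiply the slot sum by one of its terms `x`: the result is `x * x` plus cross terms, and each
cross term straightens to a multiple of a monomial in a lower slot, which is in the radical by
induction. So `x * x` is in the radical. -/
theorem ringMonomial_mem_radical [LinearOrder ι] [Finite ι] (hM : ∀ i, ∀ g ∈ G i, g ∈ M)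
    (hst : ∀ i, ∀ g ∈ G i, ∀ g' ∈ G i, g ≠ g' →
      ∃ j < i, ∃ h ∈ G j, ∃ h' ∈ M, g + g' = h + h') (i : ι) (g : σ →₀ ℕ) (hg : g ∈ G i) :
    ringMonomial K (⟨g, hM i g hg⟩ : M) ∈ (Ideal.span (Set.range (ringParam K hM))).radical := by
  classical
  induction i using WellFoundedLT.induction generalizing g with
  | ind i ih =>
    set I := Ideal.span (Set.range (ringParam K hM))
    set x := ringMonomial K (⟨g, hM i g hg⟩ : M)
    have h1 : x * ringParam K hM i ∈ I.radical :=
      Ideal.mul_mem_left _ _ (Ideal.le_radical (Ideal.subset_span ⟨i, rfl⟩))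
    rw [ringParam_eq, Finset.mul_sum,
      ← Finset.add_sum_erase _ _ (Finset.mem_attach (G i) ⟨g, hg⟩)] at h1
    have h2 : ∑ g' ∈ (G i).attach.erase ⟨g, hg⟩,
        x * ringMonomial K (⟨g', hM i g' g'.2⟩ : M) ∈ I.radical := by
      refine Ideal.sum_mem _ fun g' hg' => ?_
      obtain ⟨j, hj, h, hh, h', hh', heq⟩ := hst i g hg g' g'.2
        fun h => Finset.ne_of_mem_erase hg' (Subtype.ext h.symm)
      have : x * ringMonomial K (⟨g', hM i g' g'.2⟩ : M) =
          ringMonomial K (⟨h, hM j h hh⟩ : M) * ringMonomial K (⟨h', hh'⟩ : M) := by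
        rw [← ringMonomial_add, ← ringMonomial_add]
        congr 1
        exact Subtype.ext heq
      rw [this]
      exact Ideal.mul_mem_right _ _ (ih j hj h hh)
    have h3 : x * x ∈ I.radical := ((Submodule.add_mem_iff_left _ h2).1 h1)
    rw [← pow_two] at h3
    exact (Ideal.radical_isRadical I) ⟨2, h3⟩

/-- Some power of the ideal `X` of all slot monomials lies in the ideal of the parameters, since its
finitely many generators are in the radical; and monomials of degree `j` lie in `X ^ j`. -/
theorem exists_grade_le_paramIdeal [LinearOrder ι] [Fintype ι] (hM : ∀ i, ∀ g ∈ G i, g ∈ M)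
    (hδ : ∀ i, ∀ g ∈ G i, δ g = 1)
    (hst : ∀ i, ∀ g ∈ G i, ∀ g' ∈ G i, g ≠ g' →
      ∃ j < i, ∃ h ∈ G j, ∃ h' ∈ M, g + g' = h + h')
    (hcl : ∀ m ∈ M, 0 < δ m → ∃ i, ∃ g ∈ G i, ∃ m' ∈ M, m = g + m') :
    ∃ N, ∀ j ≥ N, grade K M δ j ≤ paramIdeal K M δ G Finset.univ j := by
  classical
  set I := Ideal.span (Set.range (ringParam K hM))
  let v : (Σ i, G i) → monomialRing K M := fun x => ringMonomial K (⟨x.2, hM _ _ x.2.2⟩ : M)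
  set X := Ideal.span (Set.range v) with hX
  have hXI : X ≤ I.radical := Ideal.span_le.2 (by
    rintro _ ⟨x, rfl⟩
    exact ringMonomial_mem_radical hM hst x.1 x.2 x.2.2)
  obtain ⟨N, hN⟩ := Ideal.exists_pow_le_of_le_radical_of_fg hXI
    ⟨Finset.univ.image v, by rw [Finset.coe_image, Finset.coe_univ, Set.image_univ]⟩
  have hpow : ∀ j, ∀ m : M, δ m = j → ringMonomial K m ∈ X ^ j := by
    intro j
    induction j with
    | zero => intro m _; rw [pow_zero, Ideal.one_eq_top]; trivial
    | succ j ih =>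
      intro m hm
      obtain ⟨i, g, hg, m', hm', heq⟩ := hcl m m.2 (by omega)
      have h1 : m = (⟨g, hM i g hg⟩ : M) + (⟨m', hm'⟩ : M) := Subtype.ext heq
      rw [h1, ringMonomial_add, pow_succ']
      refine Ideal.mul_mem_mul (Ideal.subset_span ⟨⟨i, g, hg⟩, rfl⟩) (ih _ ?_)
      have := hδ i g hg
      rw [heq, map_add] at hm
      simp only; omega
  refine ⟨N, fun j hj => ?_⟩
  rw [grade_eq_span, Submodule.span_le]
  rintro _ ⟨m, ⟨hm, hmj⟩, rfl⟩
  have h1 : ringMonomial K (⟨m, hm⟩ : M) ∈ I := hN (Ideal.pow_le_pow_right hj (hpow j ⟨m, hm⟩ hmj))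
  obtain ⟨c, hc⟩ := Ideal.mem_span_range_iff_exists_fun.1 h1
  have h2 : monomial m (1 : K) = ∑ i ∈ Finset.univ, param K G i * (c i : MvPolynomial σ K) := by
    have := congrArg (Subtype.val) hc
    rw [AddSubmonoidClass.coe_finsetSum] at this
    change _ = monomial m (1 : K) at this
    rw [← this]
    exact Finset.sum_congr rfl fun i _ => mul_comm _ _
  have h3 := component_mem_paramIdeal (K := K) (M := M) hδ (J := Finset.univ)
    (s := fun i => (c i : MvPolynomial σ K)) (fun i _ => (c i).2) j
  rw [← h2, component_of_mem (monomial_mem_grade hm hmj _)] at h3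
  exact h3

/-- In large degrees the parameters generate everything, so the finitely many monomials of degree
below `N` generate the ring as a module. -/
theorem aeval_ringParam_finite [Fintype ι] (hfin : ∀ j, {m | m ∈ M ∧ δ m = j}.Finite)
    (hM : ∀ i, ∀ g ∈ G i, g ∈ M)
    (hN : ∃ N, ∀ j ≥ N, grade K M δ j ≤ paramIdeal K M δ G Finset.univ j) :
    (aeval (R := K) (ringParam K hM)).toRingHom.Finite := by
  obtain ⟨N, hN⟩ := hN
  let W : Set (σ →₀ ℕ) := {m | m ∈ M ∧ δ m < N}
  have hWfin : W.Finite := by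
    refine ((Set.finite_lt_nat N).biUnion fun j _ => hfin j).subset ?_
    intro m hm
    exact Set.mem_biUnion (x := δ m) hm.2 ⟨hm.1, rfl⟩
  have hW : ∀ j, grade K M δ j ≤ Submodule.span K
      ((fun m => monomial m (1 : K)) '' {m | m ∈ W ∧ δ m = j}) ⊔
        paramIdeal K M δ G Finset.univ j := fun j => by
    rcases lt_or_ge j N with hj | hj
    · refine le_sup_of_le_left ?_
      rw [grade_eq_span]
      refine Submodule.span_mono (Set.image_mono ?_)
      rintro m ⟨hm, rfl⟩
      exact ⟨⟨hm, hj⟩, rfl⟩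
    · exact le_sup_of_le_right (hN j hj)
  let := (aeval (R := K) (ringParam K hM)).toRingHom.toAlgebra
  have hsmul : ∀ (a : MvPolynomial ι K) (x : monomialRing K M),
      a • x = aeval (ringParam K hM) a * x := fun a x => rfl
  change Module.Finite (MvPolynomial ι K) (monomialRing K M)
  have : Finite W := hWfin
  let v : W → monomialRing K M := fun w => ringMonomial K ⟨w, w.2.1⟩
  refine ⟨Submodule.fg_def.2 ⟨Set.range v, Set.finite_range v, ?_⟩⟩
  rw [eq_top_iff]
  have key : ∀ j, ∀ f ∈ grade K M δ j, ∃ x ∈ Submodule.span (MvPolynomial ι K) (Set.range v),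
      (x : MvPolynomial σ K) = f := by
    intro j f hf
    have hf' := grade_le_span hW j hf
    clear hf
    induction hf' using Submodule.span_induction with
    | mem f h =>
      obtain ⟨w, hw, ν, -, rfl⟩ := h
      refine ⟨(monomial ν (1 : K) : MvPolynomial ι K) • v ⟨w, hw⟩, Submodule.smul_mem _ _
        (Submodule.subset_span ⟨_, rfl⟩), ?_⟩
      rw [hsmul, MulMemClass.coe_mul, coe_aeval_ringParam]
      rfl
    | zero => exact ⟨0, Submodule.zero_mem _, rfl⟩
    | add f g _ _ hf hg =>
      obtain ⟨x, hx, rfl⟩ := hf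
      obtain ⟨y, hy, rfl⟩ := hg
      exact ⟨x + y, Submodule.add_mem _ hx hy, rfl⟩
    | smul a f _ hf =>
      obtain ⟨x, hx, rfl⟩ := hf
      refine ⟨(C a : MvPolynomial ι K) • x, Submodule.smul_mem _ _ hx, ?_⟩
      rw [hsmul, ← algebraMap_eq, AlgHom.commutes, MulMemClass.coe_mul, Algebra.smul_def]
      rfl
  intro f _
  choose! c hc hc' using fun j => key j _ (component_mem (δ := δ) f.2 j)
  have : f = ∑ j ∈ (f : MvPolynomial σ K).support.image δ, c j := by
    apply Subtype.ext
    rw [AddSubmonoidClass.coe_finsetSum]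
    conv_lhs => rw [← sum_component (δ := δ) (f : MvPolynomial σ K)]
    exact Finset.sum_congr rfl fun j _ => (hc' j).symm
  rw [this]
  exact Submodule.sum_mem _ fun j _ => hc j

/-- Each variable is a quotient of two monomials of the ring by `hfull`, hence algebraic over the
subalgebra of the parameters. As many parameters as the transcendence degree must then be
algebraically independent. -/
theorem aeval_ringParam_injective [Fintype ι] [Finite σ] (hM : ∀ i, ∀ g ∈ G i, g ∈ M)
    (hfin : (aeval (R := K) (ringParam K hM)).toRingHom.Finite)
    (hcard : Nat.card ι = Nat.card σ)
    (hfull : ∀ s : σ, ∃ m ∈ M, m + Finsupp.single s 1 ∈ M) :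
    Function.Injective (aeval (R := K) (ringParam K hM)) := by
  have hint := hfin.to_isIntegral
  let A := Algebra.adjoin K (Set.range (param K G))
  have hA : ∀ P : MvPolynomial ι K, aeval (param K G) P ∈ A := fun P => by
    rw [show A = (aeval (param K G)).range from Algebra.adjoin_range_eq_range_aeval K _]
    exact ⟨P, rfl⟩
  let φ : MvPolynomial ι K →+* A := ((aeval (param K G)).codRestrict A hA).toRingHom
  have halg : ∀ m ∈ M, IsAlgebraic A (monomial m (1 : K)) := by
    intro m hm
    obtain ⟨p, hp, hp0⟩ := hint (ringMonomial K ⟨m, hm⟩)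
    refine IsIntegral.isAlgebraic ⟨p.map φ, hp.map φ, ?_⟩
    have h1 := congrArg (monomialRing K M).val.toRingHom hp0
    rw [Polynomial.hom_eval₂, map_zero] at h1
    rw [Polynomial.eval₂_map]
    rw [← h1]
    congr 1
    exact RingHom.ext fun P => (coe_aeval_ringParam hM P).symm
  have hX : ∀ s : σ, IsAlgebraic A (X s : MvPolynomial σ K) := by
    intro s
    obtain ⟨m, hm, hms⟩ := hfull s
    refine IsAlgebraic.of_mul (y := monomial m (1 : K)) ?_ (halg m hm) ?_
    · exact mem_nonZeroDivisors_of_ne_zero (by simp)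
    · rw [X, monomial_mul, one_mul]
      exact halg _ hms
  have : Algebra.IsAlgebraic A (MvPolynomial σ K) := by
    refine ⟨fun f => ?_⟩
    induction f using MvPolynomial.induction_on with
    | C a =>
      exact isAlgebraic_algebraMap (R := A) (algebraMap K A a)
    | add f g hf hg => exact hf.add hg
    | mul_X f s hf => exact hf.mul (hX s)
  have := Fintype.ofFinite σ
  have hb : IsTranscendenceBasis K (param K G) := by
    refine Algebra.IsAlgebraic.isTranscendenceBasis_of_lift_le_trdeg_of_finite K (param K G) ?_
    rw [MvPolynomial.trdeg_of_isDomain, Nat.card_eq_fintype_card, Nat.card_eq_fintype_card] at *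
    simp [hcard]
  intro P P' h
  apply hb.1
  have := congrArg Subtype.val h
  rwa [coe_aeval_ringParam, coe_aeval_ringParam] at this

end Parameters

end StabFamily

/-! ### Transfer of spanning sets from characteristic `p` to characteristic zero. -/

namespace StabFamily

open MvPolynomial

/-- An integral family whose reduction modulo a prime spans, spans in characteristic zero. -/
theorem span_range_intCast_eq_top (p : ℕ) [Fact p.Prime] (k : Type*) [Field k] [CharZero k]
    {S A : Type*} [Fintype S] (v : A → S → ℤ)
    (h : Submodule.span (ZMod p) (Set.range fun a s => (v a s : ZMod p)) = ⊤) :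
    Submodule.span k (Set.range fun a s => (v a s : k)) = ⊤ := by
  classical
  obtain ⟨b, hb, hspan, hli⟩ := exists_linearIndependent (ZMod p)
    (Set.range fun a s => (v a s : ZMod p))
  rw [h] at hspan
  let B := Module.Basis.mk hli (by rw [Subtype.range_coe, hspan])
  let e : S ≃ b := (Pi.basisFun (ZMod p) S).indexEquiv B
  choose a ha using fun x : b => hb x.2
  let N : Matrix S S ℤ := Matrix.of fun s t => v (a (e s)) t
  -- The rows of `N` are chosen to reduce to a basis modulo `p`; its integer determinant is
  -- therefore nonzero, and remains so in `k`.
  have h1 : IsUnit (N.map (Int.castRingHom (ZMod p))) := by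
    rw [← Matrix.linearIndependent_rows_iff_isUnit]
    have : (N.map (Int.castRingHom (ZMod p))).row = fun s => ((e s : b) : S → ZMod p) := by
      ext1 s
      rw [← ha (e s)]
      rfl
    rw [this]
    exact hli.comp e e.injective
  have h2 : N.det ≠ 0 := by
    intro h0
    rw [Matrix.isUnit_iff_isUnit_det] at h1
    apply h1.ne_zero
    change (((Int.castRingHom (ZMod p)).mapMatrix N).det) = 0
    rw [← RingHom.map_det, h0, map_zero]
  have h3 : IsUnit (N.map (Int.castRingHom k)) := by
    rw [Matrix.isUnit_iff_isUnit_det]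
    change IsUnit (((Int.castRingHom k).mapMatrix N).det)
    rw [← RingHom.map_det]
    exact isUnit_iff_ne_zero.2 (by simpa using h2)
  rw [← Matrix.linearIndependent_rows_iff_isUnit] at h3
  have h4 := h3.span_eq_top_of_card_eq_finrank' (by simp)
  rw [eq_top_iff, ← h4]
  refine Submodule.span_mono ?_
  rintro _ ⟨s, rfl⟩
  exact ⟨a (e s), rfl⟩

section Transfer

variable {σ : Type*} {M : AddSubmonoid (σ →₀ ℕ)} {δ : (σ →₀ ℕ) →+ ℕ}
variable {ι : Type*} {G : ι → Finset (σ →₀ ℕ)}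

-- Exhibits the space as the span of a family whose coefficients are integers independent of the
-- field. Writing the degree condition as `δ m + 1 = j` makes the second part empty when `j = 0`.
variable (K : Type*) [Field K] in
theorem span_sup_paramIdeal [Fintype ι] (W : Set (σ →₀ ℕ)) (j : ℕ) :
    Submodule.span K ((fun m => monomial m (1 : K)) '' W) ⊔ paramIdeal K M δ G Finset.univ j =
      Submodule.span K (Set.range (Sum.elim (fun w : W => monomial (w : σ →₀ ℕ) (1 : K))
        fun x : ι × {m // m ∈ M ∧ δ m + 1 = j} =>
          param K G x.1 * monomial (x.2 : σ →₀ ℕ) 1)) := by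
  rw [Set.Sum.elim_range, Submodule.span_union, Set.image_eq_range]
  congr 1
  rcases j with _ | j
  · rw [Set.range_eq_empty_iff.2 ⟨fun x => by have := x.2.2.2; omega⟩, Submodule.span_empty]
    rfl
  · simp only [paramIdeal, grade_eq_span, Submodule.map_span, Submodule.iSup_span,
      Finset.mem_univ, iSup_pos]
    congr 1
    ext f
    simp only [Set.mem_iUnion, Set.mem_image, Set.mem_range, Prod.exists, Subtype.exists]
    constructor
    · rintro ⟨i, _, ⟨m, ⟨hm, hj⟩, rfl⟩, rfl⟩
      exact ⟨i, m, ⟨hm, by rw [hj]⟩, rfl⟩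
    · rintro ⟨i, m, ⟨hm, hj⟩, rfl⟩
      exact ⟨i, _, ⟨m, ⟨hm, by omega⟩, rfl⟩, rfl⟩

open Classical in
variable (M δ G) in
/-- The integral coefficients of a family of monomials and multiples of the parameters. -/
noncomputable def spanCoeff (W : Set (σ →₀ ℕ)) (j : ℕ) :
    W ⊕ (ι × {m // m ∈ M ∧ δ m + 1 = j}) → {m | m ∈ M ∧ δ m = j} → ℤ := fun a s =>
  Sum.elim (fun w : W => if (w : σ →₀ ℕ) = s then 1 else 0)
    (fun x => ∑ g ∈ G x.1, if g + x.2 = s then 1 else 0) a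

/-- Reading coefficients identifies the graded piece with the functions on its finite set of
exponents, and the spanning family with the integer matrix `spanCoeff`. -/
theorem grade_le_iff_span_eq_top (K : Type*) [Field K] [Fintype ι]
    (hfin : ∀ j, {m | m ∈ M ∧ δ m = j}.Finite) (hM : ∀ i, ∀ g ∈ G i, g ∈ M)
    (hδ : ∀ i, ∀ g ∈ G i, δ g = 1) {W : Set (σ →₀ ℕ)} {j : ℕ} (hW : ∀ w ∈ W, w ∈ M ∧ δ w = j) :
    (grade K M δ j ≤ Submodule.span K ((fun m => monomial m (1 : K)) '' W) ⊔
      paramIdeal K M δ G Finset.univ j) ↔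
    Submodule.span K (Set.range fun a s => (spanCoeff M δ G W j a s : K)) = ⊤ := by
  classical
  have : Fintype {m | m ∈ M ∧ δ m = j} := (hfin j).fintype
  rw [span_sup_paramIdeal]
  set u : W ⊕ (ι × {m // m ∈ M ∧ δ m + 1 = j}) → MvPolynomial σ K :=
    Sum.elim (fun w : W => monomial (w : σ →₀ ℕ) (1 : K))
      fun x : ι × {m // m ∈ M ∧ δ m + 1 = j} => param K G x.1 * monomial (x.2 : σ →₀ ℕ) 1
  have hu : ∀ a, u a ∈ grade K M δ j := by
    rintro (w | ⟨i, m⟩)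
    · exact monomial_mem_grade (hW w w.2).1 (hW w w.2).2 _
    · have := mul_mem_grade (param_mem_grade (K := K) hM hδ i)
        (monomial_mem_grade m.2.1 rfl (1 : K))
      rw [add_comm, m.2.2] at this
      exact this
  let Ψ : MvPolynomial σ K →ₗ[K] ({m | m ∈ M ∧ δ m = j} → K) :=
    LinearMap.pi fun s => lcoeff K (s : σ →₀ ℕ)
  have hΨ : ∀ f s, Ψ f s = coeff (s : σ →₀ ℕ) f := fun f s => rfl
  have hΨu : Ψ ∘ u = fun a s => (spanCoeff M δ G W j a s : K) := by
    ext a s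
    rw [Function.comp_apply, hΨ]
    rcases a with w | ⟨i, m⟩
    · simp [u, spanCoeff, coeff_monomial]
    · simp [u, spanCoeff, param, Finset.sum_mul, monomial_mul, coeff_sum, coeff_monomial]
  rw [← hΨu, Set.range_comp, ← Submodule.map_span, eq_top_iff]
  constructor
  · intro h c _
    refine Submodule.map_mono h ⟨∑ s : {m | m ∈ M ∧ δ m = j}, monomial (s : σ →₀ ℕ) (c s),
      Submodule.sum_mem _ fun s _ => monomial_mem_grade s.2.1 s.2.2 _, ?_⟩
    ext s
    rw [hΨ, coeff_sum]
    simp only [coeff_monomial, ← Subtype.ext_iff]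
    simp
  · intro h f hf
    obtain ⟨g, hg, hgf⟩ := h (Submodule.mem_top : Ψ f ∈ ⊤)
    have hg' : g ∈ grade K M δ j :=
      Submodule.span_le.2 (by rintro _ ⟨a, rfl⟩; exact hu a) hg
    have : f = g := by
      ext m
      by_cases hm : m ∈ M ∧ δ m = j
      · exact (congrFun hgf ⟨m, hm⟩).symm
      · rw [not_not.1 (mt (hf m) hm), not_not.1 (mt (hg' m) hm)]
    rwa [this]

theorem grade_le_transfer (p : ℕ) [Fact p.Prime] (k : Type*) [Field k] [CharZero k] [Fintype ι]
    (hfin : ∀ j, {m | m ∈ M ∧ δ m = j}.Finite) (hM : ∀ i, ∀ g ∈ G i, g ∈ M)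
    (hδ : ∀ i, ∀ g ∈ G i, δ g = 1) {W : Set (σ →₀ ℕ)} {j : ℕ} (hW : ∀ w ∈ W, w ∈ M ∧ δ w = j)
    (h : grade (ZMod p) M δ j ≤ Submodule.span (ZMod p) ((fun m => monomial m (1 : ZMod p)) '' W) ⊔
      paramIdeal (ZMod p) M δ G Finset.univ j) :
    grade k M δ j ≤ Submodule.span k ((fun m => monomial m (1 : k)) '' W) ⊔
      paramIdeal k M δ G Finset.univ j := by
  have : Fintype {m | m ∈ M ∧ δ m = j} := (hfin j).fintype
  rw [grade_le_iff_span_eq_top _ hfin hM hδ hW] at h ⊢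
  exact span_range_intCast_eq_top p k _ h

end Transfer

theorem natCard_degree_eq {ι : Type*} [Fintype ι] (i : ℕ) :
    Nat.card {ν : ι →₀ ℕ // ν.degree = i} = (Fintype.card ι).multichoose i := by
  classical
  rw [← Sym.card_sym_eq_multichoose, ← Nat.card_eq_fintype_card]
  refine Nat.card_congr ((Sym.equivNatSum ι i).trans (Equiv.subtypeEquivRight fun ν => ?_)).symm
  rfl

theorem one_sub_X_pow_mul_mk_multichoose (D : ℕ) :
    (1 - PowerSeries.X : PowerSeries ℤ) ^ D * PowerSeries.mk (fun i => (D.multichoose i : ℤ)) = 1 := by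
  rcases D with _ | D
  · ext i
    rcases i with _ | i
    · simp
    · simp [PowerSeries.coeff_one]
  · rw [← PowerSeries.invOneSubPow_inv_eq_one_sub_pow]
    have : PowerSeries.mk (fun i => ((D + 1).multichoose i : ℤ)) =
      (PowerSeries.invOneSubPow ℤ (D + 1)).val := by
      rw [PowerSeries.invOneSubPow_val_succ_eq_mk_add_choose]
      ext i
      rw [PowerSeries.coeff_mk, PowerSeries.coeff_mk, Nat.multichoose_eq,
        show D + 1 + i - 1 = D + i by omega, Nat.choose_symm_add]
    rw [this]
    exact (PowerSeries.invOneSubPow ℤ (D + 1)).inv_val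

end StabFamily

namespace StabFamily

open MvPolynomial

/-! ### Homogeneous bases over the ring of the parameters. -/

section ParamBasis

variable {σ : Type*} {K : Type*} [Field K] {M : AddSubmonoid (σ →₀ ℕ)} {δ : (σ →₀ ℕ) →+ ℕ}
variable {ι : Type*} {G : ι → Finset (σ →₀ ℕ)}

/-- Pairs of given total degree. -/
def sigmaDegreeEquiv (W : Finset (σ →₀ ℕ)) (δ : (σ →₀ ℕ) →+ ℕ) (j : ℕ) :
    {x : W × (ι →₀ ℕ) // δ x.1 + x.2.degree = j} ≃
      Σ w : W, {ν : ι →₀ ℕ // δ w + ν.degree = j} where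
  toFun := fun x => ⟨x.1.1, x.1.2, x.2⟩
  invFun := fun y => ⟨(y.1, y.2.1), y.2.2⟩
  left_inv := fun _ => rfl
  right_inv := fun _ => rfl

theorem finite_degree [Fintype ι] (a j : ℕ) : Finite {ν : ι →₀ ℕ // a + ν.degree = j} := by
  classical
  by_cases h : a ≤ j
  · have : Finite {ν : ι →₀ ℕ // ν.degree = j - a} :=
      Finite.of_equiv _ (Sym.equivNatSum ι (j - a))
    exact Finite.of_equiv _ (Equiv.subtypeEquivRight (p := fun ν : ι →₀ ℕ => ν.degree = j - a)
      fun ν => by omega)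
  · have : IsEmpty {ν : ι →₀ ℕ // a + ν.degree = j} := ⟨fun ν => by have := ν.2; omega⟩
    infer_instance

theorem finite_sigma_degree [Fintype ι] (W : Finset (σ →₀ ℕ)) (j : ℕ) :
    Finite {x : W × (ι →₀ ℕ) // δ x.1 + x.2.degree = j} := by
  have := fun w : W => finite_degree (ι := ι) (δ w) j
  exact Finite.of_equiv _ (sigmaDegreeEquiv W δ j).symm

/-- The generating function of `W` is multiplied by that of the monomials in the parameters. -/
theorem natCard_sigma_degree [Fintype ι] (W : Finset (σ →₀ ℕ)) (j : ℕ) :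
    (Nat.card {x : W × (ι →₀ ℕ) // δ x.1 + x.2.degree = j} : ℤ) =
      PowerSeries.coeff j (PowerSeries.mk (fun i => ((W.filter (δ · = i)).card : ℤ)) *
        PowerSeries.mk (fun i => ((Fintype.card ι).multichoose i : ℤ))) := by
  classical
  have h1 : ∀ w : W, Nat.card {ν : ι →₀ ℕ // δ w + ν.degree = j} =
      if δ w ≤ j then (Fintype.card ι).multichoose (j - δ w) else 0 := fun w => by
    split_ifs with h
    · rw [← natCard_degree_eq]
      exact Nat.card_congr (Equiv.subtypeEquivRight fun ν => by omega)
    · rw [Nat.card_eq_zero]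
      exact Or.inl ⟨fun ν => by have := ν.2; omega⟩
  have h0 := fun w : W => finite_degree (ι := ι) (δ w) j
  rw [Nat.card_congr (sigmaDegreeEquiv W δ j), Nat.card_sigma, PowerSeries.coeff_mul]
  simp only [h1, PowerSeries.coeff_mk, Finset.card_filter, Nat.cast_sum, Finset.sum_mul]
  rw [Finset.sum_comm, ← Finset.sum_coe_sort W]
  refine Finset.sum_congr rfl fun w _ => ?_
  rw [Finset.Nat.sum_antidiagonal_eq_sum_range_succ
    (fun a b => (((if δ (w : σ →₀ ℕ) = a then 1 else 0 : ℕ) : ℤ) *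
      ((Fintype.card ι).multichoose b : ℤ)))]
  simp only [Nat.cast_ite, Nat.cast_one, Nat.cast_zero, ite_mul, one_mul, zero_mul,
    Finset.sum_ite_eq, Finset.mem_range, Nat.lt_succ_iff]

variable (K G) in
/-- Products of monomials in the parameters with a monomial. -/
noncomputable def paramMonomial (x : (σ →₀ ℕ) × (ι →₀ ℕ)) : MvPolynomial σ K :=
  aeval (param K G) (monomial x.2 (1 : K)) * monomial x.1 1

theorem aeval_monomial_mem_grade (hM : ∀ i, ∀ g ∈ G i, g ∈ M) (hδ : ∀ i, ∀ g ∈ G i, δ g = 1)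
    (ν : ι →₀ ℕ) : aeval (param K G) (monomial ν (1 : K)) ∈ grade K M δ ν.degree := by
  induction ν using Finsupp.induction_linear with
  | zero =>
    rw [← C_apply, map_one, map_one, map_zero]
    exact monomial_mem_grade M.zero_mem (map_zero δ) 1
  | add a b ha hb =>
    rw [← one_mul (1 : K), ← monomial_mul, map_mul, map_add]
    exact mul_mem_grade ha hb
  | single i c =>
    rw [aeval_monomial, map_one, one_mul, Finsupp.degree_single, Finsupp.prod_single_index (by simp)]
    induction c with
    | zero => rw [pow_zero]; exact monomial_mem_grade M.zero_mem (map_zero δ) 1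
    | succ c ih =>
      rw [pow_succ]
      exact mul_mem_grade ih (param_mem_grade hM hδ i)

theorem paramMonomial_mem_grade (hM : ∀ i, ∀ g ∈ G i, g ∈ M) (hδ : ∀ i, ∀ g ∈ G i, δ g = 1)
    (x : (σ →₀ ℕ) × (ι →₀ ℕ)) (hx : x.1 ∈ M) :
    paramMonomial K G x ∈ grade K M δ (δ x.1 + x.2.degree) := by
  rw [add_comm]
  exact mul_mem_grade (aeval_monomial_mem_grade hM hδ _) (monomial_mem_grade hx rfl _)

/-- The products span the graded piece, and `hcount` says that there are exactly as many of them as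
its dimension. -/
theorem linearIndependent_paramMonomial_degree [Fintype ι]
    (hfin : ∀ j, {m | m ∈ M ∧ δ m = j}.Finite)
    (hM : ∀ i, ∀ g ∈ G i, g ∈ M) (hδ : ∀ i, ∀ g ∈ G i, δ g = 1)
    {W : Finset (σ →₀ ℕ)} (hWM : ∀ w ∈ W, w ∈ M)
    (hspan : ∀ j, grade K M δ j ≤ Submodule.span K
      ((fun m => monomial m (1 : K)) '' {m | m ∈ (W : Set (σ →₀ ℕ)) ∧ δ m = j}) ⊔
        paramIdeal K M δ G Finset.univ j)
    (hcount : PowerSeries.mk (fun j => ((W.filter (δ · = j)).card : ℤ)) =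
      (1 - PowerSeries.X) ^ Fintype.card ι * PowerSeries.mk (fun j => (hilb M δ j : ℤ))) (j : ℕ) :
    LinearIndependent K (fun x : {x : W × (ι →₀ ℕ) // δ x.1 + x.2.degree = j} =>
      paramMonomial K G ((x.1.1 : σ →₀ ℕ), x.1.2)) := by
  have hcard : Nat.card {x : W × (ι →₀ ℕ) // δ x.1 + x.2.degree = j} = hilb M δ j := by
    have := natCard_sigma_degree (δ := δ) (ι := ι) W j
    rw [hcount, mul_right_comm, one_sub_X_pow_mul_mk_multichoose, one_mul,
      PowerSeries.coeff_mk] at this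
    exact_mod_cast this
  have hspanj : Submodule.span K (Set.range (fun x : {x : W × (ι →₀ ℕ) //
      δ x.1 + x.2.degree = j} => paramMonomial K G ((x.1.1 : σ →₀ ℕ), x.1.2))) =
      grade K M δ j := by
    apply le_antisymm
    · rw [Submodule.span_le]
      rintro _ ⟨x, rfl⟩
      have := paramMonomial_mem_grade (K := K) hM hδ ((x.1.1 : σ →₀ ℕ), x.1.2) (hWM _ x.1.1.2)
      rwa [x.2] at this
    · refine (grade_le_span hspan j).trans (Submodule.span_mono ?_)
      rintro _ ⟨w, hw, ν, hj, rfl⟩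
      exact ⟨⟨(⟨w, hw⟩, ν), hj⟩, rfl⟩
  have := finite_sigma_degree (δ := δ) (ι := ι) W j
  have := Fintype.ofFinite {x : W × (ι →₀ ℕ) // δ x.1 + x.2.degree = j}
  rw [linearIndependent_iff_card_eq_finrank_span, Set.finrank, hspanj, finrank_grade hfin,
    ← hcard, Nat.card_eq_fintype_card]

/-- A relation between homogeneous elements splits into its homogeneous components. -/
theorem linearIndependent_of_graded {T : Type*} (d : T → ℕ) (u : T → MvPolynomial σ K)
    (hu : ∀ x, u x ∈ grade K M δ (d x))
    (h : ∀ j, LinearIndependent K (fun x : {x : T // d x = j} => u x)) :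
    LinearIndependent K u := by
  rw [linearIndependent_iff']
  intro s g hg x hx
  have h1 := congrArg (component δ (d x)) hg
  rw [component_sum] at h1
  have h2 : ∀ y ∈ s, component δ (d x) (g y • u y) = if d y = d x then g y • u y else 0 := by
    intro y _
    split_ifs with h
    · exact component_of_mem (h ▸ Submodule.smul_mem _ _ (hu y))
    · ext m
      rw [coeff_component, coeff_zero]
      split_ifs with hm
      · by_contra hne
        exact h (((Submodule.smul_mem _ (g y) (hu y)) m hne).2.symm.trans hm)
      · rfl
  have h0 : component δ (d x) (0 : MvPolynomial σ K) = 0 := by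
    ext m; rw [coeff_component]; simp
  rw [Finset.sum_congr rfl h2, h0, ← Finset.sum_filter, ← Finset.sum_subtype_eq_sum_filter] at h1
  exact linearIndependent_iff'.1 (h (d x)) _ (fun y => g y) h1 ⟨x, rfl⟩ (by simpa using hx)

/-- The monomial ring as an algebra over the polynomial ring in the parameters. -/
noncomputable abbrev paramAlgebra (hM : ∀ i, ∀ g ∈ G i, g ∈ M) :
    Algebra (MvPolynomial ι K) (monomialRing K M) :=
  (aeval (R := K) (ringParam K hM)).toRingHom.toAlgebra

/-- Monomials which form a basis of the monomial ring modulo the parameters are a basis over the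
polynomial ring in the parameters. -/
theorem exists_paramBasis [Fintype ι] (hfin : ∀ j, {m | m ∈ M ∧ δ m = j}.Finite)
    (hM : ∀ i, ∀ g ∈ G i, g ∈ M) (hδ : ∀ i, ∀ g ∈ G i, δ g = 1)
    {W : Finset (σ →₀ ℕ)} (hWM : ∀ w ∈ W, w ∈ M)
    (hspan : ∀ j, grade K M δ j ≤ Submodule.span K
      ((fun m => monomial m (1 : K)) '' {m | m ∈ (W : Set (σ →₀ ℕ)) ∧ δ m = j}) ⊔
        paramIdeal K M δ G Finset.univ j)
    (hcount : PowerSeries.mk (fun j => ((W.filter (δ · = j)).card : ℤ)) =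
      (1 - PowerSeries.X) ^ Fintype.card ι * PowerSeries.mk (fun j => (hilb M δ j : ℤ))) :
    letI := paramAlgebra (K := K) hM
    ∃ B : Module.Basis W (MvPolynomial ι K) (monomialRing K M),
      (∀ w, B w = ringMonomial K ⟨w, hWM w w.2⟩) ∧
      ∀ j, ∀ f : monomialRing K M, (f : MvPolynomial σ K) ∈ grade K M δ j →
        ∀ w ν, coeff ν (B.repr f w) ≠ 0 → δ w + ν.degree = j := by
  classical
  let := paramAlgebra (K := K) hM
  have hsmul : ∀ (a : MvPolynomial ι K) (x : monomialRing K M),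
      ((a • x : monomialRing K M) : MvPolynomial σ K) = aeval (param K G) a * x := fun a x => by
    rw [← coe_aeval_ringParam hM]; rfl
  let v : W → monomialRing K M := fun w => ringMonomial K ⟨w, hWM w w.2⟩
  have hv : ∀ (w : W) (ν : ι →₀ ℕ), (((monomial ν (1 : K) : MvPolynomial ι K) • v w :
      monomialRing K M) : MvPolynomial σ K) = paramMonomial K G ((w : σ →₀ ℕ), ν) :=
    fun w ν => hsmul _ _
  have hli : LinearIndependent (MvPolynomial ι K) v := by
    have hK := linearIndependent_of_graded (fun x : W × (ι →₀ ℕ) => δ x.1 + x.2.degree)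
      (fun x => paramMonomial K G ((x.1 : σ →₀ ℕ), x.2))
      (fun x => paramMonomial_mem_grade hM hδ _ (hWM _ x.1.2))
      (linearIndependent_paramMonomial_degree hfin hM hδ hWM hspan hcount)
    rw [Fintype.linearIndependent_iff]
    intro P hP w
    ext ν
    rw [coeff_zero]
    -- A relation with polynomial coefficients is unfolded into a relation over `K` between products
    -- of parameter monomials and elements of `W`.
    let S := Finset.univ.biUnion fun w => (P w).support
    have hPw : ∀ w, P w = ∑ ν ∈ S, coeff ν (P w) • monomial ν (1 : K) := fun w => by
      conv_lhs => rw [as_sum (P w)]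
      rw [Finset.sum_subset (Finset.subset_biUnion_of_mem (fun w => (P w).support)
        (Finset.mem_univ w))]
      · exact Finset.sum_congr rfl fun ν _ => by rw [smul_monomial, smul_eq_mul, mul_one]
      · intro ν _ h
        rw [notMem_support_iff.1 h, monomial_zero]
    have hsum : ∑ x ∈ Finset.univ ×ˢ S, coeff x.2 (P x.1) •
        paramMonomial K G ((x.1 : σ →₀ ℕ), x.2) = 0 := by
      have h0 := congrArg Subtype.val hP
      rw [AddSubmonoidClass.coe_finsetSum] at h0
      rw [Finset.sum_product]
      refine Eq.trans (Finset.sum_congr rfl fun w _ => ?_) h0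
      rw [hsmul]
      conv_rhs => rw [hPw w]
      rw [map_sum, Finset.sum_mul]
      exact Finset.sum_congr rfl fun ν _ => by
        rw [map_smul, smul_mul_assoc]; rfl
    have := linearIndependent_iff'.1 hK _ (fun x => coeff x.2 (P x.1)) hsum
    by_cases hν : ν ∈ S
    · exact this (w, ν) (by simp [hν])
    · by_contra hne
      exact hν (Finset.mem_biUnion.2 ⟨w, Finset.mem_univ _, mem_support_iff.2 hne⟩)
  -- Spanning in a form which also records that the coefficients are homogeneous; by uniqueness this
  -- passes to the coordinates in the basis.
  have key : ∀ j, ∀ f ∈ grade K M δ j, ∃ c : W →₀ MvPolynomial ι K,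
      (∀ w ν, coeff ν (c w) ≠ 0 → δ w + ν.degree = j) ∧
      ((Finsupp.linearCombination (MvPolynomial ι K) v c : monomialRing K M) :
        MvPolynomial σ K) = f := by
    intro j f hf
    have hf' := grade_le_span hspan j hf
    clear hf
    induction hf' using Submodule.span_induction with
    | mem f h =>
      obtain ⟨w, hw, ν, hj, rfl⟩ := h
      refine ⟨Finsupp.single ⟨w, hw⟩ (monomial ν 1), fun w' ν' h => ?_, ?_⟩
      · by_cases hw' : ⟨w, hw⟩ = w'
        · subst hw'
          rw [Finsupp.single_eq_same, coeff_monomial] at h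
          by_cases hν : ν = ν'
          · exact hν ▸ hj
          · exact absurd (if_neg hν) h
        · rw [Finsupp.single_eq_of_ne (Ne.symm hw'), coeff_zero] at h
          exact absurd rfl h
      · rw [Finsupp.linearCombination_single, hv]
        rfl
    | zero => exact ⟨0, fun w ν h => absurd (coeff_zero _) h, by rw [map_zero]; rfl⟩
    | add f g _ _ hf hg =>
      obtain ⟨x, hx, rfl⟩ := hf
      obtain ⟨y, hy, rfl⟩ := hg
      refine ⟨x + y, fun w ν h => ?_, by rw [map_add]; rfl⟩
      by_contra hne
      refine h ?_
      rw [Finsupp.add_apply, coeff_add, not_not.1 (mt (hx w ν) hne),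
        not_not.1 (mt (hy w ν) hne), add_zero]
    | smul a f _ hf =>
      obtain ⟨x, hx, rfl⟩ := hf
      refine ⟨(C a : MvPolynomial ι K) • x, fun w ν h => hx w ν fun h0 => h ?_, ?_⟩
      · rw [Finsupp.smul_apply, smul_eq_mul, coeff_C_mul, h0, mul_zero]
      · rw [map_smul, hsmul, ← algebraMap_eq, AlgHom.commutes, Algebra.smul_def]
  have hsp : ⊤ ≤ Submodule.span (MvPolynomial ι K) (Set.range v) := by
    intro f _
    choose! c hc hc' using fun j => key j _ (component_mem (δ := δ) f.2 j)
    have : f = ∑ j ∈ (f : MvPolynomial σ K).support.image δ,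
        Finsupp.linearCombination (MvPolynomial ι K) v (c j) := by
      apply Subtype.ext
      rw [AddSubmonoidClass.coe_finsetSum]
      conv_lhs => rw [← sum_component (δ := δ) (f : MvPolynomial σ K)]
      exact Finset.sum_congr rfl fun j _ => (hc' j).symm
    rw [this]
    exact Submodule.sum_mem _ fun j _ => Finsupp.mem_span_range_iff_exists_finsupp.2 ⟨c j, rfl⟩
  refine ⟨Module.Basis.mk hli hsp, fun w => by rw [Module.Basis.mk_apply], ?_⟩
  intro j f hf w ν hne
  obtain ⟨c, hc, hcf⟩ := key j f hf
  have : (Module.Basis.mk hli hsp).repr f = c := by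
    rw [← (Module.Basis.mk hli hsp).repr_linearCombination c, Module.Basis.coe_mk]
    congr 1
    exact (Subtype.ext hcf).symm
  rw [this] at hne
  exact hc w ν hne

end ParamBasis

end StabFamily

namespace StabFamily

open MvPolynomial

section ExistsBasis

variable {σ : Type*} {M : AddSubmonoid (σ →₀ ℕ)} {δ : (σ →₀ ℕ) →+ ℕ}
variable {ι : Type*} {G : ι → Finset (σ →₀ ℕ)}

/-- The graded form of `monomialRing_regular`: apply it and keep only the component of degree `j`.
-/
theorem mem_paramIdeal_of_param_mul_mem {p : ℕ} [Fact p.Prime]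
    (hsat : ∀ e ∈ M, ∃ N : ℕ, ∀ q ≥ N, ∀ m : σ →₀ ℕ, q • m + e ∈ M → m ∈ M)
    (hM : ∀ i, ∀ g ∈ G i, g ∈ M) (hδ : ∀ i, ∀ g ∈ G i, δ g = 1)
    (hinj : Function.Injective (aeval (R := ZMod p) (ringParam (ZMod p) hM)))
    (hfinite : (aeval (R := ZMod p) (ringParam (ZMod p) hM)).toRingHom.Finite)
    (J : Finset ι) (i : ι) (hi : i ∉ J) (j : ℕ) (f : MvPolynomial σ (ZMod p))
    (hf : f ∈ grade (ZMod p) M δ j)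
    (h : param (ZMod p) G i * f ∈ paramIdeal (ZMod p) M δ G J (j + 1)) :
    f ∈ paramIdeal (ZMod p) M δ G J j := by
  classical
  obtain ⟨s, hs, hsum⟩ := mem_paramIdeal_succ.1 h
  obtain ⟨s', hs'⟩ := monomialRing_regular hsat (ringParam (ZMod p) hM) hinj hfinite hi
    ⟨f, grade_le j hf⟩ (fun l => if hl : l ∈ J then ⟨s l, grade_le j (hs l hl)⟩ else 0) (by
      apply Subtype.ext
      rw [AddSubmonoidClass.coe_finsetSum, MulMemClass.coe_mul]
      change f * param (ZMod p) G i = _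
      rw [mul_comm, hsum]
      refine Finset.sum_congr rfl fun l hl => ?_
      rw [dif_pos hl, mul_comm]
      rfl)
  have h1 := congrArg Subtype.val hs'
  rw [AddSubmonoidClass.coe_finsetSum] at h1
  have h2 := component_mem_paramIdeal (K := ZMod p) (M := M) hδ (J := J)
    (s := fun l => (s' l : MvPolynomial σ (ZMod p))) (fun l _ => (s' l).2) j
  have h3 : ∑ l ∈ J, param (ZMod p) G l * (s' l : MvPolynomial σ (ZMod p)) = f := by
    exact (Finset.sum_congr rfl fun l _ => mul_comm _ _).trans h1.symm
  rwa [h3, component_of_mem hf] at h2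

/-- In a saturated graded monoid with a straightening law, there is a set of exponents which, over
every field of characteristic zero, gives a basis of the monomial ring modulo the parameters. -/
theorem exists_exponents_span [Finite σ] [Fintype ι] [LinearOrder ι]
    (hsat : ∀ e ∈ M, ∃ N : ℕ, ∀ q ≥ N, ∀ m : σ →₀ ℕ, q • m + e ∈ M → m ∈ M)
    (hfin : ∀ j, {m | m ∈ M ∧ δ m = j}.Finite)
    (hM : ∀ i, ∀ g ∈ G i, g ∈ M) (hδ : ∀ i, ∀ g ∈ G i, δ g = 1) (hG : ∀ i, (G i).Nonempty)
    (hst : ∀ i, ∀ g ∈ G i, ∀ g' ∈ G i, g ≠ g' →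
      ∃ j < i, ∃ h ∈ G j, ∃ h' ∈ M, g + g' = h + h')
    (hcl : ∀ m ∈ M, 0 < δ m → ∃ i, ∃ g ∈ G i, ∃ m' ∈ M, m = g + m')
    (hcard : Nat.card ι = Nat.card σ)
    (hfull : ∀ s : σ, ∃ m ∈ M, m + Finsupp.single s 1 ∈ M)
    (k : Type*) [Field k] [CharZero k] :
    ∃ W : Finset (σ →₀ ℕ), (∀ w ∈ W, w ∈ M) ∧
      (∀ j, grade k M δ j ≤ Submodule.span k
        ((fun m => monomial m (1 : k)) '' {m | m ∈ (W : Set (σ →₀ ℕ)) ∧ δ m = j}) ⊔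
        paramIdeal k M δ G Finset.univ j) ∧
      PowerSeries.mk (fun j => ((W.filter (δ · = j)).card : ℤ)) =
        (1 - PowerSeries.X) ^ Fintype.card ι * PowerSeries.mk (fun j => (hilb M δ j : ℤ)) := by
  classical
  -- Any prime would serve; it is an auxiliary characteristic in which the parameters are shown to
  -- be regular.
  have : Fact (Nat.Prime 2) := ⟨Nat.prime_two⟩
  obtain ⟨N, hN⟩ := exists_grade_le_paramIdeal (K := ZMod 2) hM hδ hst hcl
  have hfinite := aeval_ringParam_finite (K := ZMod 2) hfin hM ⟨N, hN⟩
  have hinj := aeval_ringParam_injective hM hfinite hcard hfull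
  have hseries := mk_hilb_sub_finrank (K := ZMod 2) hfin hM hδ hG
    (mem_paramIdeal_of_param_mul_mem hsat hM hδ hinj hfinite) Finset.univ
  choose W hWM hWspan hWcard using fun j =>
    exists_monomial_basis (K := ZMod 2) hfin hM hδ Finset.univ j
  -- In large degrees the quotient by the parameters vanishes, so the union over all degrees is
  -- finite.
  have hWN : ∀ j ≥ N, W j = ∅ := fun j hj => by
    have h1 : paramIdeal (ZMod 2) M δ G Finset.univ j = grade (ZMod 2) M δ j :=
      le_antisymm (paramIdeal_le_grade hM hδ _ j) (hN j hj)
    have h2 := hWcard j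
    rw [h1, finrank_grade hfin] at h2
    exact Finset.card_eq_zero.1 (by omega)
  let W' := (Finset.range N).biUnion W
  have hmem : ∀ j m, (m ∈ W' ∧ δ m = j) ↔ m ∈ W j := by
    intro j m
    simp only [W', Finset.mem_biUnion, Finset.mem_range]
    constructor
    · rintro ⟨⟨i, -, hm⟩, rfl⟩
      rwa [← (hWM i m hm).2] at hm
    · intro hm
      refine ⟨⟨j, ?_, hm⟩, (hWM j m hm).2⟩
      by_contra hj
      rw [hWN j (by omega)] at hm
      exact absurd hm (Finset.notMem_empty m)
  refine ⟨W', fun w hw => ?_, fun j => ?_, ?_⟩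
  · exact (hWM _ w ((hmem _ w).1 ⟨hw, rfl⟩)).1
  · have : {m | m ∈ (W' : Set (σ →₀ ℕ)) ∧ δ m = j} = (W j : Set (σ →₀ ℕ)) :=
      Set.ext fun m => hmem j m
    rw [this]
    exact grade_le_transfer 2 k hfin hM hδ (hWM j) (hWspan j)
  · rw [← Finset.card_univ, ← hseries]
    congr 1
    ext j
    have : W'.filter (δ · = j) = W j := by
      ext m; rw [Finset.mem_filter, hmem]
    rw [this, ← hWcard j]
    push_cast
    ring

end ExistsBasis

section Clique

variable {n : ℕ} {r : Fin n → ℕ}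

theorem finite_cliqueMonoid_deg (j : ℕ) : {m | m ∈ cliqueMonoid r ∧ deg r m = j}.Finite := by
  -- The inequalities bound `minusSum` by the degree, and `plusSum i` by the degree plus `minusSum
  -- i`, hence by `2 * j`.
  refine (Set.finite_Iic (Finsupp.equivFunOnFinite.symm fun _ : Var r => 2 * j)).subset ?_
  rintro m ⟨hm, hj⟩ v
  rw [mem_cliqueMonoid] at hm
  have h1 : ∀ i, minusSum i m ≤ ∑ i, minusSum i m := fun i =>
    Finset.single_le_sum (f := fun i => minusSum i m) (fun _ _ => Nat.zero_le _) (Finset.mem_univ i)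
  rw [Finsupp.equivFunOnFinite_symm_apply_apply]
  rcases v with _ | ⟨i, a⟩ | ⟨i, a⟩
  · have := deg_apply m; omega
  · have h2 : m (some (Sum.inl ⟨i, a⟩)) ≤ plusSum i m :=
      Finset.single_le_sum (f := fun a => m (some (Sum.inl ⟨i, a⟩)))
        (fun _ _ => Nat.zero_le _) (Finset.mem_univ a)
    have := hm.2 i; have := h1 i; omega
  · have h2 : m (some (Sum.inr ⟨i, a⟩)) ≤ minusSum i m :=
      Finset.single_le_sum (f := fun a => m (some (Sum.inr ⟨i, a⟩)))
        (fun _ _ => Nat.zero_le _) (Finset.mem_univ a)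
    have := h1 i; omega

variable (r) in
open Classical in
/-- The exponents of the generators in a given slot. -/
noncomputable def slotExps (s : Fin (2 * dim r + 1)) : Finset (Var r →₀ ℕ) :=
  (Finset.univ.filter fun g : Gen r => slot g = s).image genExp

theorem mem_slotExps {s : Fin (2 * dim r + 1)} {m : Var r →₀ ℕ} :
    m ∈ slotExps r s ↔ ∃ g : Gen r, slot g = s ∧ genExp g = m := by
  simp [slotExps]

theorem exists_slot_eq (s : ℕ) (hs : s < 2 * dim r + 1) : ∃ g : Gen r, slot g = s := by
  rcases s with _ | t
  · exact ⟨Sum.inl 0, slotPlus_of_rankSum_eq_zero (by simp [rankSum])⟩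
  · obtain ⟨i, e, he, h⟩ := exists_offset (r := r) (c := t / 2) (by omega)
    -- Within the block, the position is `2 * e` or `2 * e + 1`, which is split as evenly as
    -- possible into the minus index and the plus index.
    refine ⟨Sum.inr ⟨i, ⟨e, he⟩, ⟨e + t % 2, by omega⟩⟩, ?_⟩
    simp only [slot]
    omega

theorem slotExps_subset (s : Fin (2 * dim r + 1)) : ∀ g ∈ slotExps r s, g ∈ cliqueMonoid r := by
  intro g hg
  obtain ⟨g, -, rfl⟩ := mem_slotExps.1 hg
  exact genExp_mem g

theorem deg_slotExps (s : Fin (2 * dim r + 1)) : ∀ g ∈ slotExps r s, deg r g = 1 := by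
  intro g hg
  obtain ⟨g, -, rfl⟩ := mem_slotExps.1 hg
  exact deg_genExp g

/-- Together with `single_none_mem`, this exhibits each variable as a quotient of two monomials of
the ring. -/
theorem single_none_add_mem (s : Var r) :
    Finsupp.single none 2 + Finsupp.single s 1 ∈ cliqueMonoid r := by
  rw [mem_cliqueMonoid]
  rcases s with _ | ⟨j, a⟩ | ⟨j, a⟩
  · simp
  · refine ⟨by simp, fun i => ?_⟩
    simp [plusSum_single_inl]
    split_ifs <;> omega
  · refine ⟨by simp [minusSum_single_inr], fun i => ?_⟩
    simp [minusSum_single_inr]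
    omega

theorem single_none_mem : Finsupp.single none 2 ∈ cliqueMonoid r := by
  simp [mem_cliqueMonoid]

variable (r) in
theorem exists_exponents_cliqueMonoid (k : Type*) [Field k] [CharZero k] :
    ∃ W : Finset (Var r →₀ ℕ), (∀ w ∈ W, w ∈ cliqueMonoid r) ∧
      (∀ j, grade k (cliqueMonoid r) (deg r) j ≤ Submodule.span k
        ((fun m => monomial m (1 : k)) '' {m | m ∈ (W : Set (Var r →₀ ℕ)) ∧ deg r m = j}) ⊔
        paramIdeal k (cliqueMonoid r) (deg r) (slotExps r) Finset.univ j) ∧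
      PowerSeries.mk (fun j => ((W.filter (deg r · = j)).card : ℤ)) =
        (1 - PowerSeries.X) ^ (2 * dim r + 1) *
          PowerSeries.mk (fun j => (hilb (cliqueMonoid r) (deg r) j : ℤ)) := by
  have := exists_exponents_span (M := cliqueMonoid r) (δ := deg r) (G := slotExps r)
    (fun e _ => cliqueMonoid_saturated e) finite_cliqueMonoid_deg slotExps_subset deg_slotExps ?_
    ?_ ?_ ?_ (fun s => ⟨_, single_none_mem, single_none_add_mem s⟩) k
  · rwa [Fintype.card_fin] at this
  · intro s
    obtain ⟨g, hg⟩ := exists_slot_eq (r := r) s s.2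
    exact ⟨_, mem_slotExps.2 ⟨g, hg, rfl⟩⟩
  · intro s e he e' he' hne
    obtain ⟨g, hg, rfl⟩ := mem_slotExps.1 he
    obtain ⟨g', hg', rfl⟩ := mem_slotExps.1 he'
    obtain ⟨h, h', hlt, heq⟩ := exists_lower_slot (g := g) (g' := g')
      (fun h => hne (h ▸ rfl)) (hg.trans hg'.symm)
    exact ⟨⟨slot h, slot_lt h⟩, Fin.lt_def.2 (by simpa [← hg] using hlt), _,
      mem_slotExps.2 ⟨h, rfl, rfl⟩, _, genExp_mem h', heq⟩
  · intro m hm hpos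
    obtain ⟨g, m', hm', rfl⟩ := exists_genExp_add hm hpos
    exact ⟨⟨slot g, slot_lt g⟩, _, mem_slotExps.2 ⟨g, rfl, rfl⟩, m', hm', rfl⟩
  · rw [Nat.card_eq_fintype_card, Nat.card_eq_fintype_card]
    simp [dim, two_mul]

end Clique

end StabFamily

namespace StabFamily

/-! ### The Hilbert function of the clique monoid. -/

section Count

variable {n : ℕ} {r : Fin n → ℕ}

theorem natCard_sum_eq (α : Type*) [Fintype α] (t : ℕ) :
    Nat.card {a : α → ℕ // ∑ c, a c = t} = (Fintype.card α).multichoose t := by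
  classical
  rw [← Sym.card_sym_eq_multichoose, ← Nat.card_eq_fintype_card]
  exact Nat.card_congr (Sym.equivNatSumOfFintype α t).symm

theorem natCard_sum_le (α : Type*) [Fintype α] (t : ℕ) :
    Nat.card {a : α → ℕ // ∑ c, a c ≤ t} = (Fintype.card α + 1).multichoose t := by
  rw [← Fintype.card_option, ← natCard_sum_eq]
  refine Nat.card_congr
    { toFun := fun a => ⟨fun o => o.elim (t - ∑ c, a.1 c) a.1, ?_⟩
      invFun := fun b => ⟨fun c => b.1 (some c), ?_⟩
      left_inv := fun a => rfl
      right_inv := fun b => ?_ }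
  · have := a.2
    simp [Fintype.sum_option]; omega
  · have := b.2
    change ∑ c, b.1 (some c) ≤ t
    rw [Fintype.sum_option] at this; omega
  · have := b.2
    rw [Fintype.sum_option] at this
    ext o
    rcases o with _ | o
    · simp; omega
    · rfl

variable (r) in
/-- Exponents sorted by the slack in the inequality `Q_0` and the sums over the cliques. -/
abbrev CountData (j : ℕ) : Type :=
  Σ w : Fin (j + 1), Σ s : {s : Fin n → ℕ // ∑ i, s i = j - w}, ∀ i,
    {a : Fin (r i) → ℕ // ∑ c, a c = s.1 i} × {b : Fin (r i) → ℕ // ∑ c, b c ≤ w + s.1 i}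

/-- The exponent attached to sorted data. -/
noncomputable def CountData.toExp {j : ℕ} (x : CountData r j) : Var r →₀ ℕ :=
  Finsupp.equivFunOnFinite.symm fun v => v.elim j
    (Sum.elim (fun c => (x.2.2 c.1).2.1 c.2) (fun c => (x.2.2 c.1).1.1 c.2))

theorem CountData.deg_toExp {j : ℕ} (x : CountData r j) : deg r x.toExp = j := rfl

theorem CountData.minusSum_toExp {j : ℕ} (x : CountData r j) (i : Fin n) :
    minusSum i x.toExp = x.2.1.1 i := (x.2.2 i).1.2

theorem CountData.plusSum_toExp {j : ℕ} (x : CountData r j) (i : Fin n) :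
    plusSum i x.toExp ≤ x.1 + x.2.1.1 i := (x.2.2 i).2.2

theorem CountData.toExp_mem {j : ℕ} (x : CountData r j) : x.toExp ∈ cliqueMonoid r := by
  have h1 := x.2.1.2
  have h2 := x.1.2
  rw [mem_cliqueMonoid]
  simp only [x.minusSum_toExp, x.deg_toExp, h1]
  refine ⟨by omega, fun i => ?_⟩
  have := x.plusSum_toExp i
  omega

theorem CountData.toExp_injective {j : ℕ} :
    Function.Injective (CountData.toExp : CountData r j → Var r →₀ ℕ) := by
  rintro ⟨w, ⟨s, hs⟩, x⟩ ⟨w', ⟨s', hs'⟩, x'⟩ h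
  have h1 : s = s' := by
    ext i
    have := congrArg (minusSum i) h
    rwa [CountData.minusSum_toExp, CountData.minusSum_toExp] at this
  subst h1
  have h2 : w = w' := by
    ext
    have := w.2
    have := w'.2
    omega
  subst h2
  have h3 : x = x' := by
    funext i
    refine Prod.ext (Subtype.ext ?_) (Subtype.ext ?_)
    · funext c
      exact DFunLike.congr_fun h (some (Sum.inr ⟨i, c⟩))
    · funext c
      exact DFunLike.congr_fun h (some (Sum.inl ⟨i, c⟩))
  rw [h3]

theorem CountData.exists_toExp_eq {m : Var r →₀ ℕ} (hm : m ∈ cliqueMonoid r) :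
    ∃ x : CountData r (deg r m), x.toExp = m := by
  rw [mem_cliqueMonoid] at hm
  refine ⟨⟨⟨deg r m - ∑ i, minusSum i m, by omega⟩, ⟨fun i => minusSum i m, ?_⟩, fun i =>
    ⟨⟨fun c => m (some (Sum.inr ⟨i, c⟩)), rfl⟩, ⟨fun c => m (some (Sum.inl ⟨i, c⟩)), ?_⟩⟩⟩, ?_⟩
  · simp only; omega
  · have := hm.2 i
    rw [plusSum_apply] at this
    simp only; omega
  · ext v
    rcases v with _ | c | c <;> rfl

-- Once the slack `w` in the inequality of `Q_0` is fixed, the inequality of `Q_i` reads `plusSum i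
-- ≤ w + minusSum i`. The blocks then interact only through the total of the minus sums, so the
-- count is a coefficient of a product over the blocks.
open PowerSeries in
theorem hilb_cliqueMonoid (j : ℕ) : (hilb (cliqueMonoid r) (deg r) j : ℤ) =
    ∑ w ∈ Finset.range (j + 1), coeff (j - w) (∏ i, PowerSeries.mk fun s =>
      ((r i).multichoose s * (r i + 1).multichoose (w + s) : ℤ)) := by
  classical
  have h1 : hilb (cliqueMonoid r) (deg r) j = Nat.card (CountData r j) := by
    refine (Nat.card_eq_of_bijective (fun x : CountData r j =>
      (⟨x.toExp, x.toExp_mem, x.deg_toExp⟩ : {m // m ∈ cliqueMonoid r ∧ deg r m = j})) ⟨?_, ?_⟩).symm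
    · intro x y h
      exact CountData.toExp_injective (congrArg Subtype.val h)
    · rintro ⟨m, hm, rfl⟩
      obtain ⟨x, hx⟩ := CountData.exists_toExp_eq hm
      exact ⟨x, Subtype.ext hx⟩
  have h2 : ∀ t, Fintype {s : Fin n → ℕ // ∑ i, s i = t} := fun t =>
    Fintype.ofEquiv _ (Sym.equivNatSumOfFintype (Fin n) t)
  have h3 : ∀ (i : Fin n) t, Finite {a : Fin (r i) → ℕ // ∑ c, a c = t} := fun i t =>
    Finite.of_equiv _ (Sym.equivNatSumOfFintype (Fin (r i)) t)
  have h4 : ∀ (i : Fin n) t, Finite {a : Fin (r i) → ℕ // ∑ c, a c ≤ t} := fun i t =>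
    Set.Finite.subset (Set.finite_Iic (fun _ : Fin (r i) => t)) fun a ha c =>
      (Finset.single_le_sum (fun _ _ => Nat.zero_le _) (Finset.mem_univ c)).trans ha
  rw [h1, Nat.card_sigma, Finset.sum_range]
  push_cast
  refine Finset.sum_congr rfl fun w _ => ?_
  rw [Nat.card_sigma, coeff_prod]
  simp only [Nat.card_pi, Nat.card_prod, natCard_sum_eq, natCard_sum_le, Fintype.card_fin,
    PowerSeries.coeff_mk]
  push_cast
  refine Finset.sum_bij' (fun s _ => Finsupp.equivFunOnFinite.symm s.1)
    (fun l hl => ⟨l, (Finset.mem_finsuppAntidiag.1 hl).1⟩) ?_ ?_ ?_ ?_ ?_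
  · intro s _
    exact Finset.mem_finsuppAntidiag.2 ⟨s.2, Finset.subset_univ _⟩
  · simp
  · intro s _; rfl
  · intro l _; ext; rfl
  · intro s _; rfl

end Count

end StabFamily

/-! ### Generating function of one block, and its reciprocity. -/

namespace StabFamily

open Polynomial

theorem ring_choose_neg (x : ℤ) (j : ℕ) :
    Ring.choose (-x) j = (-1) ^ j * Ring.choose (x + j - 1) j := by
  rw [Ring.choose_neg, Units.smul_def, Int.coe_negOnePow_natCast, smul_eq_mul]

theorem ring_choose_neg_natCast (r k : ℕ) :
    Ring.choose (-(r : ℤ)) k = (-1) ^ k * (r.multichoose k : ℤ) := by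
  rw [ring_choose_neg, Nat.multichoose_eq]
  rcases r with _ | r
  · rcases k with _ | k
    · simp
    · have : (((0 : ℕ) : ℤ) + ((k + 1 : ℕ) : ℤ) - 1) = (k : ℤ) := by push_cast; ring
      rw [this, Ring.choose_natCast]
      simp
  · have : (((r + 1 : ℕ) : ℤ) + (k : ℤ) - 1) = ((r + 1 + k - 1 : ℕ) : ℤ) := by
      rw [show r + 1 + k - 1 = r + k by omega]; push_cast; ring
    rw [this, Ring.choose_natCast]

theorem multichoose_mul_choose (r s k : ℕ) (h : k ≤ s) :
    r.multichoose s * s.choose k = r.multichoose k * (r + k).multichoose (s - k) := by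
  rcases r with _ | r
  · rcases s with _ | s
    · obtain rfl : k = 0 := by omega
      simp
    · rcases k with _ | k <;> simp
  · simp only [Nat.multichoose_eq]
    have e1 : r + 1 + s - 1 = r + s := by omega
    have e2 : r + 1 + k - 1 = r + k := by omega
    have e3 : r + 1 + k + (s - k) - 1 = r + s := by omega
    rw [e1, e2, e3, Nat.choose_mul h]
    have h1 : (r + s).choose (s - k) = (r + s).choose (r + k) := by
      rw [← Nat.choose_symm (by omega)]; congr 1; omega
    rw [h1, mul_comm ((r + k).choose k), Nat.choose_mul (by omega)]
    congr 1
    rw [← Nat.choose_symm (by omega)]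
    congr 1
    omega

/-- The numerator of the generating function of `multichoose r s * multichoose (r + 1) (w + s)`. -/
noncomputable def blockPoly (r : ℕ) (w : ℤ) : ℤ[X] :=
  ∑ j ∈ Finset.range (r + 1), monomial j (Ring.choose (r - 1 - w) j * Ring.choose (w + r) (r - j))

theorem coeff_blockPoly (r : ℕ) (w : ℤ) (j : ℕ) : (blockPoly r w).coeff j =
    if j ≤ r then Ring.choose (r - 1 - w) j * Ring.choose (w + r) (r - j) else 0 := by
  simp [blockPoly, coeff_monomial]

theorem natDegree_blockPoly_le (r : ℕ) (w : ℤ) : (blockPoly r w).natDegree ≤ r := by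
  rw [natDegree_le_iff_coeff_eq_zero]
  intro j hj
  rw [coeff_blockPoly, if_neg (by omega)]

/-- Under `w ↦ -1 - w` and `j ↦ r - j` the two binomial factors of a coefficient are exchanged. This
is why `w` is allowed to be any integer. -/
theorem reflect_blockPoly (r : ℕ) (w : ℤ) :
    reflect r (blockPoly r w) = blockPoly r (-1 - w) := by
  ext j
  rw [coeff_reflect, coeff_blockPoly, coeff_blockPoly]
  by_cases h : j ≤ r
  · rw [revAt_le h, if_pos (by omega), if_pos h, mul_comm]
    congr 2
    · ring
    · omega
    · ring
  · rw [revAt_eq_self_of_lt (by omega), if_neg h, if_neg h]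

theorem coeff_one_sub_X_pow (i m : ℕ) :
    ((1 - X : ℤ[X]) ^ i).coeff m = (-1) ^ m * (i.choose m : ℤ) := by
  have : (1 - X : ℤ[X]) ^ i = ((1 + X) ^ i).comp (C (-1) * X) := by
    simp [sub_eq_add_neg]
  rw [this, comp_C_mul_X_coeff, coeff_one_add_X_pow, mul_comm]

theorem choose_mul_choose_sub (w r j k : ℕ) (hk : k ≤ j) (hj : j ≤ r) :
    (w + r).choose (r - k) * (r - k).choose (j - k) =
      (w + r).choose (r - j) * (w + j).choose (j - k) := by
  have h1 : (r - k).choose (j - k) = (r - k).choose (r - j) := by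
    rw [← Nat.choose_symm (by omega)]; congr 1; omega
  rw [h1, Nat.choose_mul (by omega)]
  congr 2 <;> omega

/-- Upper negation followed by Vandermonde, with upper arguments `-r` and `w + j`. The right-hand
side is the form in which the numerator arises from the power series. -/
theorem blockPoly_eq_sum (r w : ℕ) : blockPoly r w =
    ∑ ik ∈ Finset.HasAntidiagonal.antidiagonal r,
      C (((w + r).choose ik.1 * r.multichoose ik.2 : ℕ) : ℤ) *
      (X ^ ik.2 * (1 - X) ^ ik.1) := by
  ext j
  rw [coeff_blockPoly, finsetSum_coeff]
  simp only [coeff_C_mul, coeff_X_pow_mul', coeff_one_sub_X_pow]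
  split_ifs with h
  · rw [← Finset.Nat.sum_antidiagonal_swap, Finset.Nat.sum_antidiagonal_eq_sum_range_succ_mk]
    simp only [Prod.swap]
    rw [← Finset.sum_subset (Finset.range_mono (Nat.succ_le_succ h))
      (fun k _ hk => by rw [if_neg (by simpa using hk), mul_zero])]
    have h1 : ((r : ℤ) - 1 - w) = -((w : ℤ) - r + 1) := by ring
    have h2 : ((w : ℤ) - r + 1 + j - 1) = -(r : ℤ) + ((w + j : ℕ) : ℤ) := by push_cast; ring
    have h3 : ((w : ℤ) + r) = ((w + r : ℕ) : ℤ) := by push_cast; ring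
    rw [h1, ring_choose_neg, h2, Ring.add_choose_eq _ (Commute.all _ _), h3, Ring.choose_natCast,
      Finset.Nat.sum_antidiagonal_eq_sum_range_succ_mk, Finset.mul_sum, Finset.sum_mul]
    refine Finset.sum_congr rfl fun k hk => ?_
    have hk : k ≤ j := by simpa [Nat.lt_succ_iff] using hk
    rw [if_pos hk]
    rw [ring_choose_neg_natCast, Ring.choose_natCast]
    have h4 := choose_mul_choose_sub w r j k hk h
    zify at h4
    have h5 : ((-1 : ℤ)) ^ j * (-1) ^ k = (-1) ^ (j - k) := by
      rw [← pow_add, show j + k = (j - k) + 2 * k by omega, pow_add, pow_mul]; simp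
    push_cast
    linear_combination (r.multichoose k : ℤ) * (w + j).choose (j - k) * (w + r).choose (r - j) * h5
      - (r.multichoose k : ℤ) * (-1) ^ (j - k) * h4
  · symm
    refine Finset.sum_eq_zero fun ik hik => ?_
    rw [Finset.HasAntidiagonal.mem_antidiagonal] at hik
    split_ifs with h1
    · rw [Nat.choose_eq_zero_of_lt (by omega : ik.1 < j - ik.2)]
      simp
    · simp

-- Vandermonde writes `multichoose (r + 1) (w + s)` through the products `choose (w + r) i * choose
-- s k` with `i + k = r`. Multiplied by `multichoose r s`, each of them sums over `s` to a multiple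
-- of `X ^ k / (1 - X) ^ (r + k)`.
open PowerSeries in
theorem one_sub_X_pow_mul_mk (r w : ℕ) :
    (1 - PowerSeries.X : PowerSeries ℤ) ^ (2 * r) *
      PowerSeries.mk (fun s => (r.multichoose s * (r + 1).multichoose (w + s) : ℤ)) =
      (blockPoly r w : ℤ[X]) := by
  have h1 : PowerSeries.mk (fun s => (r.multichoose s * (r + 1).multichoose (w + s) : ℤ)) =
      ∑ ik ∈ Finset.HasAntidiagonal.antidiagonal r, PowerSeries.C (((w + r).choose ik.1 * r.multichoose ik.2 : ℕ) : ℤ) *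
        (PowerSeries.X ^ ik.2 * PowerSeries.mk fun s => ((r + ik.2).multichoose s : ℤ)) := by
    ext s
    rw [PowerSeries.coeff_mk, map_sum]
    have : (r + 1).multichoose (w + s) =
        ∑ ik ∈ Finset.HasAntidiagonal.antidiagonal r, (w + r).choose ik.1 * s.choose ik.2 := by
      rw [Nat.multichoose_eq, ← Nat.add_choose_eq, ← Nat.choose_symm (by omega)]
      congr 1 <;> omega
    rw [this]
    push_cast
    rw [Finset.mul_sum]
    refine Finset.sum_congr rfl fun ik _ => ?_
    rw [← Nat.cast_mul, PowerSeries.coeff_C_mul, PowerSeries.coeff_X_pow_mul']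
    split_ifs with h
    · rw [PowerSeries.coeff_mk]
      have := multichoose_mul_choose r s ik.2 h
      zify at this
      push_cast
      linear_combination ((w + r).choose ik.1 : ℤ) * this
    · rw [Nat.choose_eq_zero_of_lt (not_le.1 h)]
      simp
  rw [h1, blockPoly_eq_sum, Finset.mul_sum, ← Polynomial.coeToPowerSeries.ringHom_apply, map_sum]
  refine Finset.sum_congr rfl fun ik hik => ?_
  rw [Finset.HasAntidiagonal.mem_antidiagonal] at hik
  rw [show 2 * r = ik.1 + (r + ik.2) by omega, pow_add]
  simp only [map_mul, map_pow, map_sub, map_one, Polynomial.coeToPowerSeries.ringHom_apply,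
    Polynomial.coe_C, Polynomial.coe_X]
  have := one_sub_X_pow_mul_mk_multichoose (r + ik.2)
  linear_combination (PowerSeries.C (((w + r).choose ik.1 * r.multichoose ik.2 : ℕ) : ℤ)) *
    (PowerSeries.X ^ ik.2 * (1 - PowerSeries.X) ^ ik.1) * this

end StabFamily

namespace StabFamily

open Polynomial

/-! ### Symmetry of the h-vector. -/

section Palindromic

variable {n : ℕ} (r : Fin n → ℕ)

/-- The product of the numerators of the blocks. -/
noncomputable def numerator (w : ℤ) : ℤ[X] := ∏ i, blockPoly (r i) w

theorem natDegree_numerator_le (w : ℤ) : (numerator r w).natDegree ≤ dim r :=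
  (natDegree_prod_le _ _).trans (Finset.sum_le_sum fun i _ => natDegree_blockPoly_le (r i) w)

theorem reflect_numerator (w : ℤ) : reflect (dim r) (numerator r w) = numerator r (-1 - w) := by
  have : ∀ s : Finset (Fin n), reflect (∑ i ∈ s, r i) (∏ i ∈ s, blockPoly (r i) w) =
      ∏ i ∈ s, blockPoly (r i) (-1 - w) := by
    intro s
    induction s using Finset.induction_on with
    | empty =>
      rw [Finset.sum_empty, Finset.prod_empty, Finset.prod_empty, ← C_1, reflect_C, pow_zero,
        mul_one]
    | insert i s hi ih =>
      rw [Finset.sum_insert hi, Finset.prod_insert hi, Finset.prod_insert hi, reflect_mul, ih,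
        reflect_blockPoly]
      · exact natDegree_blockPoly_le _ _
      · exact (natDegree_prod_le _ _).trans
          (Finset.sum_le_sum fun i _ => natDegree_blockPoly_le (r i) w)
  exact this Finset.univ

theorem coeff_numerator_neg (w : ℤ) {j : ℕ} (hj : j ≤ dim r) :
    (numerator r (-1 - w)).coeff j = (numerator r w).coeff (dim r - j) := by
  rw [← reflect_numerator, coeff_reflect, revAt_le hj]

/-- Integer valued functions on the integers which are given by a rational polynomial. -/
def IsPolyFun (f : ℤ → ℤ) : Prop := ∃ P : ℚ[X], ∀ w : ℤ, P.eval (w : ℚ) = f w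

namespace IsPolyFun

theorem const (c : ℤ) : IsPolyFun fun _ => c := ⟨C (c : ℚ), fun w => by simp⟩

theorem add {f g : ℤ → ℤ} (hf : IsPolyFun f) (hg : IsPolyFun g) : IsPolyFun fun w => f w + g w := by
  obtain ⟨P, hP⟩ := hf
  obtain ⟨Q, hQ⟩ := hg
  exact ⟨P + Q, fun w => by simp [hP, hQ]⟩

theorem mul {f g : ℤ → ℤ} (hf : IsPolyFun f) (hg : IsPolyFun g) : IsPolyFun fun w => f w * g w := by
  obtain ⟨P, hP⟩ := hf
  obtain ⟨Q, hQ⟩ := hg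
  exact ⟨P * Q, fun w => by simp [hP, hQ]⟩

theorem sum {α : Type*} (s : Finset α) {f : α → ℤ → ℤ} (hf : ∀ a ∈ s, IsPolyFun (f a)) :
    IsPolyFun fun w => ∑ a ∈ s, f a w := by
  classical
  induction s using Finset.induction_on with
  | empty => simpa using const 0
  | insert a s ha ih =>
    simp only [Finset.sum_insert ha]
    exact (hf a (Finset.mem_insert_self a s)).add
      (ih fun b hb => hf b (Finset.mem_insert_of_mem hb))

theorem comp_linear {f : ℤ → ℤ} (hf : IsPolyFun f) (a b : ℤ) : IsPolyFun fun w => f (a + b * w) := by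
  obtain ⟨P, hP⟩ := hf
  refine ⟨P.comp (C (a : ℚ) + C (b : ℚ) * X), fun w => ?_⟩
  rw [← hP]
  simp

theorem choose (j : ℕ) : IsPolyFun fun w => Ring.choose w j := by
  refine ⟨C ((j.factorial : ℚ)⁻¹) * (descPochhammer ℤ j).map (Int.castRingHom ℚ), fun w => ?_⟩
  have h1 : ((Ring.choose w j : ℤ) : ℚ) = Ring.choose (w : ℚ) j :=
    Ring.map_choose (Int.castRingHom ℚ) w j
  rw [h1, Ring.choose_eq_smul, ← aeval_eq_smeval, aeval_def, eval_mul, eval_C, eval_map,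
    smul_eq_mul]
  rfl

/-- A polynomial which is constant at all large natural numbers is constant; this carries
information to negative arguments. -/
theorem eq_of_eventually {f : ℤ → ℤ} (hf : IsPolyFun f) {c : ℤ} {N : ℕ}
    (h : ∀ m : ℕ, N ≤ m → f m = c) (w : ℤ) : f w = c := by
  obtain ⟨P, hP⟩ := hf
  have : P = C (c : ℚ) := by
    refine Polynomial.eq_of_infinite_eval_eq _ _ ?_
    refine Set.Infinite.mono (s := (fun m : ℕ => (m : ℚ)) '' Set.Ici N) ?_
      ((Set.Ici_infinite N).image fun a _ b _ h => Nat.cast_injective h)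
    rintro _ ⟨m, hm, rfl⟩
    have := hP m
    simp only [Set.mem_ofPred_eq, eval_C]
    rw [← h m hm, ← this]
    simp
  have h2 := hP w
  rw [this, eval_C] at h2
  exact_mod_cast h2.symm

end IsPolyFun

theorem isPolyFun_coeff_blockPoly (r j : ℕ) : IsPolyFun fun w => (blockPoly r w).coeff j := by
  simp only [coeff_blockPoly]
  split_ifs with h
  · refine IsPolyFun.mul ?_ ?_
    · have := (IsPolyFun.choose j).comp_linear (r - 1) (-1)
      simpa [sub_eq_add_neg] using this
    · have := (IsPolyFun.choose (r - j)).comp_linear r 1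
      simpa [add_comm] using this
  · exact IsPolyFun.const 0

theorem isPolyFun_coeff_numerator (j : ℕ) : IsPolyFun fun w => (numerator r w).coeff j := by
  have : ∀ (s : Finset (Fin n)) (j : ℕ), IsPolyFun fun w =>
      (∏ i ∈ s, blockPoly (r i) w).coeff j := by
    intro s
    induction s using Finset.induction_on with
    | empty => intro j; simpa using IsPolyFun.const _
    | insert i s hi ih =>
      intro j
      simp only [Finset.prod_insert hi, coeff_mul]
      exact IsPolyFun.sum _ fun a _ => (isPolyFun_coeff_blockPoly _ _).mul (ih _)
  exact this Finset.univ j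

-- The factor `(1 - X) ^ (2 * dim r)` clears the denominators of all blocks at once, and the terms
-- of slack `w = m - j` contribute the coefficient of index `j`.
open PowerSeries in
theorem coeff_one_sub_X_pow_mul_hilb (m : ℕ) :
    PowerSeries.coeff m ((1 - PowerSeries.X) ^ (2 * dim r) *
      PowerSeries.mk (fun j => (hilb (cliqueMonoid r) (deg r) j : ℤ))) =
    ∑ j ∈ Finset.range (m + 1), (numerator r ((m : ℤ) - j)).coeff j := by
  classical
  set F : ℕ → PowerSeries ℤ := fun w => ∏ i, PowerSeries.mk fun s =>
      ((r i).multichoose s * (r i + 1).multichoose (w + s) : ℤ) with hF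
  have hFN : ∀ w : ℕ, (1 - PowerSeries.X : PowerSeries ℤ) ^ (2 * dim r) * F w =
      ((numerator r w : ℤ[X]) : PowerSeries ℤ) := fun w => by
    rw [hF, dim, Finset.mul_sum, ← Finset.prod_pow_eq_pow_sum, ← Finset.prod_mul_distrib,
      numerator, ← Polynomial.coeToPowerSeries.ringHom_apply, map_prod]
    exact Finset.prod_congr rfl fun i _ => one_sub_X_pow_mul_mk (r i) w
  have h1 : PowerSeries.coeff m ((1 - PowerSeries.X) ^ (2 * dim r) *
      PowerSeries.mk (fun j => (hilb (cliqueMonoid r) (deg r) j : ℤ))) =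
      PowerSeries.coeff m ((1 - PowerSeries.X) ^ (2 * dim r) *
        ∑ w ∈ Finset.range (m + 1), PowerSeries.X ^ w * F w) := by
    rw [PowerSeries.coeff_mul, PowerSeries.coeff_mul]
    refine Finset.sum_congr rfl fun x hx => ?_
    rw [Finset.HasAntidiagonal.mem_antidiagonal] at hx
    congr 1
    rw [PowerSeries.coeff_mk, hilb_cliqueMonoid, map_sum]
    simp only [PowerSeries.coeff_X_pow_mul']
    rw [← Finset.sum_subset (Finset.range_mono (by omega : x.2 + 1 ≤ m + 1))
      (fun w _ hw => if_neg (by simpa using hw))]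
    refine Finset.sum_congr rfl fun w hw => ?_
    rw [if_pos (by simpa [Nat.lt_succ_iff] using hw)]
  rw [h1, Finset.mul_sum, map_sum, ← Finset.sum_range_reflect]
  refine Finset.sum_congr rfl fun j hj => ?_
  have hj : j ≤ m := by simpa [Nat.lt_succ_iff] using hj
  rw [mul_left_comm, hFN, PowerSeries.coeff_X_pow_mul', if_pos (by omega), Polynomial.coeff_coe]
  congr 2
  · omega
  · omega

/-- `S` is the sequence of partial sums of `h`. For `m ≥ dim r` it agrees with the polynomial
function `E`, and it is eventually constant because `h` has finite support; so `E` is a constant `c`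
everywhere. For `m < dim r`, the terms of `E m` beyond those of `S m` have negative slack, and
reciprocity turns them into `S (dim r - 1 - m)`. Thus `S m + S (dim r - 1 - m) = c`, and taking
differences gives the symmetry. -/
theorem hVector_symm (h : ℕ → ℤ)
    (hh : PowerSeries.mk h = (1 - PowerSeries.X) ^ (2 * dim r + 1) *
      PowerSeries.mk (fun j => (hilb (cliqueMonoid r) (deg r) j : ℤ)))
    {L : ℕ} (hL : ∀ j ≥ L, h j = 0) :
    (∀ j, dim r < j → h j = 0) ∧ ∀ j ≤ dim r, h j = h (dim r - j) := by
  set S : ℕ → ℤ := fun m => ∑ j ∈ Finset.range (m + 1), (numerator r ((m : ℤ) - j)).coeff j with hS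
  set E : ℤ → ℤ := fun m => ∑ j ∈ Finset.range (dim r + 1), (numerator r (m - j)).coeff j with hE
  have hSsucc : ∀ m, h (m + 1) = S (m + 1) - S m := fun m => by
    have := congrArg (PowerSeries.coeff (m + 1)) hh
    rw [pow_succ', mul_assoc, sub_mul, one_mul, map_sub, PowerSeries.coeff_succ_X_mul,
      coeff_one_sub_X_pow_mul_hilb, coeff_one_sub_X_pow_mul_hilb, PowerSeries.coeff_mk] at this
    exact this
  have hS0 : h 0 = S 0 := by
    have := congrArg (PowerSeries.coeff 0) hh
    rw [pow_succ', mul_assoc, sub_mul, one_mul, map_sub, PowerSeries.coeff_zero_X_mul,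
      coeff_one_sub_X_pow_mul_hilb, PowerSeries.coeff_mk, sub_zero] at this
    exact this
  have hSE : ∀ m : ℕ, dim r ≤ m → S m = E m := fun m hm => by
    refine (Finset.sum_subset (Finset.range_mono (by omega)) fun j _ hj => ?_).symm
    refine coeff_eq_zero_of_natDegree_lt ((natDegree_numerator_le r _).trans_lt ?_)
    simpa using hj
  have hEpoly : IsPolyFun E := IsPolyFun.sum _ fun j _ => by
    have := (isPolyFun_coeff_numerator r j).comp_linear (-j) 1
    simpa [sub_eq_add_neg, add_comm] using this
  set c := S (max L (dim r)) with hc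
  have hconst : ∀ m, max L (dim r) ≤ m → S m = c := fun m hm => by
    induction m, hm using Nat.le_induction with
    | base => rfl
    | succ m hm ih =>
      have h1 := hSsucc m
      rw [hL (m + 1) (by have := le_max_left L (dim r); omega)] at h1
      rw [← ih]; linarith
  have hEc : ∀ w, E w = c := hEpoly.eq_of_eventually (N := max L (dim r)) fun m hm => by
    rw [← hSE m ((le_max_right _ _).trans hm), hconst m hm]
  have hSc : ∀ m, dim r ≤ m → S m = c := fun m hm => by rw [hSE m hm, hEc]
  have hSsymm : ∀ m, m < dim r → S m + S (dim r - 1 - m) = c := fun m hm => by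
    rw [← hEc m]
    simp only [hE]
    rw [show dim r + 1 = (m + 1) + (dim r - m) by omega, Finset.sum_range_add]
    congr 1
    simp only [hS]
    rw [show dim r - 1 - m + 1 = dim r - m by omega, ← Finset.sum_range_reflect]
    refine Finset.sum_congr rfl fun i hi => ?_
    rw [Finset.mem_range] at hi
    -- The term of slack `-1 - i` becomes a coefficient of the numerator at slack `i`.
    have h1 := coeff_numerator_neg r (-1 - (i : ℤ)) (j := dim r - m - 1 - i) (by omega)
    rw [show dim r - (dim r - m - 1 - i) = m + 1 + i by omega, sub_sub_cancel] at h1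
    rw [show ((m : ℤ) - ((m + 1 + i : ℕ) : ℤ)) = -1 - (i : ℤ) by omega, ← h1]
    congr 2
    omega
  constructor
  · intro j hj
    obtain ⟨m, rfl⟩ : ∃ m, j = m + 1 := ⟨j - 1, by omega⟩
    rw [hSsucc, hSc _ (by omega), hSc _ (by omega), sub_self]
  -- `T` is `S` shifted by one with the value `0` for `S (-1)`, so that `h` is a difference of `T`
  -- in degree zero as well.
  · set T : ℕ → ℤ := fun j => if j = 0 then 0 else S (j - 1) with hT
    have hT1 : ∀ j, T (j + 1) = S j := fun j => by simp [hT]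
    have hT0 : T 0 = 0 := by simp [hT]
    have hhT : ∀ j, h j = T (j + 1) - T j := fun j => by
      rcases j with _ | j
      · rw [hT1, hT0, hS0, sub_zero]
      · rw [hT1, hT1, hSsucc]
    have hTc : ∀ j ≤ dim r, T (j + 1) + T (dim r - j) = c := fun j hj => by
      rcases eq_or_lt_of_le hj with rfl | h1
      · rw [Nat.sub_self, hT0, hT1, hSc _ le_rfl, add_zero]
      · rw [show dim r - j = (dim r - 1 - j) + 1 by omega, hT1, hT1, hSsymm j h1]
    intro j hj
    have h1 := hTc j hj
    have h2 := hTc (dim r - j) (Nat.sub_le _ _)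
    rw [show dim r - (dim r - j) = j by omega] at h2
    rw [hhT, hhT]
    linarith

end Palindromic

end StabFamily

/-! ### From a symmetric h-vector to the Gorenstein property. -/

namespace StabFamily

open MvPolynomial

universe u

/-- A graded domain which is free over a polynomial ring, with a homogeneous basis whose degrees
are symmetric around half the degree of one of its members, is Gorenstein. -/
theorem isGorenstein_of_homogeneous_basis (k : Type u) [Field k] (m : ℕ) (R : Type u) [CommRing R]
    [IsDomain R] [IsNoetherianRing R] [Algebra (MvPolynomial (Fin m) k) R] {W : Type*} [Fintype W]
    (B : Module.Basis W (MvPolynomial (Fin m) k) R) (e : W → ℕ) (w₀ : W)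
    (hB : ∀ w w' v ν, coeff ν (B.repr (B w * B w') v) ≠ 0 → e v + ν.degree = e w + e w')
    (hsum : 2 * ∑ w, e w = Fintype.card W * e w₀) : IsGorenstein R := by
  classical
  let P := MvPolynomial (Fin m) k
  let φ : R →ₗ[P] P := B.coord w₀
  have hφ : ∀ w w' ν, coeff ν (φ (B w * B w')) ≠ 0 → e w₀ + ν.degree = e w + e w' :=
    fun w w' ν h => hB w w' w₀ ν h
  have : Module.Free P R := Module.Free.of_basis B
  have : Module.Finite P R := Module.Finite.of_basis B
  have hinjP : Function.Injective (algebraMap P R) := by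
    rw [injective_iff_map_eq_zero]
    intro p hp
    have h1 : p • B w₀ = 0 := by rw [Algebra.smul_def, hp, zero_mul]
    have h2 := congrArg (fun x => B.repr x w₀) h1
    simpa using h2
  have : FaithfulSMul P R := (faithfulSMul_iff_algebraMap_injective P R).2 hinjP
  -- In an integral extension that is a domain, a nonzero `a` divides a nonzero element `p` of `P`;
  -- then `p • B w₀` is a multiple of `a` on which `φ` takes the value `p`.
  have hinj : ∀ a, (∀ b, φ (b * a) = 0) → a = 0 := by
    intro a ha
    by_contra hne
    have hint : IsAlgebraic P a := (Algebra.IsIntegral.isIntegral a).isAlgebraic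
    obtain ⟨p, hp, b, hb⟩ := hint.exists_nonzero_dvd (mem_nonZeroDivisors_of_ne_zero hne)
    have h1 := ha (B w₀ * b)
    rw [mul_assoc, mul_comm b a, ← hb, mul_comm, ← Algebra.smul_def, map_smul] at h1
    apply hp
    simpa [φ] using h1
  let N : Matrix W W P := Matrix.of fun w w' => φ (B w * B w')
  -- Each term of the Leibniz formula is homogeneous of degree `2 * ∑ e - card W * e w₀`, which is
  -- zero by `hsum`.
  have hdet : ∀ ν, coeff ν N.det ≠ 0 → ν = 0 := by
    intro ν hν
    rw [Matrix.det_apply, coeff_sum] at hν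
    obtain ⟨π, -, hπ⟩ := Finset.exists_ne_zero_of_sum_ne_zero hν
    have hprod : ∀ s : Finset W, ∀ ν, coeff ν (∏ w ∈ s, N (π w) w) ≠ 0 →
        s.card * e w₀ + ν.degree = ∑ w ∈ s, (e (π w) + e w) := by
      intro s
      induction s using Finset.induction_on with
      | empty =>
        intro ν h
        rw [Finset.prod_empty, coeff_one] at h
        have : 0 = ν := by by_contra h0; exact h (if_neg h0)
        simp [← this]
      | insert w s hw ih =>
        intro ν h
        rw [Finset.prod_insert hw, coeff_mul] at h
        obtain ⟨⟨a, b⟩, hab, h⟩ := Finset.exists_ne_zero_of_sum_ne_zero h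
        rw [Finset.HasAntidiagonal.mem_antidiagonal] at hab
        have h1 := ih b (right_ne_zero_of_mul h)
        have h2 := hφ _ _ a (left_ne_zero_of_mul h)
        rw [Finset.card_insert_of_notMem hw, Finset.sum_insert hw, ← hab, map_add, ← h1, ← h2]
        ring
    have h0 : coeff ν (∏ w, N (π w) w) ≠ 0 := by
      intro h
      apply hπ
      rw [Units.smul_def, coeff_smul, h, smul_zero]
    have h1 := hprod Finset.univ ν h0
    rw [Finset.sum_add_distrib, Equiv.sum_comp π e, Finset.card_univ, ← hsum] at h1
    exact (Finsupp.degree_eq_zero_iff ν).1 (by omega)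
  -- A kernel vector of the Gram matrix would give an element annihilated by the form, hence zero.
  have hdet0 : N.det ≠ 0 := by
    intro h0
    obtain ⟨v, hv, hvN⟩ := Matrix.exists_mulVec_eq_zero_iff.2 h0
    apply hv
    have ha : ∑ w, v w • B w = 0 := by
      apply hinj
      intro b
      rw [← B.sum_repr b, Finset.sum_mul, map_sum]
      refine Finset.sum_eq_zero fun w _ => ?_
      rw [smul_mul_assoc, map_smul, Finset.mul_sum, map_sum]
      have := congrFun hvN w
      rw [Matrix.mulVec, dotProduct] at this
      simp only [mul_smul_comm, map_smul, smul_eq_mul]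
      rw [show ∑ x, v x * φ (B w * B x) = 0 from
        (Finset.sum_congr rfl fun x _ => mul_comm _ _).trans this, mul_zero]
    funext w
    exact Fintype.linearIndependent_iff.1 B.linearIndependent v ha w
  have hunit : IsUnit N.det := by
    have h1 : N.det = C (coeff 0 N.det) := by
      ext ν
      rw [coeff_C]
      split_ifs with h
      · rw [h]
      · by_contra h2
        exact h (hdet ν h2).symm
    rw [h1] at hdet0 ⊢
    exact (isUnit_iff_ne_zero.2 fun h => hdet0 (by rw [h, C_0])).map C
  refine isGorenstein_of_frobenius_form k m R φ hinj fun ψ => ?_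
  -- Representing `ψ` by the form means solving a linear system with the invertible Gram matrix.
  let c : W → P := N⁻¹.mulVec fun w => ψ (B w)
  have hc : N.mulVec c = fun w => ψ (B w) := by
    rw [Matrix.mulVec_mulVec, Matrix.mul_nonsing_inv _ hunit, Matrix.one_mulVec]
  refine ⟨∑ w, c w • B w, fun b => ?_⟩
  have : ψ = φ ∘ₗ LinearMap.mulRight P (∑ w, c w • B w) := by
    refine B.ext fun w => ?_
    have h := congrFun hc w
    rw [← h, Matrix.mulVec, dotProduct, LinearMap.comp_apply, LinearMap.mulRight_apply,
      Finset.mul_sum, map_sum]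
    refine Finset.sum_congr rfl fun x _ => ?_
    rw [mul_smul_comm, map_smul, smul_eq_mul, mul_comm]
    rfl
  rw [this]
  rfl

theorem hilb_cliqueMonoid_zero {n : ℕ} (r : Fin n → ℕ) : hilb (cliqueMonoid r) (deg r) 0 = 1 := by
  have h := hilb_cliqueMonoid (r := r) 0
  simp [Nat.multichoose_zero_right] at h
  exact_mod_cast h

/-- The entry in degree `dim r` equals the entry in degree zero, which is `1`, so some basis element
has top degree. By symmetry the average degree is half of it. -/
theorem two_mul_sum_deg {n : ℕ} (r : Fin n → ℕ) {W : Finset (Var r →₀ ℕ)}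
    (hcount : PowerSeries.mk (fun j => ((W.filter (deg r · = j)).card : ℤ)) =
        (1 - PowerSeries.X) ^ (2 * dim r + 1) *
          PowerSeries.mk (fun j => (hilb (cliqueMonoid r) (deg r) j : ℤ))) :
    (∃ w ∈ W, deg r w = dim r) ∧ 2 * ∑ w ∈ W, deg r w = W.card * dim r := by
  classical
  have hL : ∀ j ≥ W.sup (deg r) + 1, ((W.filter (deg r · = j)).card : ℤ) = 0 := by
    intro j hj
    rw [Nat.cast_eq_zero, Finset.card_eq_zero, Finset.filter_eq_empty_iff]
    intro w hw h
    have := Finset.le_sup (f := deg r) hw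
    omega
  obtain ⟨hzero, hsymm⟩ := hVector_symm r _ hcount hL
  have h0 : ((W.filter (deg r · = 0)).card : ℤ) = 1 := by
    have := congrArg (PowerSeries.coeff 0) hcount
    simpa [PowerSeries.coeff_mul, hilb_cliqueMonoid_zero] using this
  constructor
  · have h1 := hsymm (dim r) le_rfl
    rw [Nat.sub_self, h0] at h1
    have h2 : (W.filter (deg r · = dim r)).Nonempty := Finset.card_pos.1 (by omega)
    obtain ⟨w, hw⟩ := h2
    exact ⟨w, (Finset.mem_filter.1 hw).1, (Finset.mem_filter.1 hw).2⟩
  · have hmaps : ∀ w ∈ W, deg r w ∈ Finset.range (dim r + 1) := fun w hw => by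
      by_contra hlt
      have h1 := hzero (deg r w) (by simpa using hlt)
      rw [Nat.cast_eq_zero, Finset.card_eq_zero, Finset.filter_eq_empty_iff] at h1
      exact h1 hw rfl
    have hsym' : ∀ j ≤ dim r, (W.filter (deg r · = j)).card =
        (W.filter (deg r · = dim r - j)).card := fun j hj => by exact_mod_cast hsymm j hj
    rw [← Finset.sum_fiberwise_of_maps_to hmaps, Finset.card_eq_sum_card_fiberwise hmaps]
    have h1 : ∀ j, ∑ w ∈ W with deg r w = j, deg r w = (W.filter (deg r · = j)).card * j :=
      fun j => by
        rw [Finset.sum_congr rfl fun w hw => (Finset.mem_filter.1 hw).2, Finset.sum_const,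
          smul_eq_mul]
    simp only [h1]
    rw [two_mul]
    nth_rewrite 2 [← Finset.sum_range_reflect]
    rw [← Finset.sum_add_distrib, Finset.sum_mul]
    refine Finset.sum_congr rfl fun j hj => ?_
    have hj : j ≤ dim r := by simpa [Nat.lt_succ_iff] using hj
    rw [show dim r + 1 - 1 - j = dim r - j by omega, ← hsym' j hj, ← mul_add]
    congr 1
    omega

theorem isGorenstein_of_equiv_monomialRing {n : ℕ} (r : Fin n → ℕ) (k : Type u) [Field k]
    [CharZero k] (R : Type u) [CommRing R] [IsDomain R] [IsNoetherianRing R]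
    (e : monomialRing k (cliqueMonoid r) ≃+* R) : IsGorenstein R := by
  classical
  obtain ⟨W, hWM, hspan, hcount⟩ := exists_exponents_cliqueMonoid r k
  let P := MvPolynomial (Fin (2 * dim r + 1)) k
  let := paramAlgebra (K := k) (M := cliqueMonoid r) (slotExps_subset (r := r))
  obtain ⟨B, hB, hgr⟩ := exists_paramBasis (K := k) (finite_cliqueMonoid_deg (r := r))
    slotExps_subset deg_slotExps hWM hspan (by rwa [Fintype.card_fin])
  obtain ⟨⟨w₀, hw₀, hdeg⟩, hsum⟩ := two_mul_sum_deg r hcount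
  let : Algebra P R := (e.toRingHom.comp (algebraMap P (monomialRing k (cliqueMonoid r)))).toAlgebra
  let el : monomialRing k (cliqueMonoid r) ≃ₗ[P] R :=
    { e with
      map_smul' := fun p x => by
        change e (p • x) = p • e x
        rw [Algebra.smul_def, Algebra.smul_def, map_mul]
        rfl }
  refine isGorenstein_of_homogeneous_basis k _ R (B.map el) (fun w : W => deg r w) ⟨w₀, hw₀⟩ ?_ ?_
  · intro w w' v ν hne
    refine hgr (deg r w + deg r w') (B w * B w') ?_ v ν ?_
    · rw [hB, hB]
      exact mul_mem_grade (monomial_mem_grade (hWM _ w.2) rfl _)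
        (monomial_mem_grade (hWM _ w'.2) rfl _)
    · have : B.map el w * B.map el w' = el (B w * B w') := (map_mul e _ _).symm
      rw [this] at hne
      simpa using hne
  · simp only [Fintype.card_coe]
    rw [Finset.sum_coe_sort W (fun w => deg r w), hsum, hdeg]

end StabFamily

namespace StabFamily

/-! ### Orders along height one primes. -/

section OrdAt

variable {R : Type*} [CommRing R] [IsDomain R]

/-- A nonzero element of a domain as a unit of the fraction field. -/
noncomputable def fracUnit (x : R) (hx : x ≠ 0) : (FractionRing R)ˣ :=
  Units.mk0 (algebraMap R (FractionRing R) x)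
    (fun h => hx (FaithfulSMul.algebraMap_injective R (FractionRing R) (by rw [h, map_zero])))

theorem fracUnit_mul {x y : R} (hx : x ≠ 0) (hy : y ≠ 0) :
    fracUnit (x * y) (mul_ne_zero hx hy) = fracUnit x hx * fracUnit y hy :=
  Units.ext (by simp [fracUnit])

theorem exists_fracUnit_div (f : (FractionRing R)ˣ) :
    ∃ (x y : R) (hx : x ≠ 0) (hy : y ≠ 0), f = fracUnit x hx / fracUnit y hy := by
  obtain ⟨x, y, hy, h⟩ := IsFractionRing.div_surjective (A := R) (f : FractionRing R)
  have hy0 : y ≠ 0 := nonZeroDivisors.ne_zero hy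
  have hx0 : x ≠ 0 := by
    rintro rfl
    rw [map_zero, zero_div] at h
    exact f.ne_zero h.symm
  exact ⟨x, y, hx0, hy0, Units.ext (by simp [fracUnit, ← h, div_eq_mul_inv])⟩

theorem eq_bot_of_height_eq_zero {p : Ideal R} [p.IsPrime] (h : p.height = 0) : p = ⊥ := by
  rw [Ideal.height_eq_zero_iff] at h
  rwa [IsDomain.minimalPrimes_eq_singleton_bot] at h

variable [IsNoetherianRing R]

theorem ordAt_fracUnit (p : HeightOnePrime R) {x : R} (hx : x ≠ 0) {n : ℕ}
    (h : Ring.ord (Localization.AtPrime p.1) (algebraMap R _ x) = n) :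
    (ordAt p (fracUnit x hx)).toAdd = n := by
  have hx' : algebraMap R (Localization.AtPrime p.1) x ≠ 0 := fun h0 =>
    hx (IsLocalization.injective (Localization.AtPrime p.1) p.1.primeCompl_le_nonZeroDivisors
      (by rw [h0, map_zero]))
  have h1 : ((ordAt p (fracUnit x hx) : Multiplicative ℤ) : WithZero (Multiplicative ℤ)) =
      (Multiplicative.ofAdd (n : ℤ) : Multiplicative ℤ) := by
    rw [← Ring.ordMonoidWithZeroHom_eq_coe (Localization.AtPrime p.1)
      (mem_nonZeroDivisors_of_ne_zero hx') h,
      ← Ring.ordFrac_eq_ord (K := FractionRing R) (Localization.AtPrime p.1) hx',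
      ← IsScalarTower.algebraMap_apply]
    simp [ordAt, fracUnit]
  have h2 := WithZero.coe_injective h1
  rw [h2]; rfl

/-- `u` generates the maximal ideal of the localization at the prime `p`. -/
def IsUniformizer (p : Ideal R) (u : R) : Prop :=
  u ≠ 0 ∧ u ∈ p ∧ ∀ x ∈ p, ∃ s ∉ p, u ∣ s * x

theorem eq_of_le_of_height_eq_one {p q : Ideal R} [p.IsPrime] [q.IsPrime] (hp : p.height = 1)
    (hle : q ≤ p) (hq : q ≠ ⊥) : q = p := by
  by_contra hne
  have h1 := Ideal.height_strict_mono_of_isPrime_of_isPrime (lt_of_le_of_ne hle hne)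
  rw [hp, Order.lt_one_iff] at h1
  exact hq (eq_bot_of_height_eq_zero h1)

/-- The prime is minimal over `u`, so Krull's principal ideal theorem bounds its height by one. -/
theorem IsUniformizer.height_eq_one {p : Ideal R} [p.IsPrime] {u : R} (h : IsUniformizer p u) :
    p.height = 1 := by
  obtain ⟨h0, hu, hp⟩ := h
  apply le_antisymm
  · refine Ideal.height_le_one_of_isPrincipal_of_mem_minimalPrimes (Ideal.span {u}) p
      ⟨⟨inferInstance, by rwa [Ideal.span_singleton_le_iff_mem]⟩, ?_⟩
    rintro q ⟨hq, huq⟩ hqp x hx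
    obtain ⟨s, hs, hdvd⟩ := hp x hx
    rw [Ideal.span_singleton_le_iff_mem] at huq
    exact (hq.mem_or_mem (Ideal.mem_of_dvd q hdvd huq)).resolve_left fun h => hs (hqp h)
  · rw [Order.one_le_iff_ne_zero]
    intro h1
    exact h0 (eq_bot_of_height_eq_zero h1 ▸ hu : u ∈ (⊥ : Ideal R))

theorem ordAt_of_notMem (p : HeightOnePrime R) {x : R} (hx : x ≠ 0) (h : x ∉ p.1) :
    (ordAt p (fracUnit x hx)).toAdd = 0 := by
  have := ordAt_fracUnit p hx (n := 0) (by
    rw [Nat.cast_zero]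
    exact Ring.ord_of_isUnit (IsLocalization.map_units _ (⟨x, h⟩ : p.1.primeCompl)))
  simpa using this

theorem ordAt_uniformizer (p : HeightOnePrime R) {u : R} (h : IsUniformizer p.1 u) :
    (ordAt p (fracUnit u h.1)).toAdd = 1 := by
  refine ordAt_fracUnit p h.1 (n := 1) ?_
  have hspan : Ideal.span {algebraMap R (Localization.AtPrime p.1) u} =
      IsLocalRing.maximalIdeal (Localization.AtPrime p.1) := by
    apply le_antisymm
    · rw [Ideal.span_singleton_le_iff_mem]
      exact (IsLocalization.AtPrime.to_map_mem_maximal_iff _ p.1 u).2 h.2.1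
    · rw [← Localization.AtPrime.map_eq_maximalIdeal, Ideal.map_le_iff_le_comap]
      intro x hx
      obtain ⟨s, hs, y, hy⟩ := h.2.2 x hx
      rw [Ideal.mem_comap, Ideal.mem_span_singleton]
      have hunit : IsUnit (algebraMap R (Localization.AtPrime p.1) s) :=
        IsLocalization.map_units _ (⟨s, hs⟩ : p.1.primeCompl)
      refine (hunit.dvd_mul_left).1 ⟨algebraMap R _ y, ?_⟩
      rw [← map_mul, hy, map_mul]
  rw [Ring.ord, hspan, Nat.cast_one, Module.length_eq_one_iff]
  exact (isSimpleModule_iff_isSimpleModule_of_algebraMap_surjective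
    (S := Localization.AtPrime p.1 ⧸ IsLocalRing.maximalIdeal (Localization.AtPrime p.1))
    Ideal.Quotient.mk_surjective).2
    (letI := Ideal.Quotient.field (IsLocalRing.maximalIdeal (Localization.AtPrime p.1))
    instIsSimpleModule _)

theorem ordAt_mul (p : HeightOnePrime R) {x y : R} (hx : x ≠ 0) (hy : y ≠ 0) :
    (ordAt p (fracUnit (x * y) (mul_ne_zero hx hy))).toAdd =
      (ordAt p (fracUnit x hx)).toAdd + (ordAt p (fracUnit y hy)).toAdd := by
  rw [fracUnit_mul, map_mul, toAdd_mul]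

/-- Elements outside `p` have order zero and `u` has order one. All orders needed below are computed
through such a factorisation. -/
theorem ordAt_uniformizer_pow_mul (p : HeightOnePrime R) {u : R} (h : IsUniformizer p.1 u) {n : ℕ}
    {x y s : R} (hx : x ≠ 0) (hs : s ∉ p.1) (hy : y ∉ p.1) (heq : s * x = u ^ n * y) :
    (ordAt p (fracUnit x hx)).toAdd = n := by
  have hs0 : s ≠ 0 := fun h0 => hs (h0 ▸ p.1.zero_mem)
  have hy0 : y ≠ 0 := fun h0 => hy (h0 ▸ p.1.zero_mem)
  have h1 := ordAt_mul p hs0 hx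
  have h2 := ordAt_mul p (pow_ne_zero n h.1) hy0
  have h3 : fracUnit (s * x) (mul_ne_zero hs0 hx) =
    fracUnit (u ^ n * y) (mul_ne_zero (pow_ne_zero n h.1) hy0) := by simp only [heq]
  have h4 : (ordAt p (fracUnit (u ^ n) (pow_ne_zero n h.1))).toAdd = n := by
    have : fracUnit (u ^ n) (pow_ne_zero n h.1) = fracUnit u h.1 ^ n :=
      Units.ext (by simp [fracUnit])
    rw [this, map_pow, toAdd_pow, ordAt_uniformizer p h]
    simp
  rw [ordAt_of_notMem p hs0 hs, zero_add] at h1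
  rw [ordAt_of_notMem p hy0 hy, add_zero, h4] at h2
  rw [← h1, h3, h2]

end OrdAt

end StabFamily

namespace StabFamily

open MvPolynomial

/-! ### Facet systems and the prime ideals of facets. -/

section Facets

variable {σ : Type*} {k : Type*} [Field k] {M : AddSubmonoid (σ →₀ ℕ)}
variable {Φ : Type*} {F : Φ → ((σ →₀ ℕ) →+ ℤ)}

theorem ringMonomial_ne_zero (m : M) : ringMonomial k m ≠ 0 := fun h => by
  have := congrArg Subtype.val h
  exact one_ne_zero (monomial_eq_zero.1 this)

theorem ringMonomial_nsmul (m : M) (n : ℕ) : ringMonomial k (n • m) = ringMonomial k m ^ n :=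
  Subtype.ext (by simp [ringMonomial, monomial_pow])

theorem ringMonomial_dvd {u : M} {f : monomialRing k M}
    (h : ∀ m, coeff m (f : MvPolynomial σ k) ≠ 0 → ∃ c ∈ M, m = u + c) : ringMonomial k u ∣ f := by
  classical
  refine ⟨⟨divMonomial (f : MvPolynomial σ k) (u : σ →₀ ℕ), fun m hm => ?_⟩, Subtype.ext ?_⟩
  · rw [coeff_divMonomial] at hm
    obtain ⟨c, hc, heq⟩ := h _ hm
    rwa [add_left_cancel heq]
  · ext m
    change _ = coeff m (monomial (u : σ →₀ ℕ) 1 * _)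
    rw [coeff_monomial_mul', coeff_divMonomial]
    split_ifs with hle
    · rw [add_tsub_cancel_of_le hle, one_mul]
    · by_contra hne
      obtain ⟨c, -, rfl⟩ := h m hne
      exact hle le_self_add

/-- The part of a polynomial which is supported on a face. -/
noncomputable def facePart (L : (σ →₀ ℕ) →+ ℤ) (f : MvPolynomial σ k) : MvPolynomial σ k :=
  AddMonoidAlgebra.ofCoeff (Finsupp.filter (fun m => L m = 0) (AddMonoidAlgebra.coeff f))

theorem coeff_facePart (L : (σ →₀ ℕ) →+ ℤ) (f : MvPolynomial σ k) (m : σ →₀ ℕ) :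
    coeff m (facePart L f) = if L m = 0 then coeff m f else 0 := by
  classical
  exact Finsupp.filter_apply _ _ _

/-- Restriction to a face, as a ring homomorphism. -/
noncomputable def faceHom (L : (σ →₀ ℕ) →+ ℤ) (hL : ∀ m ∈ M, 0 ≤ L m) :
    monomialRing k M →+* MvPolynomial σ k where
  toFun f := facePart L f
  map_zero' := by ext m; simp [coeff_facePart]
  map_one' := by
    classical
    ext m
    rw [coeff_facePart, OneMemClass.coe_one, coeff_one]
    by_cases h : 0 = m
    · subst h; simp
    · simp [h]
  map_add' f g := by
    ext m
    simp only [coeff_facePart, coeff_add, AddMemClass.coe_add]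
    split_ifs <;> simp
  -- Since `L` is nonnegative on `M`, a sum of two exponents lies on the face only if both do.
  map_mul' f g := by
    classical
    ext m
    rw [coeff_facePart, coeff_mul, MulMemClass.coe_mul, coeff_mul]
    simp only [coeff_facePart]
    split_ifs with h
    · refine Finset.sum_congr rfl fun x hx => ?_
      rw [Finset.HasAntidiagonal.mem_antidiagonal] at hx
      by_cases h1 : coeff x.1 (f : MvPolynomial σ k) = 0
      · simp [h1]
      by_cases h2 : coeff x.2 (g : MvPolynomial σ k) = 0
      · simp [h2]
      have h3 := hL _ (f.2 _ h1)
      have h4 := hL _ (g.2 _ h2)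
      have h5 : L x.1 + L x.2 = 0 := by rw [← map_add, hx, h]
      rw [if_pos (by omega), if_pos (by omega)]
    · symm
      refine Finset.sum_eq_zero fun x hx => ?_
      rw [Finset.HasAntidiagonal.mem_antidiagonal] at hx
      by_cases h1 : L x.1 = 0
      · have h2 : L x.2 ≠ 0 := fun h2 => h (by rw [← hx, map_add, h1, h2, add_zero])
        simp [h2]
      · simp [h1]

variable (k) in
/-- The prime ideal of a facet. -/
noncomputable def facetPrime (L : (σ →₀ ℕ) →+ ℤ) (hL : ∀ m ∈ M, 0 ≤ L m) :
    Ideal (monomialRing k M) := RingHom.ker (faceHom L hL)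

instance (L : (σ →₀ ℕ) →+ ℤ) (hL : ∀ m ∈ M, 0 ≤ L m) : (facetPrime k L hL).IsPrime :=
  RingHom.ker_isPrime _

theorem mem_facetPrime {L : (σ →₀ ℕ) →+ ℤ} {hL : ∀ m ∈ M, 0 ≤ L m} {f : monomialRing k M} :
    f ∈ facetPrime k L hL ↔ ∀ m, coeff m (f : MvPolynomial σ k) ≠ 0 → 0 < L m := by
  rw [facetPrime, RingHom.mem_ker]
  constructor
  · intro h m hm
    refine lt_of_le_of_ne (hL m (f.2 m hm)) fun h0 => hm ?_
    have := congrArg (coeff m) h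
    change coeff m (facePart L (f : MvPolynomial σ k)) = 0 at this
    rwa [coeff_facePart, if_pos h0.symm] at this
  · intro h
    ext m
    change coeff m (facePart L (f : MvPolynomial σ k)) = 0
    rw [coeff_facePart]
    split_ifs with h0
    · by_contra hne
      exact (h m hne).ne' h0
    · rfl

theorem coeff_ringMonomial_ne_zero {u : M} {m : σ →₀ ℕ} :
    coeff m (ringMonomial k u : MvPolynomial σ k) ≠ 0 ↔ m = u := by
  classical
  change coeff m (monomial (u : σ →₀ ℕ) (1 : k)) ≠ 0 ↔ _
  rw [coeff_monomial]
  constructor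
  · intro h; by_contra h'; exact h (if_neg (Ne.symm h'))
  · rintro rfl; simp

theorem ringMonomial_mem_facetPrime {L : (σ →₀ ℕ) →+ ℤ} {hL : ∀ m ∈ M, 0 ≤ L m} {m : M} :
    ringMonomial k m ∈ facetPrime k L hL ↔ 0 < L m := by
  rw [mem_facetPrime]
  simp only [coeff_ringMonomial_ne_zero, forall_eq]

/-- A monoid cut out by irredundant primitive facets. -/
structure IsFacetSystem (M : AddSubmonoid (σ →₀ ℕ)) (F : Φ → ((σ →₀ ℕ) →+ ℤ)) : Prop where
  mem_iff : ∀ m, m ∈ M ↔ ∀ φ, 0 ≤ F φ m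
  -- This makes the difference of `b` and `a` an actual exponent, so division of monomials in the
  -- ring is controlled by the functionals alone.
  le_of_le : ∀ a b, (∀ φ, F φ a ≤ F φ b) → a ≤ b
  exists_eq_one : ∀ φ, ∃ u ∈ M, F φ u = 1
  -- An exponent in the relative interior of the facet; its monomial is invertible at the facet
  -- prime but lies in all other facet primes.
  exists_eq_zero : ∀ φ, ∃ s ∈ M, F φ s = 0 ∧ ∀ ψ, ψ ≠ φ → 0 < F ψ s
  exists_pos : ∃ c ∈ M, ∀ φ, 0 < F φ c

namespace IsFacetSystem

theorem nonneg (hF : IsFacetSystem M F) (φ : Φ) : ∀ m ∈ M, 0 ≤ F φ m := fun m hm => (hF.mem_iff m).1 hm φ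

theorem exists_add (hF : IsFacetSystem M F) {a b : σ →₀ ℕ} (h : ∀ φ, F φ a ≤ F φ b) : ∃ c ∈ M, b = a + c := by
  obtain ⟨c, rfl⟩ := exists_add_of_le (hF.le_of_le a b h)
  refine ⟨c, (hF.mem_iff c).2 fun φ => ?_, rfl⟩
  have := h φ
  rw [map_add] at this
  linarith

/-- A large multiple of `s` satisfies the conditions of all facets other than `φ`, where only the
comparison of values remains. At the facet prime, divisibility of monomials thus depends on `F φ`
alone. -/
theorem exists_nsmul_add (hF : IsFacetSystem M F) [Finite Φ]
    {φ : Φ} {s : σ →₀ ℕ} (hs : F φ s = 0)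
    (hs' : ∀ ψ, ψ ≠ φ → 0 < F ψ s) (u : σ →₀ ℕ) :
    ∃ N : ℕ, ∀ m ∈ M, F φ u ≤ F φ m → ∃ c ∈ M, N • s + m = u + c := by
  have := Fintype.ofFinite Φ
  refine ⟨∑ ψ, (F ψ u).natAbs, fun m hm hle => hF.exists_add fun ψ => ?_⟩
  rw [map_add, map_nsmul]
  by_cases h : ψ = φ
  · subst h; rw [hs]; simpa using hle
  · have h1 : (F ψ u).natAbs ≤ ∑ ψ, (F ψ u).natAbs :=
      Finset.single_le_sum (f := fun ψ => (F ψ u).natAbs) (fun _ _ => Nat.zero_le _)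
        (Finset.mem_univ ψ)
    have h2 := hs' ψ h
    have h3 := hF.nonneg ψ m hm
    rw [nsmul_eq_mul]
    have h4 : F ψ u ≤ ((F ψ u).natAbs : ℤ) := Int.le_natAbs
    have h5 : ((F ψ u).natAbs : ℤ) ≤ ((∑ ψ, (F ψ u).natAbs : ℕ) : ℤ) := by exact_mod_cast h1
    nlinarith

theorem isUniformizer (hF : IsFacetSystem M F) [Finite Φ] (φ : Φ) {u : M} (hu : F φ u = 1) :
    IsUniformizer (facetPrime k (F φ) (hF.nonneg φ)) (ringMonomial k u) := by
  refine ⟨ringMonomial_ne_zero u, ringMonomial_mem_facetPrime.2 (by omega), fun x hx => ?_⟩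
  obtain ⟨s, hs, hs0, hs'⟩ := hF.exists_eq_zero φ
  obtain ⟨N, hN⟩ := hF.exists_nsmul_add hs0 hs' (u : σ →₀ ℕ)
  refine ⟨ringMonomial k (N • ⟨s, hs⟩), fun h => ?_, ringMonomial_dvd fun m hm => ?_⟩
  · have := ringMonomial_mem_facetPrime.1 h
    change 0 < F φ (N • s) at this
    rw [map_nsmul, hs0, smul_zero] at this
    exact lt_irrefl _ this
  · classical
    change coeff m (monomial (N • s) 1 * (x : MvPolynomial σ k)) ≠ 0 at hm
    rw [coeff_monomial_mul', one_mul] at hm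
    split_ifs at hm with hle
    · obtain ⟨c, hc, heq⟩ := hN _ (x.2 _ hm) (by have := mem_facetPrime.1 hx _ hm; omega)
      refine ⟨c, hc, ?_⟩
      rw [← heq, add_tsub_cancel_of_le hle]
    · exact absurd rfl hm

end IsFacetSystem

end Facets

end StabFamily

namespace StabFamily

open MvPolynomial

/-! ### Classification of the height one primes of a monomial ring. -/

section DivisorialPrimes

variable {σ : Type*} {k : Type*} [Field k] {M : AddSubmonoid (σ →₀ ℕ)}
variable {Φ : Type*} {F : Φ → ((σ →₀ ℕ) →+ ℤ)}

theorem IsFacetSystem.exists_nsmul_eq_add [Finite Φ] (hF : IsFacetSystem M F) {s : σ →₀ ℕ}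
    (hs : ∀ φ, 0 < F φ s) (m : σ →₀ ℕ) : ∃ N : ℕ, ∃ c ∈ M, N • s = m + c := by
  have := Fintype.ofFinite Φ
  refine ⟨∑ ψ, (F ψ m).natAbs, hF.exists_add fun ψ => ?_⟩
  rw [map_nsmul, nsmul_eq_mul]
  have h1 : (F ψ m).natAbs ≤ ∑ ψ, (F ψ m).natAbs :=
    Finset.single_le_sum (f := fun ψ => (F ψ m).natAbs) (fun _ _ => Nat.zero_le _)
      (Finset.mem_univ ψ)
  have h2 := hs ψ
  have h4 : F ψ m ≤ ((F ψ m).natAbs : ℤ) := Int.le_natAbs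
  have h5 : ((F ψ m).natAbs : ℤ) ≤ ((∑ ψ, (F ψ m).natAbs : ℕ) : ℤ) := by exact_mod_cast h1
  nlinarith

/-- Every polynomial is carried into the monomial ring by a monomial of the ring. -/
theorem IsFacetSystem.exists_monomial_mul_mem [Finite Φ] (hF : IsFacetSystem M F)
    (f : MvPolynomial σ k) : ∃ l ∈ M, monomial l 1 * f ∈ monomialRing k M := by
  classical
  have := Fintype.ofFinite Φ
  obtain ⟨c, hc, hpos⟩ := hF.exists_pos
  set N := ∑ m ∈ f.support, ∑ ψ, (F ψ m).natAbs
  refine ⟨N • c, M.nsmul_mem hc N, fun m hm => (hF.mem_iff m).2 fun φ => ?_⟩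
  rw [coeff_monomial_mul', one_mul] at hm
  split_ifs at hm with hle
  · obtain ⟨m', rfl⟩ := exists_add_of_le hle
    rw [add_tsub_cancel_left, ← mem_support_iff] at hm
    have h1 : (F φ m').natAbs ≤ N :=
      (Finset.single_le_sum (f := fun ψ => (F ψ m').natAbs) (fun _ _ => Nat.zero_le _)
        (Finset.mem_univ φ)).trans
      (Finset.single_le_sum (f := fun m => ∑ ψ, (F ψ m).natAbs) (fun _ _ => Nat.zero_le _) hm)
    have h2 := hpos φ
    have h4 : -F φ m' ≤ ((F φ m').natAbs : ℤ) := by omega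
    have h5 : ((F φ m').natAbs : ℤ) ≤ (N : ℤ) := by exact_mod_cast h1
    rw [map_add, map_nsmul, nsmul_eq_mul]
    nlinarith
  · exact absurd rfl hm

/-- A height one prime ideal which contains a monomial is the prime ideal of a facet. -/
theorem IsFacetSystem.exists_eq_facetPrime [Finite Φ] [IsNoetherianRing (monomialRing k M)]
    (hF : IsFacetSystem M F) {p : Ideal (monomialRing k M)} [p.IsPrime] (hp : p.height = 1) {m : M}
    (hm : ringMonomial k m ∈ p) : ∃ φ, facetPrime k (F φ) (hF.nonneg φ) = p := by
  classical
  have := Fintype.ofFinite Φ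
  by_contra hcon
  push Not at hcon
  -- If `p` contained all monomials positive on `φ` it would contain the facet prime and equal it.
  -- The sum of the `s φ` is interior, so a multiple of it is `m` plus an element of `M`; this puts
  -- into `p` a product of monomials outside `p`.
  have h1 : ∀ φ, ∃ s : M, 0 < F φ s ∧ ringMonomial k s ∉ p := by
    intro φ
    by_contra hs
    push Not at hs
    obtain ⟨u, hu, hu1⟩ := hF.exists_eq_one φ
    refine hcon φ (eq_of_le_of_height_eq_one hp (fun f hf => ?_) fun h0 => ?_)
    · have hsum : f = ∑ m ∈ (f : MvPolynomial σ k).support.attach,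
          algebraMap k _ (coeff m.1 (f : MvPolynomial σ k)) *
            ringMonomial k (⟨m.1, f.2 _ (mem_support_iff.1 m.2)⟩ : M) := by
        apply Subtype.ext
        rw [AddSubmonoidClass.coe_finsetSum]
        conv_lhs => rw [as_sum (f : MvPolynomial σ k), ← Finset.sum_attach]
        refine Finset.sum_congr rfl fun m _ => ?_
        change _ = C _ * monomial (m : σ →₀ ℕ) 1
        rw [C_mul_monomial, mul_one]
      rw [hsum]
      refine Ideal.sum_mem _ fun m _ => Ideal.mul_mem_left _ _ (hs _ ?_)
      exact mem_facetPrime.1 hf _ (mem_support_iff.1 m.2)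
    · have h2 : ringMonomial k (⟨u, hu⟩ : M) ∈ facetPrime k (F φ) (hF.nonneg φ) :=
        ringMonomial_mem_facetPrime.2 (by simp only; omega)
      rw [h0] at h2
      exact ringMonomial_ne_zero _ h2
  choose s hs hsp using h1
  have hprod : ∀ t : Finset Φ, ringMonomial k (∑ φ ∈ t, s φ) ∉ p := by
    intro t
    induction t using Finset.induction_on with
    | empty =>
      intro h
      have : ringMonomial k (0 : M) = 1 := Subtype.ext (by simp [ringMonomial])
      rw [Finset.sum_empty, this] at h
      exact Ideal.one_notMem p h
    | insert φ t hφ ih =>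
      rw [Finset.sum_insert hφ, ringMonomial_add]
      exact fun h => (Ideal.IsPrime.mem_or_mem inferInstance h).elim (hsp φ) ih
  obtain ⟨N, c, hc, hN⟩ := hF.exists_nsmul_eq_add (s := ((∑ φ, s φ : M) : σ →₀ ℕ)) (fun φ => by
    rw [AddSubmonoidClass.coe_finsetSum, map_sum]
    exact lt_of_lt_of_le (hs φ) (Finset.single_le_sum (f := fun ψ => F φ (s ψ))
      (fun ψ _ => hF.nonneg φ _ (s ψ).2) (Finset.mem_univ φ))) (m : σ →₀ ℕ)
  have h3 : ringMonomial k (∑ φ, s φ) ^ N = ringMonomial k m * ringMonomial k ⟨c, hc⟩ := by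
    rw [← ringMonomial_nsmul, ← ringMonomial_add]
    congr 1
    exact Subtype.ext hN
  exact hprod Finset.univ (Ideal.IsPrime.mem_of_pow_mem inferInstance N
    (h3 ▸ Ideal.mul_mem_right _ _ hm))

variable (M) in
/-- The contraction of a principal ideal of the polynomial ring. -/
noncomputable def divPrime (π : MvPolynomial σ k) : Ideal (monomialRing k M) :=
  (Ideal.span {π}).comap (monomialRing k M).val

theorem mem_divPrime {π : MvPolynomial σ k} {f : monomialRing k M} :
    f ∈ divPrime M π ↔ π ∣ (f : MvPolynomial σ k) := by
  rw [divPrime, Ideal.mem_comap, Ideal.mem_span_singleton]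
  rfl

theorem divPrime_isPrime {π : MvPolynomial σ k} (hπ : Prime π) : (divPrime M π).IsPrime := by
  have := (Ideal.span_singleton_prime hπ.ne_zero).2 hπ
  exact Ideal.comap_isPrime _ _

/-- Prime polynomials which do not divide a monomial. -/
def IsNonmonomialPrime (π : MvPolynomial σ k) : Prop :=
  Prime π ∧ ∀ m, ¬ π ∣ monomial m 1

theorem IsNonmonomialPrime.notMem {π : MvPolynomial σ k} (hπ : IsNonmonomialPrime π) (m : M) :
    ringMonomial k m ∉ divPrime M π := fun h => hπ.2 _ (mem_divPrime.1 h)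

theorem IsFacetSystem.isUniformizer_divPrime [Finite Φ] (hF : IsFacetSystem M F)
    {π : MvPolynomial σ k} (hπ : IsNonmonomialPrime π) {l : σ →₀ ℕ} (hl : l ∈ M)
    (h : monomial l 1 * π ∈ monomialRing k M) :
    IsUniformizer (divPrime M π) ⟨monomial l 1 * π, h⟩ := by
  refine ⟨fun h0 => ?_, mem_divPrime.2 (dvd_mul_left _ _), fun x hx => ?_⟩
  · have := congrArg Subtype.val h0
    exact mul_ne_zero (fun h => one_ne_zero (monomial_eq_zero.1 h)) hπ.1.ne_zero this
  · obtain ⟨y, hy⟩ := mem_divPrime.1 hx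
    obtain ⟨l', hl', hy'⟩ := hF.exists_monomial_mul_mem y
    refine ⟨ringMonomial k (⟨l, hl⟩ + ⟨l', hl'⟩), hπ.notMem _, ⟨_, hy'⟩, Subtype.ext ?_⟩
    rw [ringMonomial_add]
    simp only [MulMemClass.coe_mul, hy, ringMonomial]
    ring

/-- A height one prime ideal which contains no monomial is the contraction of a principal prime
ideal of the polynomial ring. -/
theorem IsFacetSystem.exists_eq_divPrime [Finite Φ] [IsNoetherianRing (monomialRing k M)]
    (hF : IsFacetSystem M F) {q : Ideal (monomialRing k M)} [q.IsPrime] (hq : q.height = 1)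
    (hm : ∀ m : M, ringMonomial k m ∉ q) :
    ∃ π : MvPolynomial σ k, IsNonmonomialPrime π ∧ divPrime M π = q := by
  have hmon : ∀ f : monomialRing k M, ∀ m, (f : MvPolynomial σ k) = monomial m 1 → f ∉ q := by
    intro f m hf h
    have hmM : m ∈ M := f.2 m (by
      classical rw [hf, coeff_monomial, if_pos rfl]; exact one_ne_zero)
    exact hm ⟨m, hmM⟩ (by
      rwa [show ringMonomial k (⟨m, hmM⟩ : M) = f from Subtype.ext hf.symm])
  -- Factor an element of `q` in the polynomial ring. After multiplication by monomials all factors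
  -- lie in the monomial ring, and `q`, which contains no monomial, must contain a monomial multiple
  -- of some prime factor.
  have key : ∀ b : MvPolynomial σ k, b ≠ 0 → ∀ l, ∀ h : monomial l 1 * b ∈ monomialRing k M,
      (⟨_, h⟩ : monomialRing k M) ∈ q → ∃ π : MvPolynomial σ k, Prime π ∧
      ∃ l', ∃ h' : monomial l' 1 * π ∈ monomialRing k M, (⟨_, h'⟩ : monomialRing k M) ∈ q := by
    intro b
    induction b using UniqueFactorizationMonoid.induction_on_prime with
    | h₁ => exact fun h => absurd rfl h
    | h₂ b hb =>
      intro _ l h hq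
      obtain ⟨b', hb'⟩ := hb.exists_right_inv
      obtain ⟨l2, -, h2⟩ := hF.exists_monomial_mul_mem b'
      refine absurd (Ideal.mul_mem_right ⟨_, h2⟩ _ hq) (hmon _ (l + l2) ?_)
      change (monomial l 1 * b) * (monomial l2 1 * b') = _
      rw [mul_mul_mul_comm, hb', mul_one, monomial_mul, one_mul]
    | h₃ b π hb hπ ih =>
      intro _ l h hq
      obtain ⟨l1, hl1, h1⟩ := hF.exists_monomial_mul_mem π
      obtain ⟨l2, hl2, h2⟩ := hF.exists_monomial_mul_mem b
      obtain ⟨l3, hl3, h3⟩ := hF.exists_monomial_mul_mem (monomial l (1 : k))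
      have heq : (⟨_, h1⟩ : monomialRing k M) * ⟨_, h2⟩ * ⟨_, h3⟩ =
          ringMonomial k (⟨l1, hl1⟩ + ⟨l2, hl2⟩ + ⟨l3, hl3⟩) * ⟨_, h⟩ := by
        apply Subtype.ext
        rw [ringMonomial_add, ringMonomial_add]
        simp only [MulMemClass.coe_mul, ringMonomial]
        ring
      have hmem := Ideal.mul_mem_left q (ringMonomial k (⟨l1, hl1⟩ + ⟨l2, hl2⟩ + ⟨l3, hl3⟩)) hq
      rw [← heq] at hmem
      rcases Ideal.IsPrime.mem_or_mem inferInstance hmem with h' | h'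
      · rcases Ideal.IsPrime.mem_or_mem inferInstance h' with h' | h'
        · exact ⟨π, hπ, l1, h1, h'⟩
        · exact ih hb l2 h2 h'
      · exact absurd h' (hmon _ (l3 + l) (by simp [monomial_mul]))
  have hbot : q ≠ ⊥ := by
    rintro rfl
    rw [Ideal.height_bot] at hq
    exact zero_ne_one hq
  obtain ⟨a, ha, ha0⟩ := Submodule.exists_mem_ne_zero_of_ne_bot hbot
  have h0 : monomial (0 : σ →₀ ℕ) (1 : k) * (a : MvPolynomial σ k) = (a : MvPolynomial σ k) := by simp
  obtain ⟨π, hπ, l, h, hq'⟩ := key a (fun h => ha0 (Subtype.ext h)) 0 (h0.symm ▸ a.2)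
    (by rwa [show (⟨_, h0.symm ▸ a.2⟩ : monomialRing k M) = a from Subtype.ext h0])
  have hπ' : IsNonmonomialPrime π := by
    refine ⟨hπ, fun m ⟨y, hy⟩ => ?_⟩
    obtain ⟨l2, -, h2⟩ := hF.exists_monomial_mul_mem y
    refine absurd (Ideal.mul_mem_right ⟨_, h2⟩ _ hq') (hmon _ (l + l2 + m) ?_)
    change (monomial l 1 * π) * (monomial l2 1 * y) = _
    rw [mul_mul_mul_comm, ← hy, monomial_mul, monomial_mul, one_mul, one_mul]
  have := divPrime_isPrime (M := M) hπ
  refine ⟨π, hπ', eq_of_le_of_height_eq_one hq (fun g hg => ?_) fun hbot' => ?_⟩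
  · obtain ⟨y, hy⟩ := mem_divPrime.1 hg
    obtain ⟨l2, hl2, h2⟩ := hF.exists_monomial_mul_mem y
    obtain ⟨l3, hl3, h3⟩ := hF.exists_monomial_mul_mem (monomial l (1 : k))
    have heq : (⟨_, h3⟩ : monomialRing k M) * ringMonomial k ⟨l2, hl2⟩ * g =
        ringMonomial k ⟨l3, hl3⟩ * ((⟨_, h⟩ : monomialRing k M) * ⟨_, h2⟩) := by
      apply Subtype.ext
      simp only [MulMemClass.coe_mul, ringMonomial, hy]
      ring
    have hmem : (⟨_, h3⟩ : monomialRing k M) * ringMonomial k ⟨l2, hl2⟩ * g ∈ q := by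
      rw [heq]; exact Ideal.mul_mem_left _ _ (Ideal.mul_mem_right _ _ hq')
    refine (Ideal.IsPrime.mem_or_mem inferInstance hmem).resolve_left fun h' => ?_
    exact hmon _ (l3 + l + l2) (by simp [monomial_mul, ringMonomial]) h'
  · have h1 : (⟨_, h⟩ : monomialRing k M) ∈ divPrime M π := mem_divPrime.2 (dvd_mul_left _ _)
    rw [hbot'] at h1
    have h2 := congrArg Subtype.val (h1 : (⟨_, h⟩ : monomialRing k M) = 0)
    exact mul_ne_zero (fun h => one_ne_zero (monomial_eq_zero.1 h)) hπ.ne_zero h2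

/-- By unique factorisation: a prime which divides a monomial is associated to a variable, so equal
multiplicities at all other primes leave only monomials and a unit. -/
theorem exists_associated_monomial_mul {a b : MvPolynomial σ k} (ha : a ≠ 0) (hb : b ≠ 0)
    (h : ∀ π : MvPolynomial σ k, IsNonmonomialPrime π → emultiplicity π a = emultiplicity π b) :
    ∃ α β, Associated (monomial β 1 * a) (monomial α 1 * b) := by
  have hvar : ∀ p : MvPolynomial σ k, Prime p → ¬ IsNonmonomialPrime p →
      ∃ s, Associated p (X s) := by
    intro p hp hnot
    have : ∃ m, p ∣ monomial m 1 := by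
      by_contra hc; push Not at hc; exact hnot ⟨hp, hc⟩
    obtain ⟨m, hm⟩ := this
    rw [monomial_eq, C_1, one_mul, Finsupp.prod] at hm
    obtain ⟨s, -, hs⟩ := hp.exists_mem_finset_dvd hm
    exact ⟨s, hp.associated_of_dvd (X_prime) (hp.dvd_of_dvd_pow hs)⟩
  have hunit : ∀ b : MvPolynomial σ k, b ≠ 0 → (∀ π, IsNonmonomialPrime π → ¬ π ∣ b) →
      ∃ β, Associated b (monomial β 1) := by
    intro b
    induction b using UniqueFactorizationMonoid.induction_on_prime with
    | h₁ => exact fun h => absurd rfl h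
    | h₂ b hb => exact fun _ _ => ⟨0, associated_one_iff_isUnit.2 hb⟩
    | h₃ b p hb hp ih =>
      intro _ hnd
      obtain ⟨s, hs⟩ := hvar p hp fun hp' => hnd p hp' (dvd_mul_right _ _)
      obtain ⟨β, hβ⟩ := ih hb fun π hπ hd => hnd π hπ (hd.mul_left _)
      refine ⟨Finsupp.single s 1 + β, ?_⟩
      rw [← one_mul (1 : k), ← monomial_mul]
      exact hs.mul_mul hβ
  induction a using UniqueFactorizationMonoid.induction_on_prime generalizing b with
  | h₁ => exact absurd rfl ha
  | h₂ a hu =>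
    obtain ⟨β, hβ⟩ := hunit b hb fun π hπ hd => by
      have h1 := h π hπ
      rw [emultiplicity_eq_zero.2 fun hda => hπ.1.not_isUnit (isUnit_of_dvd_unit hda hu)] at h1
      exact emultiplicity_eq_zero.1 h1.symm hd
    refine ⟨0, β, ?_⟩
    have h1 : Associated (monomial β 1 * a) (monomial β 1) := associated_mul_unit_left _ _ hu
    have h2 : (monomial (0 : σ →₀ ℕ) (1 : k)) * b = b := by simp
    rw [h2]
    exact h1.trans hβ.symm
  | h₃ a p ha' hp ih =>
    by_cases hpn : IsNonmonomialPrime p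
    · have h1 : p ∣ b := by
        by_contra hnd
        have := h p hpn
        rw [emultiplicity_eq_zero.2 hnd, emultiplicity_eq_zero] at this
        exact this (dvd_mul_right _ _)
      obtain ⟨b', rfl⟩ := h1
      obtain ⟨α, β, hαβ⟩ := ih (b := b') ha' (right_ne_zero_of_mul hb) fun π hπ => by
        have h2 := h π hπ
        rw [emultiplicity_mul hπ.1, emultiplicity_mul hπ.1] at h2
        refine ENat.add_right_injective_of_ne_top ?_ h2
        exact finiteMultiplicity_iff_emultiplicity_ne_top.1
          (FiniteMultiplicity.of_prime_left hπ.1 hp.ne_zero)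
      refine ⟨α, β, ?_⟩
      rw [mul_left_comm, mul_left_comm _ p]
      exact hαβ.mul_left p
    · obtain ⟨s, hs⟩ := hvar p hp hpn
      obtain ⟨α, β, hαβ⟩ := ih (b := b) ha' hb fun π hπ => by
        have hnd : ¬ π ∣ p := fun hd => hπ.2 (Finsupp.single s 1) (hd.trans hs.dvd)
        have h1 := h π hπ
        rwa [emultiplicity_mul hπ.1, emultiplicity_eq_zero.2 hnd, zero_add] at h1
      refine ⟨Finsupp.single s 1 + α, β, ?_⟩
      rw [mul_left_comm, ← one_mul (1 : k), ← monomial_mul, mul_assoc]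
      simp only [one_mul]
      exact hs.mul_mul hαβ

end DivisorialPrimes

end StabFamily

namespace StabFamily

open MvPolynomial

/-! ### The class group of a monomial ring as a cokernel. -/

section MonomialClassGroup

variable {σ : Type*} {k : Type*} [Field k] {M : AddSubmonoid (σ →₀ ℕ)}
variable {Φ : Type*} [Finite Φ] {F : Φ → ((σ →₀ ℕ) →+ ℤ)}

variable (k) in
/-- The height one prime of a facet. -/
noncomputable def IsFacetSystem.facetPoint [IsNoetherianRing (monomialRing k M)]
    (hF : IsFacetSystem M F) (φ : Φ) : HeightOnePrime (monomialRing k M) :=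
  ⟨facetPrime k (F φ) (hF.nonneg φ), inferInstance, by
    obtain ⟨u, hu, hu1⟩ := hF.exists_eq_one φ
    exact (hF.isUniformizer φ (u := ⟨u, hu⟩) hu1).height_eq_one⟩

/-- The height one prime of a prime polynomial which divides no monomial. -/
noncomputable def IsFacetSystem.divPoint [IsNoetherianRing (monomialRing k M)]
    (hF : IsFacetSystem M F) {π : MvPolynomial σ k} (hπ : IsNonmonomialPrime π) :
    HeightOnePrime (monomialRing k M) :=
  ⟨divPrime M π, divPrime_isPrime hπ.1, by
    have := divPrime_isPrime (M := M) hπ.1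
    obtain ⟨l, hl, h⟩ := hF.exists_monomial_mul_mem π
    exact (hF.isUniformizer_divPrime hπ hl h).height_eq_one⟩

variable [IsNoetherianRing (monomialRing k M)]

theorem IsFacetSystem.facetPoint_injective (hF : IsFacetSystem M F) :
    Function.Injective (hF.facetPoint k) := by
  intro φ ψ h
  obtain ⟨s, hs, hs0, hs'⟩ := hF.exists_eq_zero φ
  by_contra hne
  have h1 : ringMonomial k (⟨s, hs⟩ : M) ∈ (hF.facetPoint k ψ).1 :=
    ringMonomial_mem_facetPrime.2 (hs' ψ (Ne.symm hne))
  rw [← h] at h1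
  have := ringMonomial_mem_facetPrime.1 h1
  simp only [hs0, lt_irrefl] at this

/-- With `n = F φ m`, `u` of value one and `s` interior to the facet, one has `N • s + m = n • u +
c`; evaluating `F φ` gives `F φ c = 0`. So the monomials of `N • s` and `c` are units at the prime.
-/
theorem IsFacetSystem.ordAt_facetPoint_monomial (hF : IsFacetSystem M F) (φ : Φ) (m : M) :
    (ordAt (hF.facetPoint k φ) (fracUnit (ringMonomial k m) (ringMonomial_ne_zero m))).toAdd =
      F φ m := by
  obtain ⟨u, hu, hu1⟩ := hF.exists_eq_one φ
  obtain ⟨s, hs, hs0, hs'⟩ := hF.exists_eq_zero φ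
  have hm := hF.nonneg φ m m.2
  obtain ⟨n, hn⟩ := Int.eq_ofNat_of_zero_le hm
  obtain ⟨N, hN⟩ := hF.exists_nsmul_add hs0 hs' (n • u)
  obtain ⟨c, hc, heq⟩ := hN m m.2 (by rw [map_nsmul, hu1, hn]; simp)
  have hc0 : F φ c = 0 := by
    have := congrArg (F φ) heq
    rw [map_add, map_add, map_nsmul, map_nsmul, hs0, hu1, hn] at this
    simpa using this
  rw [hn]
  refine ordAt_uniformizer_pow_mul (hF.facetPoint k φ) (u := ringMonomial k ⟨u, hu⟩)
    (hF.isUniformizer φ (u := ⟨u, hu⟩) hu1) (s := ringMonomial k (N • ⟨s, hs⟩))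
    (y := ringMonomial k ⟨c, hc⟩) _ (fun h => ?_) (fun h => ?_) ?_
  · have := ringMonomial_mem_facetPrime.1 h
    change 0 < F φ (N • s) at this
    rw [map_nsmul, hs0, smul_zero] at this
    exact lt_irrefl _ this
  · exact (ringMonomial_mem_facetPrime.1 h).ne' hc0
  · rw [← ringMonomial_nsmul, ← ringMonomial_add, ← ringMonomial_add]
    exact congrArg _ (Subtype.ext heq)

/-- Up to monomials, which are units at this prime, the uniformizer is `π` itself, so the order is
the multiplicity of `π`. The passage through `toNat` loses nothing, the order being nonnegative. -/
theorem IsFacetSystem.ordAt_divPoint (hF : IsFacetSystem M F) {π : MvPolynomial σ k}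
    (hπ : IsNonmonomialPrime π) {a : monomialRing k M} (ha : a ≠ 0) :
    (((ordAt (hF.divPoint hπ) (fracUnit a ha)).toAdd).toNat : ℕ∞) =
      emultiplicity π (a : MvPolynomial σ k) := by
  have hfin : FiniteMultiplicity π (a : MvPolynomial σ k) :=
    FiniteMultiplicity.of_prime_left hπ.1 (fun h => ha (Subtype.ext h))
  obtain ⟨b, hb, hnd⟩ := hfin.exists_eq_pow_mul_and_not_dvd
  obtain ⟨l, hl, h⟩ := hF.exists_monomial_mul_mem π
  obtain ⟨l', hl', h'⟩ := hF.exists_monomial_mul_mem b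
  have key := ordAt_uniformizer_pow_mul (hF.divPoint hπ) (n := multiplicity π (a : MvPolynomial σ k))
    (u := ⟨_, h⟩)
    (hF.isUniformizer_divPrime hπ hl h)
    (s := ringMonomial k (multiplicity π (a : MvPolynomial σ k) • ⟨l, hl⟩ + ⟨l', hl'⟩)) ha
    (y := ⟨_, h'⟩) (hπ.notMem _) (fun hmem => ?_) ?_
  · rw [key, hfin.emultiplicity_eq_multiplicity]; simp
  · have h1 : π ∣ monomial l' 1 * b := mem_divPrime.1 hmem
    exact (hπ.1.dvd_or_dvd h1).elim (hπ.2 _) hnd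
  · rw [ringMonomial_add, ringMonomial_nsmul]
    apply Subtype.ext
    simp only [MulMemClass.coe_mul, SubmonoidClass.coe_pow, ringMonomial]
    generalize multiplicity π (a : MvPolynomial σ k) = e at hb
    rw [hb]
    ring

theorem IsFacetSystem.emultiplicity_eq_of_ordAt_eq (hF : IsFacetSystem M F) {π : MvPolynomial σ k}
    (hπ : IsNonmonomialPrime π) {a b : monomialRing k M} (ha : a ≠ 0) (hb : b ≠ 0)
    (h : (ordAt (hF.divPoint hπ) (fracUnit a ha)).toAdd =
      (ordAt (hF.divPoint hπ) (fracUnit b hb)).toAdd) :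
    emultiplicity π (a : MvPolynomial σ k) = emultiplicity π (b : MvPolynomial σ k) := by
  rw [← hF.ordAt_divPoint hπ ha, ← hF.ordAt_divPoint hπ hb, h]

theorem IsFacetSystem.ringMonomial_notMem (hF : IsFacetSystem M F)
    {q : HeightOnePrime (monomialRing k M)} (hq : ∀ φ, hF.facetPoint k φ ≠ q) (m : M) :
    ringMonomial k m ∉ q.1 := fun h => by
  obtain ⟨φ, hφ⟩ := hF.exists_eq_facetPrime q.2.2 h
  exact hq φ (Subtype.ext hφ)

theorem IsFacetSystem.exists_eq_divPoint (hF : IsFacetSystem M F)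
    {q : HeightOnePrime (monomialRing k M)} (hq : ∀ φ, hF.facetPoint k φ ≠ q) :
    ∃ (π : MvPolynomial σ k) (hπ : IsNonmonomialPrime π), hF.divPoint hπ = q := by
  obtain ⟨π, hπ, h⟩ := hF.exists_eq_divPrime q.2.2 (hF.ringMonomial_notMem hq)
  exact ⟨π, hπ, Subtype.ext h⟩

variable (k) in
/-- The Weil divisors supported on facets. -/
noncomputable def IsFacetSystem.facetDivisor [Fintype Φ] (hF : IsFacetSystem M F) :
    (Φ → ℤ) →+ (HeightOnePrime (monomialRing k M) →₀ ℤ) where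
  toFun c := ∑ φ, Finsupp.single (hF.facetPoint k φ) (c φ)
  map_zero' := by simp
  map_add' c d := by simp [Finset.sum_add_distrib]

theorem IsFacetSystem.facetDivisor_facetPoint [Fintype Φ] (hF : IsFacetSystem M F) (c : Φ → ℤ)
    (φ : Φ) : hF.facetDivisor k c (hF.facetPoint k φ) = c φ := by
  classical
  change (∑ ψ, Finsupp.single (hF.facetPoint k ψ) (c ψ)) _ = _
  rw [Finsupp.finsetSum_apply, Finset.sum_eq_single φ]
  · simp
  · intro ψ _ h
    rw [Finsupp.single_apply, if_neg fun h' => h (hF.facetPoint_injective h')]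
  · simp

theorem IsFacetSystem.facetDivisor_of_ne [Fintype Φ] (hF : IsFacetSystem M F) (c : Φ → ℤ)
    {q : HeightOnePrime (monomialRing k M)} (hq : ∀ φ, hF.facetPoint k φ ≠ q) :
    hF.facetDivisor k c q = 0 := by
  classical
  change (∑ ψ, Finsupp.single (hF.facetPoint k ψ) (c ψ)) _ = _
  rw [Finsupp.finsetSum_apply]
  exact Finset.sum_eq_zero fun ψ _ => by rw [Finsupp.single_apply, if_neg (hq ψ)]

variable (k) in
/-- The divisor classes supported on facets. -/
noncomputable def IsFacetSystem.facetClass [Fintype Φ] (hF : IsFacetSystem M F) :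
    (Φ → ℤ) →+ DivisorClassGroup (monomialRing k M) :=
  (QuotientAddGroup.mk' _).comp (hF.facetDivisor k)

/-- A height one prime that is not a facet prime comes from a prime polynomial `π`. The divisor of a
monomial multiple of `π` is this prime plus facet primes. -/
theorem IsFacetSystem.facetClass_surjective [Fintype Φ] (hF : IsFacetSystem M F) :
    Function.Surjective (hF.facetClass k) := by
  classical
  rw [← AddMonoidHom.range_eq_top, eq_top_iff]
  rintro D -
  obtain ⟨D, rfl⟩ := QuotientAddGroup.mk_surjective D
  induction D using Finsupp.induction_linear with
  | zero => exact zero_mem _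
  | add D E hD hE => exact add_mem hD hE
  | single q n =>
    have key : ((Finsupp.single q 1 : HeightOnePrime (monomialRing k M) →₀ ℤ) :
        DivisorClassGroup (monomialRing k M)) ∈ (hF.facetClass k).range := by
      by_cases hq : ∀ φ, hF.facetPoint k φ ≠ q
      · obtain ⟨π, hπ, rfl⟩ := hF.exists_eq_divPoint hq
        obtain ⟨l, hl, h⟩ := hF.exists_monomial_mul_mem π
        have hu := hF.isUniformizer_divPrime hπ hl h
        -- The facet part of the divisor of the uniformizer, with the opposite sign.
        refine ⟨fun φ => -(ordAt (hF.facetPoint k φ) (fracUnit _ hu.1)).toAdd,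
          (QuotientAddGroup.eq (s := principalDivisors _)).2 ⟨fracUnit _ hu.1, fun p => ?_⟩⟩
        rw [Finsupp.add_apply, Finsupp.neg_apply]
        by_cases hp : ∀ φ, hF.facetPoint k φ ≠ p
        · rw [hF.facetDivisor_of_ne _ hp, neg_zero, zero_add]
          by_cases hpq : hF.divPoint hπ = p
          · subst hpq
            rw [Finsupp.single_eq_same]
            exact (ordAt_uniformizer (hF.divPoint hπ) hu).symm
          · rw [Finsupp.single_apply, if_neg hpq, ordAt_of_notMem]
            obtain ⟨π', hπ', rfl⟩ := hF.exists_eq_divPoint hp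
            intro hmem
            have h1 : π' ∣ monomial l 1 * π := mem_divPrime.1 hmem
            have h2 := hπ'.1.associated_of_dvd hπ.1
              ((hπ'.1.dvd_or_dvd h1).resolve_left (hπ'.2 _))
            refine hpq (Subtype.ext (Ideal.ext fun f => ?_))
            change f ∈ divPrime M π ↔ f ∈ divPrime M π'
            rw [mem_divPrime, mem_divPrime, h2.dvd_iff_dvd_left]
        · push Not at hp
          obtain ⟨φ, rfl⟩ := hp
          rw [hF.facetDivisor_facetPoint, Finsupp.single_apply, if_neg (hq φ).symm]
          ring
      · push Not at hq
        obtain ⟨φ, rfl⟩ := hq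
        refine ⟨Pi.single φ 1, congrArg (QuotientAddGroup.mk' (principalDivisors _))
          (?_ : hF.facetDivisor k (Pi.single φ 1) = _)⟩
        change ∑ ψ, Finsupp.single (hF.facetPoint k ψ) _ = _
        rw [Finset.sum_eq_single φ]
        · simp
        · intro ψ _ h; simp [h]
        · simp
    have := zsmul_mem key n
    rw [← QuotientAddGroup.mk_zsmul] at this
    simpa using this

/-- If the divisor of `a / b` is supported on facets, then `a` and `b` have equal multiplicities at
all nonmonomial primes. So `a / b` is a quotient of monomials times a constant, and its orders are
values of the functionals. -/
theorem IsFacetSystem.facetClass_eq_zero_iff [Fintype Φ] (hF : IsFacetSystem M F) (c : Φ → ℤ) :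
    hF.facetClass k c = 0 ↔ ∃ α ∈ M, ∃ β ∈ M, ∀ φ, c φ = F φ α - F φ β := by
  have h0 : hF.facetClass k c = 0 ↔ ∃ f : (FractionRing (monomialRing k M))ˣ,
      ∀ p, hF.facetDivisor k c p = (ordAt p f).toAdd :=
    QuotientAddGroup.eq_zero_iff _
  rw [h0]
  constructor
  · rintro ⟨f, hf⟩
    obtain ⟨a, b, ha, hb, rfl⟩ := exists_fracUnit_div f
    obtain ⟨α, β, e, he⟩ := exists_associated_monomial_mul (a := (a : MvPolynomial σ k))
      (b := (b : MvPolynomial σ k)) (fun h => ha (Subtype.ext h)) (fun h => hb (Subtype.ext h))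
      fun π hπ => by
        by_cases hq : ∀ φ, hF.facetPoint k φ ≠ hF.divPoint hπ
        · have := hf (hF.divPoint hπ)
          rw [hF.facetDivisor_of_ne c hq, map_div, toAdd_div] at this
          exact hF.emultiplicity_eq_of_ordAt_eq hπ ha hb (by linarith)
        · push Not at hq
          obtain ⟨φ, hφ⟩ := hq
          obtain ⟨s, hs, hpos⟩ := hF.exists_pos
          have h1 : ringMonomial k (⟨s, hs⟩ : M) ∈ (hF.facetPoint k φ).1 :=
            ringMonomial_mem_facetPrime.2 (hpos φ)
          rw [hφ] at h1
          exact absurd h1 (hπ.notMem _)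
    obtain ⟨s, hs, hpos⟩ := hF.exists_pos
    obtain ⟨N₁, c₁, hc₁, h₁⟩ := hF.exists_nsmul_eq_add hpos α
    obtain ⟨N₂, c₂, hc₂, h₂⟩ := hF.exists_nsmul_eq_add hpos β
    -- The monomials obtained in the polynomial ring need not lie in `M`; a common shift moves both
    -- of them into it.
    have hα : c₁ + c₂ + α ∈ M := by
      rw [show c₁ + c₂ + α = (α + c₁) + c₂ by abel, ← h₁]
      exact add_mem (nsmul_mem hs _) hc₂
    have hβ : c₁ + c₂ + β ∈ M := by
      rw [show c₁ + c₂ + β = (β + c₂) + c₁ by abel, ← h₂]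
      exact add_mem (nsmul_mem hs _) hc₁
    obtain ⟨r, hr, hre⟩ := (MvPolynomial.isUnit_iff_eq_C_of_isReduced).1 e.isUnit
    have hu : IsUnit (algebraMap k (monomialRing k M) r) := hr.map _
    have heq : ringMonomial k ⟨_, hβ⟩ * a * algebraMap k (monomialRing k M) r =
        ringMonomial k ⟨_, hα⟩ * b := by
      apply Subtype.ext
      change monomial (c₁ + c₂ + β) 1 * (a : MvPolynomial σ k) * C r =
        monomial (c₁ + c₂ + α) 1 * (b : MvPolynomial σ k)
      have h1 : ∀ m, monomial (c₁ + c₂ + m) (1 : k) = monomial (c₁ + c₂) 1 * monomial m 1 := by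
        intro m; rw [monomial_mul, one_mul]
      rw [h1, h1, mul_assoc _ _ (b : MvPolynomial σ k), ← he, hre]
      ring
    refine ⟨_, hα, _, hβ, fun φ => ?_⟩
    have hca := hf (hF.facetPoint k φ)
    rw [hF.facetDivisor_facetPoint, map_div, toAdd_div] at hca
    have h3 := ordAt_mul (hF.facetPoint k φ)
      (mul_ne_zero (ringMonomial_ne_zero (⟨_, hβ⟩ : M)) ha) hu.ne_zero
    rw [ordAt_mul _ (ringMonomial_ne_zero (⟨_, hβ⟩ : M)) ha,
      ordAt_of_notMem (hF.facetPoint k φ) hu.ne_zero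
        (fun h => (hF.facetPoint k φ).2.1.ne_top (Ideal.eq_top_of_isUnit_mem _ h hu)),
      hF.ordAt_facetPoint_monomial] at h3
    have h4 := ordAt_mul (hF.facetPoint k φ) (ringMonomial_ne_zero (⟨_, hα⟩ : M)) hb
    rw [hF.ordAt_facetPoint_monomial] at h4
    simp only [heq] at h3
    rw [h3] at h4
    simp only at h4
    linarith
  · rintro ⟨α, hα, β, hβ, hc⟩
    refine ⟨fracUnit (ringMonomial k ⟨α, hα⟩) (ringMonomial_ne_zero _) /
      fracUnit (ringMonomial k ⟨β, hβ⟩) (ringMonomial_ne_zero _), fun p => ?_⟩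
    rw [map_div, toAdd_div]
    by_cases hp : ∀ φ, hF.facetPoint k φ ≠ p
    · rw [hF.facetDivisor_of_ne _ hp, ordAt_of_notMem p _ (hF.ringMonomial_notMem hp _),
        ordAt_of_notMem p _ (hF.ringMonomial_notMem hp _), sub_zero]
    · push Not at hp
      obtain ⟨φ, rfl⟩ := hp
      rw [hF.facetDivisor_facetPoint, hF.ordAt_facetPoint_monomial, hF.ordAt_facetPoint_monomial,
        hc]

/-- The divisor class group of a monomial ring is the cokernel of the facet functionals. -/
theorem IsFacetSystem.nonempty_divisorClassGroup_equiv (hF : IsFacetSystem M F) {A : Type*}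
    [AddCommGroup A] (χ : (Φ → ℤ) →+ A) (hsurj : Function.Surjective χ)
    (hker : ∀ c, χ c = 0 ↔ ∃ α ∈ M, ∃ β ∈ M, ∀ φ, c φ = F φ α - F φ β) :
    Nonempty (DivisorClassGroup (monomialRing k M) ≃+ A) := by
  have := Fintype.ofFinite Φ
  have h : (hF.facetClass k).ker = χ.ker := by
    ext c
    rw [AddMonoidHom.mem_ker, AddMonoidHom.mem_ker, hker, hF.facetClass_eq_zero_iff]
  exact ⟨(QuotientAddGroup.quotientKerEquivOfSurjective _ hF.facetClass_surjective).symm.trans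
    ((QuotientAddGroup.quotientAddEquivOfEq h).trans
      (QuotientAddGroup.quotientKerEquivOfSurjective χ hsurj))⟩

end MonomialClassGroup

end StabFamily

namespace StabFamily

/-! ### Numbering of the vertices, and adjacency in coordinates. -/

section Vertices

variable {n : ℕ} {r : Fin n → ℕ}

theorem sum_Iic_eq (i : Fin n) : ∑ k ∈ Finset.Iic i, r k = offset r i + r i := by
  rw [offset, ← Finset.Iio_insert i, Finset.sum_insert (by simp), add_comm]

variable (r) in
/-- The numbering of the vertices by pairs `(i, a)` with `a < r i` and a sign. -/
def vtxFun : Cell r ⊕ Cell r → Fin (2 * dim r)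
  | Sum.inl c => ⟨offset r c.1 + c.2, by
      have := offset_add_le_dim (r := r) c.1; have := c.2.2; omega⟩
  | Sum.inr c => ⟨dim r + (offset r c.1 + c.2), by
      have := offset_add_le_dim (r := r) c.1; have := c.2.2; omega⟩

theorem offset_add_injective {c c' : Cell r}
    (h : offset r c.1 + (c.2 : ℕ) = offset r c'.1 + c'.2) : c = c' := by
  obtain ⟨i, a⟩ := c
  obtain ⟨j, b⟩ := c'
  obtain ⟨rfl, hab⟩ := offset_unique a.2 b.2 h
  exact congrArg _ (Fin.ext hab)

theorem vtxFun_bijective : Function.Bijective (vtxFun r) := by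
  constructor
  · rintro (c | c) (c' | c') h
    · rw [offset_add_injective (Fin.ext_iff.1 h)]
    · have h1 := Fin.ext_iff.1 h
      have := offset_add_le_dim (r := r) c.1; have := c.2.2
      simp only [vtxFun] at h1
      omega
    · have h1 := Fin.ext_iff.1 h
      have := offset_add_le_dim (r := r) c'.1; have := c'.2.2
      simp only [vtxFun] at h1
      omega
    · have h1 := Fin.ext_iff.1 h
      simp only [vtxFun] at h1
      rw [offset_add_injective (Nat.add_left_cancel h1)]
  · intro v
    by_cases hv : v.val < dim r
    · obtain ⟨i, e, he, h⟩ := exists_offset hv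
      exact ⟨Sum.inl ⟨i, e, he⟩, Fin.ext h.symm⟩
    · obtain ⟨i, e, he, h⟩ := exists_offset (r := r) (c := v.val - dim r) (by omega)
      refine ⟨Sum.inr ⟨i, e, he⟩, Fin.ext ?_⟩
      simp only [vtxFun]
      omega

variable (r) in
/-- The numbering of the vertices, as an equivalence. -/
noncomputable def vtx : Cell r ⊕ Cell r ≃ Fin (2 * dim r) := Equiv.ofBijective _ vtxFun_bijective

theorem vtx_inl_val (c : Cell r) : (vtx r (Sum.inl c)).val = offset r c.1 + c.2 := rfl

theorem vtx_inr_val (c : Cell r) : (vtx r (Sum.inr c)).val = dim r + (offset r c.1 + c.2) := rfl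

theorem offset_block_iff {i : Fin n} {c : Cell r} :
    (offset r i ≤ offset r c.1 + (c.2 : ℕ) ∧ offset r c.1 + (c.2 : ℕ) < offset r i + r i) ↔
      c.1 = i := by
  constructor
  · rintro ⟨h1, h2⟩
    exact (offset_unique (e := c.2) (f := offset r c.1 + c.2 - offset r i) c.2.2 (by omega)
      (by omega)).1
  · rintro rfl
    exact ⟨by omega, by have := c.2.2; omega⟩

@[simp] theorem vtx_inl_mem_Qplus {i : Fin n} {c : Cell r} :
    vtx r (Sum.inl c) ∈ Qplus r i ↔ c.1 = i := by
  rw [Qplus, Finset.mem_filter, sum_Iic_eq, vtx_inl_val, ← offset_block_iff]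
  exact and_iff_right (Finset.mem_univ _)

@[simp] theorem vtx_inr_notMem_Qplus {i : Fin n} {c : Cell r} :
    vtx r (Sum.inr c) ∉ Qplus r i := by
  rw [Qplus, Finset.mem_filter, sum_Iic_eq, vtx_inr_val]
  have := offset_add_le_dim (r := r) i
  omega

@[simp] theorem vtx_inl_notMem_Qminus {i : Fin n} {c : Cell r} :
    vtx r (Sum.inl c) ∉ Qminus r i := by
  rw [Qminus, Finset.mem_filter, vtx_inl_val]
  have := offset_add_le_dim (r := r) c.1
  have := c.2.2
  omega

@[simp] theorem vtx_inr_mem_Qminus {i : Fin n} {c : Cell r} :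
    vtx r (Sum.inr c) ∈ Qminus r i ↔ c.1 = i := by
  rw [Qminus, Finset.mem_filter, sum_Iic_eq, vtx_inr_val, ← offset_block_iff]
  change _ ∧ dim r + offset r i ≤ _ ∧ _ ↔ _
  simp only [Finset.mem_univ, true_and]
  omega

@[simp] theorem vtx_inl_notMem_Qzero {c : Cell r} : vtx r (Sum.inl c) ∉ Qzero r := by
  rw [Qzero, Finset.mem_filter, vtx_inl_val]
  have := offset_add_le_dim (r := r) c.1
  have := c.2.2
  omega

@[simp] theorem vtx_inr_mem_Qzero {c : Cell r} : vtx r (Sum.inr c) ∈ Qzero r := by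
  rw [Qzero, Finset.mem_filter, vtx_inr_val]
  exact ⟨Finset.mem_univ _, by omega⟩

@[simp] theorem vtx_inl_notMem_Q_zero {c : Cell r} : vtx r (Sum.inl c) ∉ Q r 0 :=
  vtx_inl_notMem_Qzero

@[simp] theorem vtx_inr_mem_Q_zero {c : Cell r} : vtx r (Sum.inr c) ∈ Q r 0 := vtx_inr_mem_Qzero

@[simp] theorem vtx_inl_mem_Q_succ {i : Fin n} {c : Cell r} :
    vtx r (Sum.inl c) ∈ Q r i.succ ↔ c.1 = i := by
  simp [Q]

@[simp] theorem vtx_inr_mem_Q_succ {i : Fin n} {c : Cell r} :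
    vtx r (Sum.inr c) ∈ Q r i.succ ↔ c.1 ≠ i := by
  simp [Q]

theorem graph_adj {u v : Fin (2 * dim r)} :
    (graph r).Adj u v ↔ u ≠ v ∧ ∃ i, u ∈ Q r i ∧ v ∈ Q r i := Iff.rfl

@[simp] theorem adj_inl_inl {c c' : Cell r} :
    (graph r).Adj (vtx r (Sum.inl c)) (vtx r (Sum.inl c')) ↔ c ≠ c' ∧ c.1 = c'.1 := by
  simp only [graph_adj, Fin.exists_fin_succ, ne_eq, EmbeddingLike.apply_eq_iff_eq, Sum.inl.injEq]
  simp [eq_comm]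

@[simp] theorem adj_inr_inr {c c' : Cell r} :
    (graph r).Adj (vtx r (Sum.inr c)) (vtx r (Sum.inr c')) ↔ c ≠ c' := by
  simp [graph_adj, Fin.exists_fin_succ]

@[simp] theorem adj_inl_inr {c c' : Cell r} :
    (graph r).Adj (vtx r (Sum.inl c)) (vtx r (Sum.inr c')) ↔ c.1 ≠ c'.1 := by
  simp [graph_adj, Fin.exists_fin_succ, eq_comm]

@[simp] theorem adj_inr_inl {c c' : Cell r} :
    (graph r).Adj (vtx r (Sum.inr c)) (vtx r (Sum.inl c')) ↔ c'.1 ≠ c.1 := by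
  rw [SimpleGraph.adj_comm, adj_inl_inr]

end Vertices

end StabFamily

namespace StabFamily

open MvPolynomial

/-! ### Stable sets as exponents; the stable set ring as a monomial ring. -/

section StableSets

variable {n : ℕ} {r : Fin n → ℕ}

/-- The exponent of a set of vertices. -/
noncomputable def setExp (S : Finset (Cell r ⊕ Cell r)) : Var r →₀ ℕ :=
  Finsupp.single none 1 + ∑ c ∈ S, Finsupp.single (some c) 1

@[simp] theorem setExp_none (S : Finset (Cell r ⊕ Cell r)) : setExp S none = 1 := by
  simp [setExp]

theorem setExp_some [DecidableEq (Cell r ⊕ Cell r)] (S : Finset (Cell r ⊕ Cell r))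
    (c : Cell r ⊕ Cell r) : setExp S (some c) = if c ∈ S then 1 else 0 := by
  classical
  simp only [setExp, Finsupp.add_apply, Finsupp.finsetSum_apply, Finsupp.single_apply,
    Option.some.injEq, reduceCtorEq, if_false, zero_add, Finset.sum_ite_eq']

/-- Sets of vertices without adjacent pairs. -/
def IsStable (S : Finset (Cell r ⊕ Cell r)) : Prop :=
  ∀ u ∈ S, ∀ v ∈ S, ¬ (graph r).Adj (vtx r u) (vtx r v)

/-- A clique contains at most one vertex of a stable set, which is each clique inequality in degree
one. -/
theorem setExp_mem {S : Finset (Cell r ⊕ Cell r)} (hS : IsStable S) :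
    setExp S ∈ cliqueMonoid r := by
  classical
  have hminus : ∑ i, minusSum i (setExp S) = (Finset.univ.filter fun c : Cell r =>
      Sum.inr c ∈ S).card := by
    simp only [minusSum_apply, setExp_some]
    rw [Finset.card_filter, ← Finset.univ_sigma_univ, Finset.sum_sigma]
  have h1 : ∑ i, minusSum i (setExp S) ≤ 1 := by
    rw [hminus, Finset.card_le_one]
    intro c hc c' hc'
    by_contra hne
    exact hS _ (Finset.mem_filter.1 hc).2 _ (Finset.mem_filter.1 hc').2 (adj_inr_inr.2 hne)
  refine mem_cliqueMonoid.2 ⟨by rwa [deg_apply, setExp_none], fun i => ?_⟩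
  rw [deg_apply, setExp_none]
  by_cases hex : ∃ a, Sum.inl ⟨i, a⟩ ∈ S
  · obtain ⟨a, ha⟩ := hex
    have h2 : plusSum i (setExp S) ≤ 1 := by
      simp only [plusSum_apply, setExp_some]
      rw [Finset.sum_boole, Nat.cast_id, Finset.card_le_one]
      intro b hb b' hb'
      by_contra hne
      exact hS _ (Finset.mem_filter.1 hb).2 _ (Finset.mem_filter.1 hb').2
        (adj_inl_inl.2 ⟨by simpa using hne, rfl⟩)
    have h3 : ∑ j, minusSum j (setExp S) = minusSum i (setExp S) := by
      refine Finset.sum_eq_single i (fun j _ hj => ?_) (by simp)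
      rw [minusSum_apply]
      refine Finset.sum_eq_zero fun b _ => ?_
      rw [setExp_some, if_neg]
      exact fun hb => hS _ ha _ hb (adj_inl_inr.2 (Ne.symm hj))
    omega
  · have h2 : plusSum i (setExp S) = 0 := by
      rw [plusSum_apply]
      refine Finset.sum_eq_zero fun b _ => ?_
      rw [setExp_some, if_neg fun hb => hex ⟨b, hb⟩]
    omega

@[simp] theorem plusExp_inl (i : Fin n) (b : Fin (r i + 1)) (c : Cell r) :
    plusExp i b (some (Sum.inl c)) = if (b : ℕ) = c.2 + 1 ∧ i = c.1 then 1 else 0 := by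
  classical
  obtain ⟨j, a⟩ := c
  induction b using Fin.cases with
  | zero => simp [plusExp_zero]
  | succ a' =>
    rw [plusExp_succ, Finsupp.single_apply]
    congr 1
    simp only [Option.some.injEq, Sum.inl.injEq, Sigma.mk.injEq, Fin.val_succ, eq_iff_iff]
    constructor
    · rintro ⟨rfl, h⟩; exact ⟨by rw [eq_of_heq h], rfl⟩
    · rintro ⟨h, rfl⟩; exact ⟨rfl, heq_of_eq (Fin.ext (by omega))⟩

@[simp] theorem plusExp_inr (i : Fin n) (b : Fin (r i + 1)) (c : Cell r) :
    plusExp i b (some (Sum.inr c)) = 0 := by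
  induction b using Fin.cases with
  | zero => simp [plusExp_zero]
  | succ a' => simp [plusExp_succ]

@[simp] theorem plusExp_none (i : Fin n) (b : Fin (r i + 1)) :
    plusExp (r := r) i b none = 0 := by
  induction b using Fin.cases with
  | zero => simp [plusExp_zero]
  | succ a' => simp [plusExp_succ]

theorem exists_setExp_eq_genExp (g : Gen r) : ∃ S, IsStable S ∧ setExp S = genExp g := by
  classical
  rcases g with b | ⟨i, a, b⟩
  · refine ⟨(Finset.univ.filter fun c : Cell r => (b c.1 : ℕ) = c.2 + 1).map ⟨_, Sum.inl_injective⟩,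
      ?_, ?_⟩
    · rintro u hu v hv
      obtain ⟨⟨i, a⟩, hc, rfl⟩ := Finset.mem_map.1 hu
      obtain ⟨⟨j, a'⟩, hc', rfl⟩ := Finset.mem_map.1 hv
      simp only [Function.Embedding.coeFn_mk, adj_inl_inl, not_and]
      rintro hne rfl
      have h1 := (Finset.mem_filter.1 hc).2
      have h2 := (Finset.mem_filter.1 hc').2
      simp only at h1 h2
      exact hne (by rw [show a = a' from Fin.ext (by omega)])
    · ext v
      rcases v with _ | c | c
      · simp [genExp]
      · rw [setExp_some, genExp, Finsupp.add_apply, Finsupp.finsetSum_apply]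
        simp only [plusExp_inl]
        rw [Finset.sum_eq_single c.1 (fun j _ hj => if_neg fun h => hj h.2) (by simp)]
        simp
      · rw [setExp_some]
        simp [genExp]
  · refine ⟨insert (Sum.inr ⟨i, a⟩) ((Finset.univ.filter fun c : Cell r =>
      (b : ℕ) = c.2 + 1 ∧ i = c.1).map ⟨_, Sum.inl_injective⟩), ?_, ?_⟩
    · intro u hu v hv
      rw [Finset.mem_insert, Finset.mem_map] at hu hv
      rcases hu with rfl | ⟨⟨j, c⟩, hc, rfl⟩ <;> rcases hv with rfl | ⟨⟨j', c'⟩, hc', rfl⟩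
      · simp
      · simpa using (Finset.mem_filter.1 hc').2.2.symm
      · simpa using (Finset.mem_filter.1 hc).2.2.symm
      · simp only [Function.Embedding.coeFn_mk, adj_inl_inl, not_and]
        rintro hne rfl
        have h1 := (Finset.mem_filter.1 hc).2.1
        have h2 := (Finset.mem_filter.1 hc').2.1
        simp only at h1 h2
        exact hne (by rw [show c = c' from Fin.ext (by omega)])
    · ext v
      rcases v with _ | c | c
      · simp [genExp]
      · rw [setExp_some]
        simp [genExp]
      · rw [setExp_some]
        simp [genExp, Finsupp.single_apply, eq_comm]

theorem monomialRing_closure {σ k : Type*} [Field k] (s : Set (σ →₀ ℕ)) :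
    monomialRing k (AddSubmonoid.closure s) =
      Algebra.adjoin k ((fun m => monomial m (1 : k)) '' s) := by
  apply le_antisymm
  · intro f hf
    rw [as_sum f]
    refine Subalgebra.sum_mem _ fun m hm => ?_
    have hmem := hf m (mem_support_iff.1 hm)
    have h1 : monomial m (1 : k) ∈ Algebra.adjoin k ((fun m => monomial m (1 : k)) '' s) := by
      clear hm
      induction hmem using AddSubmonoid.closure_induction with
      | mem m h => exact Algebra.subset_adjoin ⟨m, h, rfl⟩
      | zero => exact one_mem _
      | add a b _ _ ha hb =>
        rw [show monomial (a + b) (1 : k) = monomial a 1 * monomial b 1 by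
          rw [monomial_mul, one_mul]]
        exact mul_mem ha hb
    rw [← mul_one (coeff m f), ← C_mul_monomial]
    exact mul_mem (Subalgebra.algebraMap_mem _ _) h1
  · rw [Algebra.adjoin_le_iff]
    rintro _ ⟨m, hm, rfl⟩
    exact monomial_mem_monomialRing (AddSubmonoid.subset_closure hm) 1

/-- The inclusion into the subalgebra generated by stable sets is the decomposition
`closure_range_genExp`. -/
theorem monomialRing_cliqueMonoid (k : Type*) [Field k] : monomialRing k (cliqueMonoid r) =
    Algebra.adjoin k {f | ∃ S, IsStable S ∧ f = monomial (setExp S) 1} := by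
  apply le_antisymm
  · rw [← closure_range_genExp, monomialRing_closure]
    refine Algebra.adjoin_mono ?_
    rintro _ ⟨_, ⟨g, rfl⟩, rfl⟩
    obtain ⟨S, hS, h⟩ := exists_setExp_eq_genExp g
    exact ⟨S, hS, by rw [h]⟩
  · rw [Algebra.adjoin_le_iff]
    rintro _ ⟨S, hS, rfl⟩
    exact monomial_mem_monomialRing (setExp_mem hS) 1

theorem monomial_setExp (k : Type*) [Field k] (S : Finset (Cell r ⊕ Cell r)) :
    monomial (setExp S) (1 : k) = X none * ∏ c ∈ S, X (some c) := by
  rw [setExp, show monomial (Finsupp.single none 1 + ∑ c ∈ S, Finsupp.single (some c) 1) (1 : k) =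
    monomial (Finsupp.single none 1) 1 * monomial (∑ c ∈ S, Finsupp.single (some c) 1) 1 by
    rw [monomial_mul, one_mul], monomial_sum_one]
  rfl

end StableSets

end StabFamily

namespace StabFamily

open MvPolynomial

section Transport

variable {σ τ : Type*} {k : Type*} [Field k]

theorem monomialRing_map_rename (e : σ ≃ τ) (M : AddSubmonoid (σ →₀ ℕ)) :
    (monomialRing k M).map (rename e) =
      monomialRing k (M.map (Finsupp.domCongr e).toAddMonoidHom) := by
  ext f
  constructor
  · rintro ⟨g, hg, rfl⟩ m hm
    obtain ⟨u, rfl, hu⟩ := coeff_rename_ne_zero _ _ _ hm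
    exact ⟨u, hg u hu, by simp [Finsupp.equivMapDomain_eq_mapDomain]⟩
  · intro hf
    refine ⟨rename e.symm f, fun m hm => ?_, ?_⟩
    · obtain ⟨u, rfl, hu⟩ := coeff_rename_ne_zero _ _ _ hm
      obtain ⟨w, hw, rfl⟩ := hf u hu
      convert hw
      simp [Finsupp.equivMapDomain_eq_mapDomain, ← Finsupp.mapDomain_comp]
    · change rename e (rename e.symm f) = f
      rw [rename_rename, Equiv.self_comp_symm, rename_id_apply]

theorem IsFacetSystem.map {M : AddSubmonoid (σ →₀ ℕ)} {Φ : Type*} {F : Φ → ((σ →₀ ℕ) →+ ℤ)}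
    (hF : IsFacetSystem M F) (e : (σ →₀ ℕ) ≃+ (τ →₀ ℕ)) (he : ∀ a b, e.symm a ≤ e.symm b → a ≤ b) :
    IsFacetSystem (M.map e.toAddMonoidHom) fun φ => (F φ).comp e.symm.toAddMonoidHom where
  mem_iff m := by
    rw [AddSubmonoid.mem_map_equiv, hF.mem_iff]
    rfl
  le_of_le a b h := he a b (hF.le_of_le _ _ h)
  exists_eq_one φ := by
    obtain ⟨u, hu, h⟩ := hF.exists_eq_one φ
    exact ⟨e u, ⟨u, hu, rfl⟩, by simpa using h⟩
  exists_eq_zero φ := by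
    obtain ⟨u, hu, h⟩ := hF.exists_eq_zero φ
    exact ⟨e u, ⟨u, hu, rfl⟩, by simpa using h⟩
  exists_pos := by
    obtain ⟨u, hu, h⟩ := hF.exists_pos
    exact ⟨e u, ⟨u, hu, rfl⟩, by simpa using h⟩

theorem exists_mem_map_sub_iff {M : AddSubmonoid (σ →₀ ℕ)} {Φ : Type*}
    {F : Φ → ((σ →₀ ℕ) →+ ℤ)} (e : (σ →₀ ℕ) ≃+ (τ →₀ ℕ)) (c : Φ → ℤ) :
    (∃ α ∈ M.map e.toAddMonoidHom, ∃ β ∈ M.map e.toAddMonoidHom, ∀ φ,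
      c φ = (F φ).comp e.symm.toAddMonoidHom α - (F φ).comp e.symm.toAddMonoidHom β) ↔
    ∃ α ∈ M, ∃ β ∈ M, ∀ φ, c φ = F φ α - F φ β := by
  constructor
  · rintro ⟨_, ⟨α, hα, rfl⟩, _, ⟨β, hβ, rfl⟩, hc⟩
    exact ⟨α, hα, β, hβ, fun φ => by simpa using hc φ⟩
  · rintro ⟨α, hα, β, hβ, hc⟩
    exact ⟨_, ⟨α, hα, rfl⟩, _, ⟨β, hβ, rfl⟩, fun φ => by simpa using hc φ⟩

theorem IsFacetSystem.exists_mem_sub_eq {M : AddSubmonoid (σ →₀ ℕ)} {Φ : Type*} [Finite Φ]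
    {F : Φ → ((σ →₀ ℕ) →+ ℤ)} (hF : IsFacetSystem M F) {c : Φ → ℤ} {α β : σ →₀ ℕ}
    (h : ∀ φ, c φ = F φ α - F φ β) : ∃ α ∈ M, ∃ β ∈ M, ∀ φ, c φ = F φ α - F φ β := by
  obtain ⟨s, hs, hpos⟩ := hF.exists_pos
  obtain ⟨N₁, c₁, hc₁, h₁⟩ := hF.exists_nsmul_eq_add hpos α
  obtain ⟨N₂, c₂, hc₂, h₂⟩ := hF.exists_nsmul_eq_add hpos β
  refine ⟨c₁ + c₂ + α, ?_, c₁ + c₂ + β, ?_, fun φ => ?_⟩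
  · rw [show c₁ + c₂ + α = (α + c₁) + c₂ by abel, ← h₁]
    exact add_mem (nsmul_mem hs _) hc₂
  · rw [show c₁ + c₂ + β = (β + c₂) + c₁ by abel, ← h₂]
    exact add_mem (nsmul_mem hs _) hc₁
  · rw [h φ, map_add _ (c₁ + c₂), map_add _ (c₁ + c₂), add_sub_add_left_eq_sub]

end Transport

/-! ### The facets of the clique monoid, and the group `ℤ^n`. -/

section CliqueFacets

variable {n : ℕ} {r : Fin n → ℕ}

variable (r) in
/-- The functionals which cut out the clique monoid. -/
noncomputable def cliqueFacet : (Cell r ⊕ Cell r) ⊕ Option (Fin n) → ((Var r →₀ ℕ) →+ ℤ)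
  | Sum.inl v => (Nat.castAddMonoidHom ℤ).comp (Finsupp.applyAddHom (some v))
  | Sum.inr none => (Nat.castAddMonoidHom ℤ).comp (deg r) -
      ∑ j, (Nat.castAddMonoidHom ℤ).comp (minusSum j)
  | Sum.inr (some i) => (Nat.castAddMonoidHom ℤ).comp (deg r) +
      (Nat.castAddMonoidHom ℤ).comp (minusSum i) - (Nat.castAddMonoidHom ℤ).comp (plusSum i) -
      ∑ j, (Nat.castAddMonoidHom ℤ).comp (minusSum j)

theorem cliqueFacet_inl (v : Cell r ⊕ Cell r) (m : Var r →₀ ℕ) :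
    cliqueFacet r (Sum.inl v) m = m (some v) := rfl

theorem cliqueFacet_none (m : Var r →₀ ℕ) :
    cliqueFacet r (Sum.inr none) m = deg r m - ∑ j, (minusSum j m : ℤ) := by
  simp [cliqueFacet]

theorem cliqueFacet_some (i : Fin n) (m : Var r →₀ ℕ) :
    cliqueFacet r (Sum.inr (some i)) m =
      deg r m + minusSum i m - plusSum i m - ∑ j, (minusSum j m : ℤ) := by
  simp [cliqueFacet]

variable (r) in
/-- The exponent with prescribed values in each block. -/
noncomputable def blockExp (D : ℕ) (p q : Fin n → ℕ) : Var r →₀ ℕ :=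
  Finsupp.equivFunOnFinite.symm fun v => v.elim D (Sum.elim (fun c => p c.1) (fun c => q c.1))

@[simp] theorem deg_blockExp (D : ℕ) (p q : Fin n → ℕ) : deg r (blockExp r D p q) = D := rfl

@[simp] theorem blockExp_inl (D : ℕ) (p q : Fin n → ℕ) (c : Cell r) :
    blockExp r D p q (some (Sum.inl c)) = p c.1 := rfl

@[simp] theorem blockExp_inr (D : ℕ) (p q : Fin n → ℕ) (c : Cell r) :
    blockExp r D p q (some (Sum.inr c)) = q c.1 := rfl

@[simp] theorem plusSum_blockExp (D : ℕ) (p q : Fin n → ℕ) (i : Fin n) :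
    plusSum i (blockExp r D p q) = r i * p i := by simp [plusSum_apply]

@[simp] theorem minusSum_blockExp (D : ℕ) (p q : Fin n → ℕ) (i : Fin n) :
    minusSum i (blockExp r D p q) = r i * q i := by simp [minusSum_apply]

theorem mem_cliqueMonoid_iff_cliqueFacet (m : Var r →₀ ℕ) :
    m ∈ cliqueMonoid r ↔ ∀ φ, 0 ≤ cliqueFacet r φ m := by
  rw [mem_cliqueMonoid, Sum.forall, Option.forall]
  simp only [cliqueFacet_inl, cliqueFacet_none, cliqueFacet_some]
  constructor
  · rintro ⟨h1, h2⟩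
    refine ⟨fun _ => Int.natCast_nonneg _, ?_, fun i => ?_⟩
    · rw [← Nat.cast_sum]; omega
    · have := h2 i
      rw [← Nat.cast_sum]; omega
  · rintro ⟨-, h1, h2⟩
    rw [← Nat.cast_sum] at h1 h2
    refine ⟨by omega, fun i => ?_⟩
    have := h2 i
    omega

theorem isStable_empty : IsStable (r := r) ∅ := fun u hu => absurd hu (Finset.notMem_empty u)

theorem isStable_singleton (v : Cell r ⊕ Cell r) : IsStable {v} := by
  intro u hu w hw
  rw [Finset.mem_singleton.1 hu, Finset.mem_singleton.1 hw]
  exact (graph r).irrefl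

theorem isFacetSystem_cliqueFacet (hr : ∀ i, 0 < r i) :
    IsFacetSystem (cliqueMonoid r) (cliqueFacet r) where
  mem_iff := mem_cliqueMonoid_iff_cliqueFacet
  le_of_le a b h := by
    have h1 : ∀ v, a (some v) ≤ b (some v) := fun v => by
      have := h (Sum.inl v)
      simpa only [cliqueFacet_inl, Nat.cast_le] using this
    intro v
    rcases v with _ | v
    · have h2 := h (Sum.inr none)
      rw [cliqueFacet_none, cliqueFacet_none, ← Nat.cast_sum, ← Nat.cast_sum] at h2
      have h3 : ∑ j, minusSum j a ≤ ∑ j, minusSum j b :=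
        Finset.sum_le_sum fun j _ => by
          rw [minusSum_apply, minusSum_apply]
          exact Finset.sum_le_sum fun c _ => h1 _
      rw [deg_apply, deg_apply] at h2
      omega
    · exact h1 v
  exists_eq_one φ := by
    classical
    rcases φ with v | _ | i
    · refine ⟨_, setExp_mem (isStable_singleton v), ?_⟩
      simp [cliqueFacet_inl, setExp_some]
    · refine ⟨_, setExp_mem isStable_empty, ?_⟩
      simp [cliqueFacet_none, setExp]
    · refine ⟨_, setExp_mem isStable_empty, ?_⟩
      simp [cliqueFacet_some, setExp]
  exists_eq_zero φ := by
    classical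
    suffices h : ∃ s, cliqueFacet r φ s = 0 ∧ ∀ ψ, ψ ≠ φ → 0 < cliqueFacet r ψ s by
      obtain ⟨s, h1, h2⟩ := h
      refine ⟨s, (mem_cliqueMonoid_iff_cliqueFacet s).2 fun ψ => ?_, h1, h2⟩
      by_cases hψ : ψ = φ
      · rw [hψ, h1]
      · exact (h2 ψ hψ).le
    rcases φ with v | _ | i
    -- The facet `x_v = 0`: all other coordinates are `1`, and the degree is large enough for every
    -- clique inequality to be strict.
    · set m := (blockExp r (2 * dim r + 1) 1 1).erase (some v) with hm
      have hle : m ≤ blockExp r (2 * dim r + 1) 1 1 := fun w => by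
        rw [hm, Finsupp.erase_apply]
        split_ifs
        · exact Nat.zero_le _
        · exact le_rfl
      have hmin : ∀ i, minusSum i m ≤ r i := fun i =>
        by
        have : minusSum i m ≤ minusSum i (blockExp r (2 * dim r + 1) 1 1) := by
          rw [minusSum_apply, minusSum_apply]
          exact Finset.sum_le_sum fun c _ => hle _
        simpa using this
      have hplus : ∀ i, plusSum i m ≤ r i := fun i =>
        by
        have : plusSum i m ≤ plusSum i (blockExp r (2 * dim r + 1) 1 1) := by
          rw [plusSum_apply, plusSum_apply]
          exact Finset.sum_le_sum fun c _ => hle _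
        simpa using this
      have hsum : ∑ i, minusSum i m ≤ dim r := Finset.sum_le_sum fun i _ => hmin i
      have hdeg : deg r m = 2 * dim r + 1 := by
        rw [deg_apply, hm, Finsupp.erase_ne (by simp)]; rfl
      refine ⟨m, by rw [cliqueFacet_inl, hm]; simp, ?_⟩
      rintro (w | _ | i) hw
      · rw [cliqueFacet_inl, hm, Finsupp.erase_ne (by rintro h; exact hw (by rw [Option.some.inj h]))]
        rcases w with c | c <;> simp
      · rw [cliqueFacet_none, ← Nat.cast_sum]; omega
      · have h1 := hplus i
        have h2 : r i ≤ dim r := Finset.single_le_sum (fun _ _ => Nat.zero_le _) (Finset.mem_univ i)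
        rw [cliqueFacet_some, ← Nat.cast_sum]; omega
    -- The facet of `Q_0`: with minus coordinates `2` and plus coordinates `1`, its value is `0` and
    -- that of `Q_i` is `r i`.
    · refine ⟨blockExp r (∑ i, r i * 2) 1 2, by simp [cliqueFacet_none], ?_⟩
      rintro (⟨c | c⟩ | _ | i) hw
      · simp [cliqueFacet_inl]
      · simp [cliqueFacet_inl]
      · exact absurd rfl hw
      · have := hr i
        simp [cliqueFacet_some]
        omega
    -- The facet of `Q_i`: doubling the plus coordinates of block `i` uses up the excess degree `r
    -- i`, which is left over in all other clique inequalities.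
    · refine ⟨blockExp r (dim r + r i) (Function.update 1 i 2) 1, ?_, ?_⟩
      · simp [cliqueFacet_some, dim]
        ring
      · have := hr i
        rintro (⟨c | c⟩ | _ | j) hw
        · simp only [cliqueFacet_inl, blockExp_inl, Function.update_apply]
          split_ifs <;> simp
        · simp [cliqueFacet_inl]
        · simp [cliqueFacet_none, dim]
          omega
        · have hij : j ≠ i := fun h => hw (by rw [h])
          simp [cliqueFacet_some, dim, Function.update_of_ne hij]
          omega
  exists_pos := by
    refine ⟨blockExp r (2 * dim r + 1) 1 1, ?_⟩
    have h : ∀ φ, 0 < cliqueFacet r φ (blockExp r (2 * dim r + 1) 1 1) := by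
      rintro (⟨c | c⟩ | _ | i)
      · simp [cliqueFacet_inl]
      · simp [cliqueFacet_inl]
      · simp only [cliqueFacet_none, deg_blockExp, minusSum_blockExp, Pi.one_apply, mul_one]
        rw [← Nat.cast_sum]
        unfold dim
        omega
      · have h2 : r i ≤ dim r := Finset.single_le_sum (fun _ _ => Nat.zero_le _) (Finset.mem_univ i)
        simp only [cliqueFacet_some, deg_blockExp, minusSum_blockExp, plusSum_blockExp,
          Pi.one_apply, mul_one]
        rw [← Nat.cast_sum]
        unfold dim at *
        omega
    exact ⟨(mem_cliqueMonoid_iff_cliqueFacet _).2 fun φ => (h φ).le, h⟩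

variable (r) in
/-- The map which identifies the divisor class group. -/
def classMap : ((Cell r ⊕ Cell r) ⊕ Option (Fin n) → ℤ) →+ (Fin n → ℤ) where
  -- The functional of `Q_i` minus that of `Q_0` equals `minusSum i - plusSum i`. These `n`
  -- identities are the relations among the facet functionals.
  toFun c i := c (Sum.inr (some i)) - c (Sum.inr none) - ∑ a, c (Sum.inl (Sum.inr ⟨i, a⟩)) +
    ∑ a, c (Sum.inl (Sum.inl ⟨i, a⟩))
  map_zero' := by ext i; simp
  map_add' c d := by
    ext i
    simp only [Pi.add_apply, Finset.sum_add_distrib]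
    ring

theorem classMap_surjective : Function.Surjective (classMap r) := fun z =>
  ⟨Sum.elim 0 (fun o => o.elim 0 z), by ext i; simp [classMap]⟩

theorem classMap_eq_zero_iff (hr : ∀ i, 0 < r i) (c : (Cell r ⊕ Cell r) ⊕ Option (Fin n) → ℤ) :
    classMap r c = 0 ↔ ∃ α ∈ cliqueMonoid r, ∃ β ∈ cliqueMonoid r,
      ∀ φ, c φ = cliqueFacet r φ α - cliqueFacet r φ β := by
  constructor
  · intro h
    -- An integer exponent read off from `c`: the coordinate functionals give its entries, and the
    -- functional of `Q_0` gives its degree. Its positive and negative parts are then moved into the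
    -- monoid by `exists_mem_sub_eq`.
    let x : Var r → ℤ := fun v => v.elim
      (c (Sum.inr none) + ∑ j, ∑ a, c (Sum.inl (Sum.inr ⟨j, a⟩))) fun v => c (Sum.inl v)
    refine (isFacetSystem_cliqueFacet hr).exists_mem_sub_eq
      (α := Finsupp.equivFunOnFinite.symm fun v => (x v).toNat)
      (β := Finsupp.equivFunOnFinite.symm fun v => (-x v).toNat) ?_
    set α : Var r →₀ ℕ := Finsupp.equivFunOnFinite.symm fun v => (x v).toNat with hα
    set β : Var r →₀ ℕ := Finsupp.equivFunOnFinite.symm fun v => (-x v).toNat with hβ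
    have h0 : ∀ v, (α v : ℤ) - β v = x v := fun v => by
      simp only [hα, hβ, Finsupp.equivFunOnFinite_symm_apply_apply]
      omega
    have hm : ∀ j, (minusSum j α : ℤ) - minusSum j β = ∑ a, c (Sum.inl (Sum.inr ⟨j, a⟩)) := by
      intro j
      rw [minusSum_apply, minusSum_apply, Nat.cast_sum, Nat.cast_sum, ← Finset.sum_sub_distrib]
      exact Finset.sum_congr rfl fun a _ => h0 _
    have hp : ∀ j, (plusSum j α : ℤ) - plusSum j β = ∑ a, c (Sum.inl (Sum.inl ⟨j, a⟩)) := by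
      intro j
      rw [plusSum_apply, plusSum_apply, Nat.cast_sum, Nat.cast_sum, ← Finset.sum_sub_distrib]
      exact Finset.sum_congr rfl fun a _ => h0 _
    have hms : (∑ j, (minusSum j α : ℤ)) - ∑ j, (minusSum j β : ℤ) =
        ∑ j, ∑ a, c (Sum.inl (Sum.inr ⟨j, a⟩)) := by
      rw [← Finset.sum_sub_distrib]
      exact Finset.sum_congr rfl fun j _ => hm j
    have hd : (deg r α : ℤ) - deg r β =
      c (Sum.inr none) + ∑ j, ∑ a, c (Sum.inl (Sum.inr ⟨j, a⟩)) := h0 none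
    rintro (v | _ | i)
    · exact (h0 (some v)).symm
    · rw [cliqueFacet_none, cliqueFacet_none]
      linarith
    · have h1 := congrFun h i
      change c (Sum.inr (some i)) - c (Sum.inr none) - ∑ a, c (Sum.inl (Sum.inr ⟨i, a⟩)) +
        ∑ a, c (Sum.inl (Sum.inl ⟨i, a⟩)) = 0 at h1
      have h2 := hm i
      have h3 := hp i
      rw [cliqueFacet_some, cliqueFacet_some]
      linarith
  · rintro ⟨α, -, β, -, h⟩
    ext i
    change c (Sum.inr (some i)) - c (Sum.inr none) - ∑ a, c (Sum.inl (Sum.inr ⟨i, a⟩)) +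
        ∑ a, c (Sum.inl (Sum.inl ⟨i, a⟩)) = 0
    simp only [h, cliqueFacet_inl, cliqueFacet_none, cliqueFacet_some, Finset.sum_sub_distrib,
      plusSum_apply, minusSum_apply, Nat.cast_sum]
    ring

end CliqueFacets

section StableSetRing

variable {n : ℕ} {r : Fin n → ℕ}

theorem stableSetRing_eq_map (k : Type*) [Field k] : stableSetRing k (graph r) =
    (monomialRing k (cliqueMonoid r)).map (rename (Equiv.optionCongr (vtx r))) := by
  rw [monomialRing_cliqueMonoid, AlgHom.map_adjoin, stableSetRing]
  congr 1
  ext f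
  constructor
  · rintro ⟨S, hS, rfl⟩
    refine ⟨_, ⟨S.map (vtx r).symm.toEmbedding, ?_, rfl⟩, ?_⟩
    · intro u hu v hv hadj
      obtain ⟨u, hu', rfl⟩ := Finset.mem_map.1 hu
      obtain ⟨v, hv', rfl⟩ := Finset.mem_map.1 hv
      simp only [Equiv.coe_toEmbedding, Equiv.apply_symm_apply] at hadj
      exact hS hu' hv' hadj.ne hadj
    · rw [monomial_setExp]
      simp
  · rintro ⟨_, ⟨S, hS, rfl⟩, rfl⟩
    refine ⟨S.map (vtx r).toEmbedding, ?_, ?_⟩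
    · intro u hu v hv _ hadj
      obtain ⟨u, hu', rfl⟩ := Finset.mem_map.1 hu
      obtain ⟨v, hv', rfl⟩ := Finset.mem_map.1 hv
      exact hS u hu' v hv' hadj
    · rw [monomial_setExp]
      simp

theorem isGorenstein_stableSetRing (k : Type*) [Field k] [CharZero k] :
    IsGorenstein (stableSetRing k (graph r)) := by
  refine isGorenstein_of_equiv_monomialRing r k _ (RingEquiv.trans ?_
    (Subalgebra.equivOfEq _ _ (stableSetRing_eq_map k).symm).toRingEquiv)
  exact ((monomialRing k (cliqueMonoid r)).equivMapOfInjective _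
    (rename_injective _ (Equiv.injective _))).toRingEquiv

theorem nonempty_divisorClassGroup_stableSetRing_equiv (hr : ∀ i, 0 < r i) (k : Type*) [Field k] :
    Nonempty (DivisorClassGroup (stableSetRing k (graph r)) ≃+ (Fin n → ℤ)) := by
  have hN : IsNoetherianRing (stableSetRing k (graph r)) := inferInstance
  have h : stableSetRing k (graph r) = monomialRing k ((cliqueMonoid r).map
      (Finsupp.domCongr (Equiv.optionCongr (vtx r))).toAddMonoidHom) := by
    rw [stableSetRing_eq_map, monomialRing_map_rename]
  -- Quantifying over the subalgebra and its Noetherian instance allows the equality `h` to be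
  -- substituted inside the type of the class group.
  have key : ∀ (A : Subalgebra k (MvPolynomial (Option (Fin (2 * dim r))) k)) [IsNoetherianRing A],
      A = monomialRing k ((cliqueMonoid r).map
        (Finsupp.domCongr (Equiv.optionCongr (vtx r))).toAddMonoidHom) →
      Nonempty (DivisorClassGroup A ≃+ (Fin n → ℤ)) := by
    rintro A _ rfl
    refine ((isFacetSystem_cliqueFacet hr).map (Finsupp.domCongr (Equiv.optionCongr (vtx r)))
      fun a b hab v => ?_).nonempty_divisorClassGroup_equiv (classMap r) classMap_surjective
      fun c => ?_
    · have := hab ((Equiv.optionCongr (vtx r)).symm v)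
      simpa using this
    · rw [classMap_eq_zero_iff hr, exists_mem_map_sub_iff]
  exact key _ h

end StableSetRing

end StabFamily

namespace StabFamily

/-! ### The polytope `C(G)`. -/

section ConicBox

variable {n : ℕ} {r : Fin n → ℕ}

theorem sumOver_eq (z : Fin n → ℝ) (L : Multiset (Fin (n + 1))) :
    sumOver z L = ∑ i, (L.count i.succ : ℝ) * z i := by
  rw [sumOver, Finset.sum_multiset_map_count, Finset.sum_subset (Finset.subset_univ _) (fun x _ hx => by
    rw [Multiset.count_eq_zero_of_notMem (by simpa using hx), zero_smul]), Fin.sum_univ_succ]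
  simp

theorem countP_inl (c : Cell r) (L : Multiset (Fin (n + 1))) :
    L.countP (fun l => vtx r (Sum.inl c) ∈ Q r l) = L.count c.1.succ := by
  rw [Multiset.count]
  refine Multiset.countP_congr rfl fun l _ => ?_
  induction l using Fin.cases with
  | zero => simp
  | succ i => simp

theorem countP_inr (c : Cell r) (L : Multiset (Fin (n + 1))) :
    L.countP (fun l => vtx r (Sum.inr c) ∈ Q r l) + L.count c.1.succ = L.card := by
  rw [Multiset.count, Multiset.card_eq_countP_add_countP (fun l => vtx r (Sum.inr c) ∈ Q r l) L]
  congr 1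
  refine Multiset.countP_congr rfl fun l _ => ?_
  induction l using Fin.cases with
  | zero => simp
  | succ i => simp

theorem mIJ_inl (I J : Multiset (Fin (n + 1))) (c : Cell r) :
    mIJ (Q r) I J (vtx r (Sum.inl c)) = (I.count c.1.succ : ℤ) - J.count c.1.succ := by
  rw [mIJ, countP_inl, countP_inl]

theorem mIJ_inr {I J : Multiset (Fin (n + 1))} (h : I.card = J.card) (c : Cell r) :
    mIJ (Q r) I J (vtx r (Sum.inr c)) = -((I.count c.1.succ : ℤ) - J.count c.1.succ) := by
  have h1 := countP_inr c I
  have h2 := countP_inr c J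
  rw [mIJ]
  omega

theorem sum_vtx (f : Fin (2 * dim r) → ℝ) (g h : Fin n → ℝ)
    (hg : ∀ c, f (vtx r (Sum.inl c)) = g c.1) (hh : ∀ c, f (vtx r (Sum.inr c)) = h c.1) :
    ∑ v, f v = ∑ i, (r i : ℝ) * (g i + h i) := by
  rw [← (vtx r).sum_comp, Fintype.sum_sum_type]
  simp only [hg, hh]
  rw [← Finset.univ_sigma_univ, Finset.sum_sigma, Finset.sum_sigma, ← Finset.sum_add_distrib]
  refine Finset.sum_congr rfl fun i _ => ?_
  simp only [Finset.sum_const, Finset.card_univ, Fintype.card_fin, nsmul_eq_mul]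
  ring

/-- The values at `(i, a)^+` and `(i, a)^-` are opposite, so each of the `r i` pairs contributes the
absolute value exactly once. -/
theorem sum_mIJ_pos {I J : Multiset (Fin (n + 1))} (h : I.card = J.card) :
    (∑ v with 0 < mIJ (Q r) I J v, (mIJ (Q r) I J v : ℝ)) =
      ∑ i, (r i : ℝ) * |(I.count i.succ : ℝ) - J.count i.succ| := by
  rw [Finset.sum_filter, sum_vtx _ (fun i => max ((I.count i.succ : ℝ) - J.count i.succ) 0)
    (fun i => max (-((I.count i.succ : ℝ) - J.count i.succ)) 0) (fun c => ?_) (fun c => ?_)]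
  · refine Finset.sum_congr rfl fun i _ => ?_
    rw [max_zero_add_max_neg_zero_eq_abs_self]
  · rw [mIJ_inl, max_comm, max_def_lt]
    push_cast
    congr 1
    rw [← @Int.cast_pos ℝ]
    push_cast
    rfl
  · rw [mIJ_inr h, max_comm, max_def_lt]
    push_cast
    congr 1
    rw [← @Int.cast_pos ℝ]
    push_cast
    rfl

theorem sum_mIJ_neg {I J : Multiset (Fin (n + 1))} (h : I.card = J.card) :
    (∑ v with mIJ (Q r) I J v < 0, (mIJ (Q r) I J v : ℝ)) =
      -∑ i, (r i : ℝ) * |(I.count i.succ : ℝ) - J.count i.succ| := by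
  have hneg : ∀ v, mIJ (Q r) J I v = -mIJ (Q r) I J v := fun v => by rw [mIJ, mIJ]; ring
  have h1 := sum_mIJ_pos (r := r) h.symm
  simp only [hneg, Left.neg_pos_iff, Int.cast_neg, Finset.sum_neg_distrib] at h1
  rw [← neg_eq_iff_eq_neg, h1]
  exact Finset.sum_congr rfl fun i _ => by rw [abs_sub_comm]

/-- The conic polytope is a box. -/
theorem conicPolytope_eq_box : conicPolytope (Q r) =
    {z : Fin n → ℝ | ∀ i, -(r i : ℝ) ≤ z i ∧ z i ≤ (r i : ℝ)} := by
  ext z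
  constructor
  · intro hz i
    have hd : Disjoint ({i.succ} : Multiset (Fin (n + 1))) {0} := by
      simpa using (Fin.succ_ne_zero i).symm
    -- For this pair the bounds are exactly `-r i` and `r i`, as `|I| = 1` cancels the constant `1`.
    have h := hz {i.succ} {0} rfl hd (Multiset.singleton_ne_zero _)
    have hs : ∑ j, (r j : ℝ) * |((({i.succ} : Multiset (Fin (n + 1))).count j.succ : ℕ) : ℝ) -
        (({0} : Multiset (Fin (n + 1))).count j.succ : ℕ)| = r i := by
      rw [Finset.sum_eq_single i]
      · simp
      · intro j _ hj
        simp [hj]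
      · simp
    have hcard : ({i.succ} : Multiset (Fin (n + 1))).card = ({0} : Multiset (Fin (n + 1))).card := rfl
    rw [sum_mIJ_pos hcard, sum_mIJ_neg hcard, hs] at h
    simp [sumOver] at h
    exact h
  · intro hz I J hc hd hI
    rw [sum_mIJ_pos hc, sum_mIJ_neg hc, sumOver_eq, sumOver_eq, ← Finset.sum_sub_distrib, ← hc]
    have h1 : |∑ i, ((I.count i.succ : ℝ) * z i - (J.count i.succ : ℝ) * z i)| ≤
        ∑ i, (r i : ℝ) * |(I.count i.succ : ℝ) - J.count i.succ| := by
      refine (Finset.abs_sum_le_sum_abs _ _).trans (Finset.sum_le_sum fun i _ => ?_)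
      rw [← sub_mul, abs_mul, mul_comm]
      exact mul_le_mul_of_nonneg_right (abs_le.2 (hz i)) (abs_nonneg _)
    -- The cardinality term only weakens the inequality given by the triangle inequality.
    have h2 : (1 : ℝ) ≤ I.card := by
      exact_mod_cast Multiset.card_pos.2 hI
    rw [abs_le] at h1
    constructor <;> linarith

end ConicBox

end StabFamily

namespace StabFamily

/-! ### Chords, chain polytopes and the 3-sun. -/

section GenericGraphs

variable {V : Type*} {G : SimpleGraph V}

/-- A simplicial vertex of a long cycle gives rise to a chord. -/
theorem exists_chord_of_isCycle {u : V} {c : G.Walk u u} (hc : c.IsCycle) (h4 : 4 ≤ c.length)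
    {w : V} (hw : w ∈ c.support)
    (hadj : ∀ x ∈ c.support, ∀ y ∈ c.support, G.Adj w x → G.Adj w y → x ≠ y → G.Adj x y) :
    ∃ x ∈ c.support, ∃ y ∈ c.support, G.Adj x y ∧ s(x, y) ∉ c.edges := by
  classical
  -- With the cycle starting at `w`, the chord joins the second and the last vertex before the
  -- return to `w`; they are not consecutive as the length is at least `4`.
  set p := c.rotate w hw with hp
  have hpc : p.IsCycle := hc.rotate hw
  have hlen : p.length = c.length := c.length_rotate w hw
  have hsupp : ∀ i, p.getVert i ∈ c.support := fun i =>
    (c.mem_support_rotate_iff w hw).1 (p.getVert_mem_support i)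
  have hinj : ∀ i j, i < p.length → j < p.length → p.getVert i = p.getVert j → i = j :=
    fun i j hi hj h => hpc.getVert_injOn' (show i ≤ p.length - 1 by omega)
      (show j ≤ p.length - 1 by omega) h
  have h0 : p.getVert 0 = w := p.getVert_zero
  have hL : p.getVert p.length = w := p.getVert_length
  refine ⟨p.getVert 1, hsupp 1, p.getVert (p.length - 1), hsupp _,
    hadj _ (hsupp _) _ (hsupp _) ?_ ?_ ?_, ?_⟩
  · have := p.adj_getVert_succ (i := 0) (by omega)
    rwa [h0] at this
  · have := (p.adj_getVert_succ (i := p.length - 1) (by omega)).symm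
    rwa [show p.length - 1 + 1 = p.length by omega, hL] at this
  · intro h
    have := hinj _ _ (by omega) (by omega) h
    omega
  · rw [← (c.rotate_edges w hw).mem_iff, ← hp, SimpleGraph.Walk.mk_mem_edges_iff_exists]
    rintro ⟨i, hi, h⟩
    have hsucc : ∃ j < p.length, p.getVert (i + 1) = p.getVert j ∧ (j = i + 1 ∨ j = 0) := by
      by_cases hi' : i + 1 < p.length
      · exact ⟨i + 1, hi', rfl, Or.inl rfl⟩
      · exact ⟨0, by omega, by rw [show i + 1 = p.length by omega, hL, h0], Or.inr rfl⟩
    obtain ⟨j, hj, hij, hj'⟩ := hsucc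
    rw [hij, Sym2.eq_iff] at h
    rcases h with ⟨h1, h2⟩ | ⟨h1, h2⟩
    · have e1 := hinj _ _ hi (by omega) h1
      have e2 := hinj _ _ hj (by omega) h2
      omega
    · have e1 := hinj _ _ hi (by omega) h1
      have e2 := hinj _ _ hj (by omega) h2
      omega

theorem sum_le_one_of_mem_stabPolytope {u v : V} (huv : G.Adj u v) {x : V → ℝ}
    (hx : x ∈ stabPolytope G) : x u + x v ≤ 1 := by
  have hconv : Convex ℝ {x : V → ℝ | x u + x v ≤ 1} := by
    intro x hx y hy a b ha hb hab
    simp only [Set.mem_ofPred_eq, Pi.add_apply, Pi.smul_apply, smul_eq_mul] at *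
    nlinarith
  refine convexHull_min ?_ hconv hx
  rintro _ ⟨S, hS, rfl⟩
  classical
  by_cases hu : u ∈ S
  · have hv : v ∉ S := fun hv => hS hu hv huv.ne huv
    simp [hu, hv]
  · simp only [Set.mem_ofPred_eq, Set.indicator_of_notMem hu, zero_add]
    rw [Set.indicator_apply]
    split_ifs <;> simp

/-- A graph whose stable set polytope is a chain polytope is a comparability graph. -/
theorem isComparabilityGraph_of_stabPolytope_eq {P : PartialOrder V}
    (h : stabPolytope G = chainPolytope P) : IsComparabilityGraph G := by
  classical
  refine ⟨P, fun u v => ⟨fun huv => ⟨huv.ne, ?_⟩, ?_⟩⟩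
  · by_contra hcomp
    -- A chain cannot contain two incomparable elements, whereas adjacency forbids this indicator
    -- vector in the stable set polytope.
    have hmem : (({u, v} : Set V).indicator 1 : V → ℝ) ∈ chainPolytope P := by
      refine ⟨fun w => Set.indicator_nonneg (fun _ _ => zero_le_one) w, fun C hC => ?_⟩
      rw [Finset.sum_indicator_eq_sum_filter]
      simp only [Pi.one_apply, Finset.sum_const, nsmul_eq_mul, mul_one]
      rw [Nat.cast_le_one, Finset.card_le_one]
      have key : ¬ (u ∈ C ∧ v ∈ C) := fun ⟨hu, hv⟩ => hcomp (hC hu hv huv.ne)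
      intro a ha b hb
      rw [Finset.mem_filter] at ha hb
      obtain ⟨haC, rfl | rfl⟩ := ha <;> obtain ⟨hbC, rfl | rfl⟩ := hb
      · rfl
      · exact absurd ⟨haC, hbC⟩ key
      · exact absurd ⟨hbC, haC⟩ key
      · rfl
    rw [← h] at hmem
    have := sum_le_one_of_mem_stabPolytope huv hmem
    simp at this
    linarith
  · rintro ⟨hne, hle⟩
    by_contra hadj
    have hmem : (({u, v} : Set V).indicator 1 : V → ℝ) ∈ stabPolytope G := by
      refine subset_convexHull ℝ _ ⟨{u, v}, ?_, rfl⟩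
      rintro a (rfl | rfl) b (rfl | rfl) hab
      · exact absurd rfl hab
      · exact hadj
      · exact fun h => hadj h.symm
      · exact absurd rfl hab
    rw [h] at hmem
    have := hmem.2 {u, v} (by
      intro a ha b hb hab
      simp only [Finset.coe_insert, Finset.coe_singleton, Set.mem_insert_iff,
        Set.mem_singleton_iff] at ha hb
      rcases ha with rfl | rfl <;> rcases hb with rfl | rfl
      · exact absurd rfl hab
      · exact hle
      · exact hle.symm
      · exact absurd rfl hab)
    rw [Finset.sum_pair hne] at this
    simp at this
    linarith

/-- The `3`-sun is not an induced subgraph of a comparability graph. -/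
theorem not_isComparabilityGraph_of_sun {a b c x y z : V} (hab : G.Adj a b) (hbc : G.Adj b c)
    (hac : G.Adj a c) (hxb : G.Adj x b) (hxc : G.Adj x c) (hya : G.Adj y a) (hyc : G.Adj y c)
    (hza : G.Adj z a) (hzb : G.Adj z b) (hxa : ¬ G.Adj x a) (hyb : ¬ G.Adj y b)
    (hzc : ¬ G.Adj z c) (hxy : ¬ G.Adj x y) (hyz : ¬ G.Adj y z) (hxz : ¬ G.Adj x z)
    (nxa : x ≠ a) (nyb : y ≠ b) (nzc : z ≠ c) (nxy : x ≠ y) (nyz : y ≠ z) (nxz : x ≠ z) :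
    ¬ IsComparabilityGraph G := by
  rintro ⟨P, hP⟩
  -- Two nonadjacent neighbours of `q` are both above or both below it, by transitivity. Passing
  -- through the tips of the sun, this shows that each vertex of the central triangle is above both
  -- others or below both, but three pairwise comparable elements have a middle one.
  have key : ∀ p q s, G.Adj p q → G.Adj s q → ¬ G.Adj p s → p ≠ s → (P.le p q ↔ P.le s q) := by
    have aux : ∀ p q s, G.Adj s q → ¬ G.Adj p s → p ≠ s → P.le p q → P.le s q := by
      intro p q s hsq hps hne hle
      rcases ((hP s q).1 hsq).2 with h | h
      · exact h
      · exact absurd ((hP p s).2 ⟨hne, Or.inl (P.le_trans _ _ _ hle h)⟩) hps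
    exact fun p q s hpq hsq hps hne => ⟨aux p q s hsq hps hne,
      aux s q p hpq (fun h => hps h.symm) hne.symm⟩
  have e1 := (key a b x hab hxb (fun h => hxa h.symm) nxa.symm).trans
    ((key x b z hxb hzb hxz nxz).trans (key z b c hzb hbc.symm hzc nzc))
  have e2 := (key a c x hac hxc (fun h => hxa h.symm) nxa.symm).trans
    ((key x c y hxc hyc hxy nxy).trans (key y c b hyc hbc hyb nyb))
  have e3 := (key b a y hab.symm hya (fun h => hyb h.symm) nyb.symm).trans
    ((key y a z hya hza hyz nyz).trans (key z a c hza hac.symm hzc nzc))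
  have t1 := ((hP a b).1 hab).2
  have t2 := ((hP b c).1 hbc).2
  have t3 := ((hP a c).1 hac).2
  have s1 : P.le a b → ¬ P.le b a := fun h h' => hab.ne (P.le_antisymm _ _ h h')
  have s2 : P.le b c → ¬ P.le c b := fun h h' => hbc.ne (P.le_antisymm _ _ h h')
  have s3 : P.le a c → ¬ P.le c a := fun h h' => hac.ne (P.le_antisymm _ _ h h')
  rcases t1 with h | h
  · rcases t3 with h' | h'
    · exact s2 (e2.1 h') (e1.1 h)
    · exact s1 h (e3.2 h')
  · rcases t2 with h' | h'
    · exact s3 (e2.2 h') (e3.1 h)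
    · exact s1 (e1.2 h') h

end GenericGraphs

/-! ### Cliques, stable sets, chordality and perfection of the graph. -/

section FamilyGraph

variable {n : ℕ} {r : Fin n → ℕ}

theorem exists_vtx (v : Fin (2 * dim r)) :
    (∃ c, vtx r (Sum.inl c) = v) ∨ ∃ c, vtx r (Sum.inr c) = v := by
  obtain ⟨c | c, rfl⟩ := (vtx r).surjective v
  · exact Or.inl ⟨c, rfl⟩
  · exact Or.inr ⟨c, rfl⟩

theorem eq_of_Q_subset (hr : ∀ i, 0 < r i) {i j : Fin (n + 1)} (h : Q r i ⊆ Q r j) : i = j := by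
  induction i using Fin.cases with
  | zero =>
    induction j using Fin.cases with
    | zero => rfl
    | succ j =>
      have := h (vtx_inr_mem_Q_zero (c := ⟨j, 0, hr j⟩))
      simp at this
  | succ i =>
    have h1 := h (vtx_inl_mem_Q_succ.2 rfl : vtx r (Sum.inl ⟨i, 0, hr i⟩) ∈ Q r i.succ)
    induction j using Fin.cases with
    | zero => simp at h1
    | succ j => exact congrArg Fin.succ (vtx_inl_mem_Q_succ.1 h1)

theorem Q_injective (hr : ∀ i, 0 < r i) : Function.Injective (Q r) :=
  fun _ _ h => eq_of_Q_subset hr h.le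

theorem isClique_Q (i : Fin (n + 1)) : (graph r).IsClique (Q r i : Set (Fin (2 * dim r))) :=
  fun _ hu _ hv hne => ⟨hne, i, hu, hv⟩

theorem exists_subset_Q {S : Set (Fin (2 * dim r))} (hS : (graph r).IsClique S) :
    ∃ i, S ⊆ (Q r i : Set _) := by
  by_cases h : ∃ c, vtx r (Sum.inl c) ∈ S
  · obtain ⟨c, hc⟩ := h
    refine ⟨c.1.succ, fun v hv => ?_⟩
    by_cases hne : vtx r (Sum.inl c) = v
    · rw [← hne]; exact vtx_inl_mem_Q_succ.2 rfl
    have hadj := hS hc hv hne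
    rcases exists_vtx v with ⟨c', rfl⟩ | ⟨c', rfl⟩
    · exact vtx_inl_mem_Q_succ.2 (adj_inl_inl.1 hadj).2.symm
    · exact vtx_inr_mem_Q_succ.2 (adj_inl_inr.1 hadj).symm
  · refine ⟨0, fun v hv => ?_⟩
    rcases exists_vtx v with ⟨c', rfl⟩ | ⟨c', rfl⟩
    · exact absurd ⟨c', hv⟩ h
    · exact vtx_inr_mem_Q_zero

theorem maximal_isClique_iff (hr : ∀ i, 0 < r i) (S : Set (Fin (2 * dim r))) :
    Maximal (graph r).IsClique S ↔ ∃ i, S = (Q r i : Set _) := by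
  constructor
  · intro h
    obtain ⟨i, hi⟩ := exists_subset_Q h.prop
    exact ⟨i, h.eq_of_subset (isClique_Q i) hi⟩
  · rintro ⟨i, rfl⟩
    refine ⟨isClique_Q i, fun T hT hle => ?_⟩
    obtain ⟨j, hj⟩ := exists_subset_Q hT
    rw [eq_of_Q_subset hr (Finset.coe_subset.1 (hle.trans hj))]
    exact hj

theorem maximal_isIndepSet_pair {c c' : Cell r} (h : c.1 = c'.1) :
    Maximal (graph r).IsIndepSet {vtx r (Sum.inl c), vtx r (Sum.inr c')} := by
  have hadj : ¬ (graph r).Adj (vtx r (Sum.inl c)) (vtx r (Sum.inr c')) := by simp [h]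
  refine ⟨?_, fun T hT hle v hv => ?_⟩
  · rintro _ (rfl | rfl) _ (rfl | rfl) hne
    · exact absurd rfl hne
    · exact hadj
    · exact fun h => hadj h.symm
    · exact absurd rfl hne
  · have h1 : vtx r (Sum.inl c) ∈ T := hle (Or.inl rfl)
    have h2 : vtx r (Sum.inr c') ∈ T := hle (Or.inr rfl)
    by_contra hmem
    rw [Set.mem_insert_iff, Set.mem_singleton_iff, not_or] at hmem
    rcases exists_vtx v with ⟨d, rfl⟩ | ⟨d, rfl⟩
    · have hb : d.1 = c'.1 := by
        by_contra hne
        exact hT hv h2 hmem.2 (adj_inl_inr.2 hne)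
      refine hT hv h1 hmem.1 (adj_inl_inl.2 ⟨fun hd => hmem.1 (by rw [hd]), hb.trans h.symm⟩)
    · exact hT hv h2 hmem.2 (adj_inr_inr.2 fun hd => hmem.2 (by rw [hd]))

theorem maximal_isIndepSet_range (hn : 2 ≤ n) {f : Fin n → Cell r} (hf : ∀ i, (f i).1 = i) :
    Maximal (graph r).IsIndepSet (Set.range fun i => vtx r (Sum.inl (f i))) := by
  refine ⟨?_, fun T hT hle v hv => ?_⟩
  · rintro _ ⟨i, rfl⟩ _ ⟨j, rfl⟩ hne hadj
    have h := (adj_inl_inl.1 hadj).2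
    rw [hf, hf] at h
    exact hne (by rw [h])
  · by_contra hmem
    rcases exists_vtx v with ⟨d, rfl⟩ | ⟨d, rfl⟩
    · have hne : vtx r (Sum.inl d) ≠ vtx r (Sum.inl (f d.1)) := fun h => hmem ⟨d.1, h.symm⟩
      exact hT hv (hle ⟨d.1, rfl⟩) hne (adj_inl_inl.2 ⟨fun h => hne (by rw [← h]), (hf d.1).symm⟩)
    -- A minus vertex is adjacent to the chosen plus vertex of any other block, so a second block is
    -- needed.
    · have : Nontrivial (Fin n) := Fin.nontrivial_iff_two_le.2 hn
      obtain ⟨j, hj⟩ := exists_ne d.1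
      have hadj : (graph r).Adj (vtx r (Sum.inl (f j))) (vtx r (Sum.inr d)) :=
        adj_inl_inr.2 (by rwa [hf])
      exact hT (hle ⟨j, rfl⟩) hv hadj.ne hadj

theorem maximal_isIndepSet_iff (hn : 2 ≤ n) (hr : ∀ i, 0 < r i) (S : Set (Fin (2 * dim r))) :
    Maximal (graph r).IsIndepSet S ↔
      (∃ i, ∃ v ∈ Qplus r i, ∃ v' ∈ Qminus r i, S = {v, v'}) ∨
      (∃ v : Fin n → Fin (2 * dim r), (∀ i, v i ∈ Qplus r i) ∧ S = Set.range v) := by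
  constructor
  · intro h
    have hS := h.prop
    -- In each block take the plus vertex of `S` if there is one, and an arbitrary plus vertex
    -- otherwise; maximality will show that it was in `S`.
    have hchoose : ∀ i, ∃ c : Cell r, c.1 = i ∧ ∀ d, vtx r (Sum.inl d) ∈ S → d.1 = i → d = c := by
      intro i
      by_cases hex : ∃ c : Cell r, c.1 = i ∧ vtx r (Sum.inl c) ∈ S
      · obtain ⟨c, hc, hcS⟩ := hex
        refine ⟨c, hc, fun d hd hdi => ?_⟩
        by_contra hne
        have hadj : (graph r).Adj (vtx r (Sum.inl d)) (vtx r (Sum.inl c)) :=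
          adj_inl_inl.2 ⟨hne, hdi.trans hc.symm⟩
        exact hS hd hcS hadj.ne hadj
      · exact ⟨⟨i, 0, hr i⟩, rfl, fun d hd hdi => absurd ⟨d, hdi, hd⟩ hex⟩
    choose f hf hf' using hchoose
    by_cases hex : ∃ c', vtx r (Sum.inr c') ∈ S
    · obtain ⟨c', hc'⟩ := hex
      refine Or.inl ⟨c'.1, _, vtx_inl_mem_Qplus.2 (hf c'.1), _, vtx_inr_mem_Qminus.2 rfl,
        h.eq_of_subset (maximal_isIndepSet_pair (hf c'.1)).prop fun v hv => ?_⟩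
      rcases exists_vtx v with ⟨d, rfl⟩ | ⟨d, rfl⟩
      · left
        rw [hf' c'.1 d hv]
        by_contra hne
        have hadj := adj_inl_inr.2 hne
        exact hS hv hc' hadj.ne hadj
      · right
        by_contra hne
        exact hS hv hc' hne (adj_inr_inr.2 fun hd => hne (by rw [hd]; rfl))
    · refine Or.inr ⟨_, fun i => vtx_inl_mem_Qplus.2 (hf i),
        h.eq_of_subset (maximal_isIndepSet_range hn hf).prop fun v hv => ?_⟩
      rcases exists_vtx v with ⟨d, rfl⟩ | ⟨d, rfl⟩
      · exact ⟨d.1, congrArg (fun c => vtx r (Sum.inl c)) (hf' d.1 d hv rfl).symm⟩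
      · exact absurd ⟨d, hv⟩ hex
  · rintro (⟨i, v, hv, v', hv', rfl⟩ | ⟨v, hv, rfl⟩)
    · rcases exists_vtx v with ⟨c, rfl⟩ | ⟨c, rfl⟩
      · rcases exists_vtx v' with ⟨c', rfl⟩ | ⟨c', rfl⟩
        · exact absurd hv' vtx_inl_notMem_Qminus
        · exact maximal_isIndepSet_pair
            ((vtx_inl_mem_Qplus.1 hv).trans (vtx_inr_mem_Qminus.1 hv').symm)
      · exact absurd hv vtx_inr_notMem_Qplus
    · have hex : ∀ i, ∃ c, vtx r (Sum.inl c) = v i := fun i =>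
        (exists_vtx (v i)).resolve_right fun ⟨c, hc⟩ => vtx_inr_notMem_Qplus (hc ▸ hv i)
      choose f hf using hex
      obtain rfl : (fun i => vtx r (Sum.inl (f i))) = v := funext hf
      exact maximal_isIndepSet_range hn fun i => vtx_inl_mem_Qplus.1 (hv i)

/-- All neighbours of `(i, a)^+` lie in the clique `Q_i`. -/
theorem adj_of_adj_inl {c : Cell r} {x y : Fin (2 * dim r)}
    (hx : (graph r).Adj (vtx r (Sum.inl c)) x) (hy : (graph r).Adj (vtx r (Sum.inl c)) y)
    (hne : x ≠ y) : (graph r).Adj x y := by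
  have key : ∀ z, (graph r).Adj (vtx r (Sum.inl c)) z → z ∈ Q r c.1.succ := by
    intro z hz
    rcases exists_vtx z with ⟨d, rfl⟩ | ⟨d, rfl⟩
    · exact vtx_inl_mem_Q_succ.2 (adj_inl_inl.1 hz).2.symm
    · exact vtx_inr_mem_Q_succ.2 (adj_inl_inr.1 hz).symm
  exact ⟨hne, _, key x hx, key y hy⟩

theorem isChordal_graph : IsChordal (graph r) := by
  intro u p hp h4
  by_cases h : ∃ c, vtx r (Sum.inl c) ∈ p.support
  · obtain ⟨c, hc⟩ := h
    exact exists_chord_of_isCycle hp h4 hc fun x _ y _ => adj_of_adj_inl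
  · refine exists_chord_of_isCycle hp h4 p.start_mem_support fun x hx y hy _ _ hne => ⟨hne, 0, ?_, ?_⟩
    · rcases exists_vtx x with ⟨d, rfl⟩ | ⟨d, rfl⟩
      · exact absurd ⟨d, hx⟩ h
      · exact vtx_inr_mem_Q_zero
    · rcases exists_vtx y with ⟨d, rfl⟩ | ⟨d, rfl⟩
      · exact absurd ⟨d, hy⟩ h
      · exact vtx_inr_mem_Q_zero

theorem card_le_cliqueNum_induce {V : Type*} [Finite V] {G : SimpleGraph V} {s : Set V}
    {T : Finset V} (hT : G.IsClique (T : Set V)) (hs : (T : Set V) ⊆ s) :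
    T.card ≤ (G.induce s).cliqueNum := by
  classical
  have h : (G.induce s).IsClique ((T.subtype (· ∈ s) : Finset s) : Set s) := by
    intro u hu v hv hne
    exact hT (Finset.mem_subtype.1 hu) (Finset.mem_subtype.1 hv) fun h => hne (Subtype.ext h)
  have := SimpleGraph.IsClique.card_le_cliqueNum (tc := h)
  rwa [Finset.card_subtype, Finset.filter_true_of_mem fun x hx => hs hx] at this

theorem exists_injOn_mapsTo {α : Type*} {S : Finset α} {T : Finset ℕ} (h : S.card ≤ T.card) :
    ∃ f : α → ℕ, (∀ a ∈ S, f a ∈ T) ∧ Set.InjOn f S := by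
  obtain ⟨f, hf, hinj⟩ := Set.Finite.exists_injOn_of_encard_le (s := (S : Set α)) (t := (T : Set ℕ))
    S.finite_toSet (by rw [Set.encard_coe_eq_coe_finsetCard, Set.encard_coe_eq_coe_finsetCard]
                       exact_mod_cast h)
  exact ⟨f, fun a ha => hf ha, hinj⟩

/-- Colour the minus vertices of `s` injectively, then each plus block separately, avoiding the
colours of the minus vertices of the other blocks. A plus block and those minus vertices form a
clique, so enough colours remain; different plus blocks are not adjacent and may share colours. -/
theorem isPerfect_graph : IsPerfect (graph r) := by
  classical
  intro s
  refine le_antisymm ?_ SimpleGraph.cliqueNum_le_chromaticNumber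
  set ω := ((graph r).induce s).cliqueNum
  set A : Finset (Cell r) := Finset.univ.filter fun c => vtx r (Sum.inr c) ∈ s with hA
  set B : Fin n → Finset (Cell r) := fun i =>
    Finset.univ.filter fun c => c.1 = i ∧ vtx r (Sum.inl c) ∈ s with hB
  have hAmem : ∀ c, c ∈ A ↔ vtx r (Sum.inr c) ∈ s := fun c => by simp [hA]
  have hBmem : ∀ i c, c ∈ B i ↔ c.1 = i ∧ vtx r (Sum.inl c) ∈ s := fun i c => by simp [hB]
  have hcard : ∀ T : Finset (Cell r ⊕ Cell r), (∀ u ∈ T, vtx r u ∈ s) →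
      (∀ u ∈ T, ∀ v ∈ T, u ≠ v → (graph r).Adj (vtx r u) (vtx r v)) → T.card ≤ ω := by
    intro T hs hadj
    rw [← Finset.card_map (vtx r).toEmbedding]
    refine card_le_cliqueNum_induce ?_ ?_
    · rintro u hu v hv hne
      obtain ⟨u, hu', rfl⟩ := Finset.mem_map.1 hu
      obtain ⟨v, hv', rfl⟩ := Finset.mem_map.1 hv
      exact hadj u hu' v hv' fun h => hne (by rw [h])
    · intro u hu
      obtain ⟨u, hu', rfl⟩ := Finset.mem_map.1 hu
      exact hs u hu'
  obtain ⟨f, hf, hfinj⟩ := exists_injOn_mapsTo (S := A) (T := Finset.range ω) (by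
    rw [Finset.card_range, ← Finset.card_map ⟨_, Sum.inr_injective (α := Cell r)⟩]
    refine hcard _ (fun u hu => ?_) fun u hu v hv hne => ?_
    · obtain ⟨c, hc, rfl⟩ := Finset.mem_map.1 hu
      exact (hAmem c).1 hc
    · obtain ⟨c, hc, rfl⟩ := Finset.mem_map.1 hu
      obtain ⟨d, hd, rfl⟩ := Finset.mem_map.1 hv
      exact adj_inr_inr.2 fun h => hne (by rw [h]))
  have hg : ∀ i, ∃ g : Cell r → ℕ,
      (∀ a ∈ B i, g a ∈ Finset.range ω \ (A.filter fun c => c.1 ≠ i).image f) ∧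
      Set.InjOn g (B i) := by
    intro i
    refine exists_injOn_mapsTo ?_
    have h1 : ((A.filter fun c => c.1 ≠ i).image f) ⊆ Finset.range ω := by
      intro x hx
      obtain ⟨c, hc, rfl⟩ := Finset.mem_image.1 hx
      exact hf c (Finset.mem_filter.1 hc).1
    rw [Finset.card_sdiff_of_subset h1, Finset.card_range, Finset.card_image_of_injOn
      (hfinj.mono fun c hc => (Finset.mem_filter.1 hc).1)]
    refine Nat.le_sub_of_add_le ?_
    rw [← Finset.card_disjSum]
    refine hcard _ (fun u hu => ?_) fun u hu v hv hne => ?_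
    · rcases u with c | c
      · exact ((hBmem i c).1 (Finset.inl_mem_disjSum.1 hu)).2
      · exact (hAmem c).1 (Finset.mem_filter.1 (Finset.inr_mem_disjSum.1 hu)).1
    · have hl : ∀ c, Sum.inl c ∈ (B i).disjSum (A.filter fun c => c.1 ≠ i) → c.1 = i :=
        fun c hc => ((hBmem i c).1 (Finset.inl_mem_disjSum.1 hc)).1
      have hr : ∀ c, Sum.inr c ∈ (B i).disjSum (A.filter fun c => c.1 ≠ i) → c.1 ≠ i :=
        fun c hc => (Finset.mem_filter.1 (Finset.inr_mem_disjSum.1 hc)).2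
      rcases u with c | c <;> rcases v with d | d
      · exact adj_inl_inl.2 ⟨fun h => hne (by rw [h]), (hl c hu).trans (hl d hv).symm⟩
      · exact adj_inl_inr.2 (by rw [hl c hu]; exact (hr d hv).symm)
      · exact adj_inr_inl.2 (by rw [hl d hv]; exact (hr c hu).symm)
      · exact adj_inr_inr.2 fun h => hne (by rw [h])
  choose g hg hginj using hg
  have hgmem : ∀ c, vtx r (Sum.inl c) ∈ s → c ∈ B c.1 := fun c hc => (hBmem _ c).2 ⟨rfl, hc⟩
  let col : Cell r ⊕ Cell r → ℕ := Sum.elim (fun c => g c.1 c) f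
  have hlt : ∀ u, vtx r u ∈ s → col u < ω := by
    rintro (c | c) hc
    · exact Finset.mem_range.1 (Finset.mem_sdiff.1 (hg c.1 c (hgmem c hc))).1
    · exact Finset.mem_range.1 (hf c ((hAmem c).2 hc))
  have hmix : ∀ c d, vtx r (Sum.inl c) ∈ s → vtx r (Sum.inr d) ∈ s → c.1 ≠ d.1 → g c.1 c ≠ f d := by
    intro c d hc hd hne h
    exact (Finset.mem_sdiff.1 (hg c.1 c (hgmem c hc))).2
      (Finset.mem_image.2 ⟨d, Finset.mem_filter.2 ⟨(hAmem d).2 hd, hne.symm⟩, h.symm⟩)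
  have hcol : ∀ u v, vtx r u ∈ s → vtx r v ∈ s → (graph r).Adj (vtx r u) (vtx r v) →
      col u ≠ col v := by
    rintro (c | c) (d | d) hu hv hadj
    · obtain ⟨hne, hb⟩ := adj_inl_inl.1 hadj
      intro h
      change g c.1 c = g d.1 d at h
      rw [← hb] at h
      exact hne (hginj c.1 (hgmem c hu) (hb ▸ hgmem d hv) h)
    · exact hmix c d hu hv (adj_inl_inr.1 hadj)
    · exact (hmix d c hv hu (adj_inr_inl.1 hadj)).symm
    · exact fun h => adj_inr_inr.1 hadj (hfinj ((hAmem c).2 hu) ((hAmem d).2 hv) h)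
  have hmem : ∀ v : s, vtx r ((vtx r).symm v) ∈ s := fun v => by
    rw [Equiv.apply_symm_apply]; exact v.2
  refine SimpleGraph.Colorable.chromaticNumber_le ⟨SimpleGraph.Coloring.mk
    (fun v => (⟨col ((vtx r).symm v), hlt _ (hmem v)⟩ : Fin ω)) fun {u v} hadj h => ?_⟩
  refine hcol _ _ (hmem u) (hmem v) ?_ (Fin.ext_iff.1 h)
  rw [Equiv.apply_symm_apply, Equiv.apply_symm_apply]
  exact hadj

/-- In three blocks, the minus vertices form the central triangle of a 3-sun, and the plus vertex of
each block is the tip opposite to its minus vertex. -/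
theorem not_isComparabilityGraph_graph (hn : 3 ≤ n) (hr : ∀ i, 0 < r i) :
    ¬ IsComparabilityGraph (graph r) := by
  have key : ∀ i j k : Fin n, i ≠ j → j ≠ k → i ≠ k → ¬ IsComparabilityGraph (graph r) := by
    intro i j k hij hjk hik
    refine not_isComparabilityGraph_of_sun
      (a := vtx r (Sum.inr ⟨i, 0, hr i⟩)) (b := vtx r (Sum.inr ⟨j, 0, hr j⟩))
      (c := vtx r (Sum.inr ⟨k, 0, hr k⟩)) (x := vtx r (Sum.inl ⟨i, 0, hr i⟩))
      (y := vtx r (Sum.inl ⟨j, 0, hr j⟩)) (z := vtx r (Sum.inl ⟨k, 0, hr k⟩))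
      ?_ ?_ ?_ ?_ ?_ ?_ ?_ ?_ ?_ ?_ ?_ ?_ ?_ ?_ ?_ ?_ ?_ ?_ ?_ ?_ ?_
    all_goals simp [hij, hjk, hik, hij.symm, hjk.symm, hik.symm]
  refine key ⟨0, by omega⟩ ⟨1, by omega⟩ ⟨2, by omega⟩ ?_ ?_ ?_ <;> simp

end FamilyGraph

end StabFamily

theorem proposition5p1 {k : Type*} [Field k] [IsAlgClosed k] [CharZero k]
    {n : ℕ} (hn : 3 ≤ n) (r : Fin n → ℕ) (hr : ∀ i, 0 < r i) :
    -- the maximal cliques are precisely the (distinct) sets `Q_0, …, Q_n`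
    (Function.Injective (StabFamily.Q r) ∧
      ∀ S : Set (Fin (2 * StabFamily.dim r)),
        Maximal (StabFamily.graph r).IsClique S ↔ ∃ i, S = (StabFamily.Q r i : Set _)) ∧
    -- the maximal stable sets
    (∀ S : Set (Fin (2 * StabFamily.dim r)),
      Maximal (StabFamily.graph r).IsIndepSet S ↔
        (∃ i, ∃ v ∈ StabFamily.Qplus r i, ∃ v' ∈ StabFamily.Qminus r i, S = {v, v'}) ∨
        (∃ v : Fin n → Fin (2 * StabFamily.dim r),
          (∀ i, v i ∈ StabFamily.Qplus r i) ∧ S = Set.range v)) ∧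
    -- chordal, hence perfect, but not a comparability graph, and the stable set polytope
    -- is not the chain polytope of any partial order
    (StabFamily.IsChordal (StabFamily.graph r) ∧
      StabFamily.IsPerfect (StabFamily.graph r) ∧
      ¬ StabFamily.IsComparabilityGraph (StabFamily.graph r) ∧
      ∀ P : PartialOrder (Fin (2 * StabFamily.dim r)),
        StabFamily.stabPolytope (StabFamily.graph r) ≠ StabFamily.chainPolytope P) ∧
    -- the stable set ring
    (StabFamily.IsGorenstein (StabFamily.stableSetRing k (StabFamily.graph r)) ∧
      Nonempty (StabFamily.DivisorClassGroup
        (StabFamily.stableSetRing k (StabFamily.graph r)) ≃+ (Fin n → ℤ))) ∧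
    -- the polytope `C(G)`
    StabFamily.conicPolytope (StabFamily.Q r) =
      {z : Fin n → ℝ | ∀ i, -(r i : ℝ) ≤ z i ∧ z i ≤ (r i : ℝ)} := by
  have hcomp := StabFamily.not_isComparabilityGraph_graph hn hr
  exact ⟨⟨StabFamily.Q_injective hr, StabFamily.maximal_isClique_iff hr⟩,
    StabFamily.maximal_isIndepSet_iff (by omega) hr,
    ⟨StabFamily.isChordal_graph, StabFamily.isPerfect_graph, hcomp,
      fun _ h => hcomp (StabFamily.isComparabilityGraph_of_stabPolytope_eq h)⟩,
    ⟨StabFamily.isGorenstein_stableSetRing k,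
      StabFamily.nonempty_divisorClassGroup_stableSetRing_equiv hr k⟩,
    StabFamily.conicPolytope_eq_box⟩
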